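/- Let $n\in\mathbb N$, $\hbar>0$, $1<\rho\le 2$, $\rho'=\rho/(\rho-1)$. For $x\in\mathbb R^d$ put $|x|=\max_j|x_j|$. Let $\mathcal E^\rho(\mathbb R^{d})$ be the space of smooth functions $f:\mathbb R^d\to\mathbb C$ such that for every $L>0$ $$\|f\|_L=\sup_{x,\kappa}\frac{L^{|\kappa|}|\partial^\kappa f(x)|}{(\kappa!)^{1-1/\rho}}\,e^{-|x/L|^\rho}<\infty ,$$ with the topology defined by the norms $\|\cdot\|_L$, and let $\mathcal W^\rho(\mathbb R^d)\subset\mathcal E^\rho(\mathbb R^d)$ be the subspace of the $f$ such that $|\partial^\kappa f(x)|\le C_{N,L}L^{-|\kappa|}(\kappa!)^{1-1/\rho}(1+|x|)^{-N}$ for all $L>0$, $N=0,1,2,\dots$ (and all $\kappa$, $x$). Let $\Omega=\begin{pmatrix}0&I_n\\-I_n&0\end{pmatrix}$, $\omega(x,s)=x\cdot\Omega s$, let $Q$ be a complex symmetric $2n\times 2n$ matrix, $\vartheta=Q+\frac12\Omega^{-1}$, $\widetilde Q=-\Omega Q\Omega$, and, for functions $f,g$ on $\mathbb R^{2n}$,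 $$(f\star_{\hbar\vartheta}g)(x)=\sum_{m\ge0}\frac{(i\hbar)^m}{m!}\bigl(\vartheta^{jk}\partial_{x^j}\partial_{x'^k}\bigr)^m f(x)g(x')\Big|_{x'=x}.$$ For $x=(p,q)\in\mathbb R^{2n}$ let $T_x$ be the operator on $L^2(\mathbb R^n)$ given by $(T_xu)(y)=e^{\frac i\hbar(p\cdot y-\frac12p\cdot q)}u(y-q)$, and let $\tilde f(s)=(2\pi)^{-n}\int f(x)e^{i\omega(x,s)}dx$. Let $W^{\rho'}_\rho(\mathbb R^n)$ be the space of entire functions $\psi$ on $\mathbb C^n$ with $|\psi(q+iy)|\le Ce^{-a|q|^\rho+b|y|^{\rho'}}$ for some $a,b,C>0$ depending on $\psi$, regarded as a subspace of $L^2(\mathbb R^n)$ by restriction to $\mathbb R^n$, with the locally convex inductive limit topology of the Banach spaces defined by the norms $\|\psi\|_{a,b}=\sup_{q,y}|\psi(q+iy)|e^{a|q|^\rho-b|y|^{\rho'}}$. Let $\mathcal A$ be the algebra of continuous linear operators of $W^{\rho'}_\rho(\mathbb R^n)$ into itself, with the topology of uniform convergence on bounded subsets of $W^{\rho'}_\rho(\mathbb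 R^n)$. Then $\mathcal W^\rho(\mathbb R^{2n})$ and $\mathcal E^\rho(\mathbb R^{2n})$ are closed under $\star_{\hbar\vartheta}$ (the series being convergent), and the following holds. The generalized Weyl map $$ j(f)=\frac1{(2\pi)^n}\int\tilde f(s)\,e^{\frac{i\hbar}2 s\cdot\widetilde Qs}\,T_{\hbar s}\,ds$$ (the integral converges absolutely when applied to any $u\in L^2(\mathbb R^n)$) is a homomorphism from the algebra $(\mathcal W^\rho(\mathbb R^{2n}),\star_{\hbar\vartheta})$ to the algebra of bounded operators on $L^2(\mathbb R^n)$. It extends to a continuous unital homomorphism $J$ from the algebra $(\mathcal E^\rho(\mathbb R^{2n}),\star_{\hbar\vartheta})$ to $\mathcal A$, where extension means that $J(f)\psi=j(f)\psi$ for all $f\in\mathcal W^\rho(\mathbb R^{2n})$ and $\psi\in W^{\rho'}_\rho(\mathbb R^n)$. The extension is unique, even among the continuous linear maps from $\mathcal E^\rho(\mathbb R^{2n})$ to $\mathcal A$ that extend $j$. -/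

import Mathlib

open MeasureTheory Filter Topology
open scoped ContDiff Matrix Nat

noncomputable section

namespace StarAlgebra

/-! ### Multi-indices and partial derivatives on `ℝ^ι` (with `|x| = max_j |x_j|`, the norm of `ι → ℝ`) -/

section Derivatives

variable {ι : Type} [Fintype ι] [DecidableEq ι]

/-- The iterated partial derivative `∂_{α 0} ⋯ ∂_{α (m-1)} f` at `x`. -/
def wordDeriv {m : ℕ} (α : Fin m → ι) (f : (ι → ℝ) → ℂ) (x : ι → ℝ) : ℂ :=
  iteratedFDeriv ℝ m f x (fun i => Pi.single (α i) 1)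

/-- The list in which each `j` occurs `κ j` times. (The order of the list does not matter:
the partial derivatives of a smooth function commute.) -/
def indexList (κ : ι → ℕ) : List ι :=
  (Finset.univ : Finset ι).toList.flatMap fun j => List.replicate (κ j) j

/-- The partial derivative `∂^κ f` at `x`. -/
def multiDeriv (κ : ι → ℕ) (f : (ι → ℝ) → ℂ) (x : ι → ℝ) : ℂ :=
  wordDeriv (fun i : Fin (indexList κ).length => (indexList κ).get i) f x

/-- `|κ| = ∑_j κ_j`. -/
def order (κ : ι → ℕ) : ℕ := ∑ j, κ j

/-- `κ! = ∏_j κ_j!`. -/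
def mfact (κ : ι → ℕ) : ℕ := ∏ j, (κ j)!

theorem multiDeriv_add (κ : ι → ℕ) {f g : (ι → ℝ) → ℂ} (hf : ContDiff ℝ ∞ f)
    (hg : ContDiff ℝ ∞ g) (x : ι → ℝ) :
    multiDeriv κ (f + g) x = multiDeriv κ f x + multiDeriv κ g x := by
  unfold multiDeriv wordDeriv
  rw [iteratedFDeriv_add_apply ((hf.of_le (by exact_mod_cast le_top)).contDiffAt)
    ((hg.of_le (by exact_mod_cast le_top)).contDiffAt)]
  rfl

theorem multiDeriv_smul (κ : ι → ℕ) (c : ℂ) {f : (ι → ℝ) → ℂ} (hf : ContDiff ℝ ∞ f)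
    (x : ι → ℝ) :
    multiDeriv κ (c • f) x = c * multiDeriv κ f x := by
  unfold multiDeriv wordDeriv
  rw [iteratedFDeriv_const_smul_apply ((hf.of_le (by exact_mod_cast le_top)).contDiffAt)]
  rfl

end Derivatives

theorem mfact_pos {ι : Type} [Fintype ι] (κ : ι → ℕ) : 0 < mfact κ :=
  Finset.prod_pos fun _ _ => Nat.factorial_pos _

/-- The seminorm `v ↦ sup_i |A v i|` attached to a linear map `A` into bounded families. -/
def supSeminorm {V I : Type*} [AddCommGroup V] [Module ℂ V] (A : V →ₗ[ℂ] (I → ℂ))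
    (h : ∀ v, BddAbove (Set.range fun i => ‖A v i‖)) : Seminorm ℂ V :=
  Seminorm.of (fun v => ⨆ i, ‖A v i‖)
    (fun v w => by
      refine Real.iSup_le (fun i => ?_) (add_nonneg (Real.iSup_nonneg fun i => norm_nonneg _)
        (Real.iSup_nonneg fun i => norm_nonneg _))
      rw [map_add]
      exact (norm_add_le _ _).trans (add_le_add (le_ciSup (h v) i) (le_ciSup (h w) i)))
    (fun c v => by
      simp only [map_smul, Pi.smul_apply, norm_smul]
      exact (Real.mul_iSup_of_nonneg (norm_nonneg c) _).symm)

/-! ### The space `𝓔^ρ(ℝ^ι)` and its subspace `𝒲^ρ(ℝ^ι)` -/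

section ESpace

variable (ρ : ℝ) (ι : Type) [Fintype ι] [DecidableEq ι]

/-- The smooth functions on `ℝ^ι` with
`|∂^κ f(x)| ≤ C_L L^{-|κ|} (κ!)^{1-1/ρ} e^{|x/L|^ρ}` for every `L > 0`. -/
def eSubmodule : Submodule ℂ ((ι → ℝ) → ℂ) where
  carrier := {f | ContDiff ℝ ∞ f ∧ ∀ L : ℝ, 0 < L → ∃ C : ℝ, ∀ (κ : ι → ℕ) (x : ι → ℝ),
    ‖multiDeriv κ f x‖ ≤
      C * ((L ^ order κ)⁻¹ * (mfact κ : ℝ) ^ (1 - 1 / ρ) * Real.exp ((‖x‖ / L) ^ ρ))}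
  zero_mem' := by
    refine ⟨contDiff_const, fun L _ => ⟨0, fun κ x => ?_⟩⟩
    have h : multiDeriv κ (0 : (ι → ℝ) → ℂ) x = 0 := by
      simpa using multiDeriv_smul κ 0 (f := (0 : (ι → ℝ) → ℂ)) contDiff_const x
    simp [h]
  add_mem' := by
    rintro f g ⟨hf, hf'⟩ ⟨hg, hg'⟩
    refine ⟨hf.add hg, fun L hL => ?_⟩
    obtain ⟨C, hC⟩ := hf' L hL
    obtain ⟨D, hD⟩ := hg' L hL
    refine ⟨C + D, fun κ x => ?_⟩
    rw [multiDeriv_add κ hf hg, add_mul]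
    exact (norm_add_le _ _).trans (add_le_add (hC κ x) (hD κ x))
  smul_mem' := by
    rintro c f ⟨hf, hf'⟩
    refine ⟨hf.const_smul c, fun L hL => ?_⟩
    obtain ⟨C, hC⟩ := hf' L hL
    refine ⟨‖c‖ * C, fun κ x => ?_⟩
    rw [multiDeriv_smul κ c hf, norm_mul, mul_assoc]
    exact mul_le_mul_of_nonneg_left (hC κ x) (norm_nonneg c)

/-- The vector space `𝓔^ρ(ℝ^ι)`. -/
def ESpace : Type := ↥(eSubmodule ρ ι)

instance : AddCommGroup (ESpace ρ ι) := inferInstanceAs (AddCommGroup ↥(eSubmodule ρ ι))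

instance : Module ℂ (ESpace ρ ι) := inferInstanceAs (Module ℂ ↥(eSubmodule ρ ι))

instance : CoeFun (ESpace ρ ι) (fun _ => (ι → ℝ) → ℂ) := ⟨fun f => f.1⟩

variable {ρ ι}

theorem ESpace.contDiff (f : ESpace ρ ι) : ContDiff ℝ ∞ f := f.2.1

theorem ESpace.add_coe (f g : ESpace ρ ι) : ((f + g : ESpace ρ ι) : (ι → ℝ) → ℂ) = f.1 + g.1 := rfl

theorem ESpace.smul_coe (c : ℂ) (f : ESpace ρ ι) :
    ((c • f : ESpace ρ ι) : (ι → ℝ) → ℂ) = c • f.1 := rfl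

/-- The family `(κ, x) ↦ L^{|κ|} (κ!)^{-(1-1/ρ)} e^{-|x/L|^ρ} ∂^κ f(x)`. -/
def eWeighted (L : ℝ) : ESpace ρ ι →ₗ[ℂ] ((ι → ℕ) × (ι → ℝ) → ℂ) where
  toFun f kx := ((L ^ order kx.1 / (mfact kx.1 : ℝ) ^ (1 - 1 / ρ) *
    Real.exp (-(‖kx.2‖ / L) ^ ρ) : ℝ) : ℂ) * multiDeriv kx.1 f kx.2
  map_add' f g := by
    funext kx
    simp only [ESpace.add_coe, Pi.add_apply]
    rw [multiDeriv_add _ f.2.1 g.2.1, mul_add]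
  map_smul' c f := by
    funext kx
    simp only [ESpace.smul_coe, Pi.smul_apply, RingHom.id_apply, smul_eq_mul]
    rw [multiDeriv_smul _ c f.2.1]
    ring

theorem eWeighted_bdd {L : ℝ} (hL : 0 < L) (f : ESpace ρ ι) :
    BddAbove (Set.range fun kx => ‖eWeighted L f kx‖) := by
  obtain ⟨C, hC⟩ := f.2.2 L hL
  refine ⟨C, ?_⟩
  rintro _ ⟨⟨κ, x⟩, rfl⟩
  have hm : (0 : ℝ) < (mfact κ : ℝ) ^ (1 - 1 / ρ) :=
    Real.rpow_pos_of_pos (by exact_mod_cast mfact_pos κ) _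
  have hLk : 0 < L ^ order κ := pow_pos hL _
  have hw : 0 < L ^ order κ / (mfact κ : ℝ) ^ (1 - 1 / ρ) * Real.exp (-(‖x‖ / L) ^ ρ) := by
    positivity
  change ‖((_ : ℝ) : ℂ) * multiDeriv κ f x‖ ≤ C
  rw [norm_mul, Complex.norm_real, Real.norm_of_nonneg hw.le]
  refine (mul_le_mul_of_nonneg_left (hC κ x) hw.le).trans (le_of_eq ?_)
  rw [Real.exp_neg]
  have := (Real.exp_pos ((‖x‖ / L) ^ ρ)).ne'
  field_simp

variable (ρ ι) in
/-- The norms `‖f‖_L = sup_{x,κ} L^{|κ|} |∂^κ f(x)| (κ!)^{-(1-1/ρ)} e^{-|x/L|^ρ}`, `L > 0`. -/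
def eSeminorms : SeminormFamily ℂ (ESpace ρ ι) {L : ℝ // 0 < L} :=
  fun L => supSeminorm (eWeighted L.1) (eWeighted_bdd L.2)

instance : Nonempty {L : ℝ // 0 < L} := ⟨⟨1, one_pos⟩⟩

/-- The topology of `𝓔^ρ(ℝ^ι)` is defined by the norms `‖·‖_L`, `L > 0`. -/
instance : TopologicalSpace (ESpace ρ ι) := (eSeminorms ρ ι).moduleFilterBasis.topology

variable (ρ ι) in
/-- The subspace `𝒲^ρ(ℝ^ι)` of the functions with
`|∂^κ f(x)| ≤ C_{N,L} L^{-|κ|} (κ!)^{1-1/ρ} (1+|x|)^{-N}` for all `L > 0` and `N = 0, 1, 2, …`.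
(These bounds imply the bounds that define `𝓔^ρ(ℝ^ι)`.) -/
def wSubmodule : Submodule ℂ (ESpace ρ ι) where
  carrier := {f | ∀ L : ℝ, 0 < L → ∀ N : ℕ, ∃ C : ℝ, ∀ (κ : ι → ℕ) (x : ι → ℝ),
    ‖multiDeriv κ f x‖ ≤
      C * ((L ^ order κ)⁻¹ * (mfact κ : ℝ) ^ (1 - 1 / ρ) * ((1 + ‖x‖) ^ N)⁻¹)}
  zero_mem' := by
    refine fun L _ N => ⟨0, fun κ x => ?_⟩
    have h : multiDeriv κ (0 : (ι → ℝ) → ℂ) x = 0 := by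
      simpa using multiDeriv_smul κ 0 (f := (0 : (ι → ℝ) → ℂ)) contDiff_const x
    change ‖multiDeriv κ (0 : (ι → ℝ) → ℂ) x‖ ≤ _
    simp [h]
  add_mem' := by
    intro f g hf hg L hL N
    obtain ⟨C, hC⟩ := hf L hL N
    obtain ⟨D, hD⟩ := hg L hL N
    refine ⟨C + D, fun κ x => ?_⟩
    rw [ESpace.add_coe, multiDeriv_add κ f.2.1 g.2.1, add_mul]
    exact (norm_add_le _ _).trans (add_le_add (hC κ x) (hD κ x))
  smul_mem' := by
    intro c f hf L hL N
    obtain ⟨C, hC⟩ := hf L hL N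
    refine ⟨‖c‖ * C, fun κ x => ?_⟩
    rw [ESpace.smul_coe, multiDeriv_smul κ c f.2.1, norm_mul, mul_assoc]
    exact mul_le_mul_of_nonneg_left (hC κ x) (norm_nonneg c)

end ESpace

/-! ### The star product -/

section Star

variable {ι : Type} [Fintype ι] [DecidableEq ι]

/-- The `m`-th term `(iħ)^m / m! (ϑ^{jk} ∂_{x^j} ∂_{x'^k})^m f(x) g(x') |_{x = x'}`
of the series that defines the star product. -/
def starTerm (ħ : ℝ) (ϑ : Matrix ι ι ℂ) (f g : (ι → ℝ) → ℂ) (m : ℕ) (x : ι → ℝ) : ℂ :=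
  (Complex.I * ħ) ^ m / (m ! : ℂ) * ∑ α : Fin m → ι, ∑ β : Fin m → ι,
    (∏ i, ϑ (α i) (β i)) * (wordDeriv α f x * wordDeriv β g x)

/-- `h = f ⋆_{ħϑ} g`: the series of the star product converges (absolutely) at each point,
and its sum is `h`. -/
def IsStarProduct (ħ : ℝ) (ϑ : Matrix ι ι ℂ) (f g h : (ι → ℝ) → ℂ) : Prop :=
  ∀ x, HasSum (fun m => starTerm ħ ϑ f g m x) (h x)

end Star

/-! ### The phase space `ℝ^{2n}`, points being written as `x = (p, q)` -/

/-- The index set of the coordinates `(p_1, …, p_n; q^1, …, q^n)`. -/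
abbrev PhaseIndex (n : ℕ) : Type := Fin n ⊕ Fin n

/-- The matrix `Ω = (0, I; -I, 0)` of the symplectic form. -/
def Omega (n : ℕ) (R : Type) [CommRing R] : Matrix (PhaseIndex n) (PhaseIndex n) R :=
  Matrix.fromBlocks 0 1 (-1) 0

/-- `ϑ = Q + π / 2` with `π = Ω⁻¹`. -/
def theta {n : ℕ} (Q : Matrix (PhaseIndex n) (PhaseIndex n) ℂ) :
    Matrix (PhaseIndex n) (PhaseIndex n) ℂ :=
  Q + (1 / 2 : ℂ) • (Omega n ℂ)⁻¹

/-- `Q̃ = -Ω Q Ω`. -/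
def Qtilde {n : ℕ} (Q : Matrix (PhaseIndex n) (PhaseIndex n) ℂ) :
    Matrix (PhaseIndex n) (PhaseIndex n) ℂ :=
  -(Omega n ℂ * Q * Omega n ℂ)

/-- The symplectic form `ω(x, s) = x · Ω s`. -/
def omegaForm {n : ℕ} (x s : PhaseIndex n → ℝ) : ℝ := x ⬝ᵥ (Omega n ℝ *ᵥ s)

/-- The symplectic Fourier transform `f̃(s) = (2π)^{-n} ∫ f(x) e^{i ω(x, s)} dx`. -/
def sympFourier {n : ℕ} (f : (PhaseIndex n → ℝ) → ℂ) (s : PhaseIndex n → ℝ) : ℂ :=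
  (((2 * Real.pi) ^ n : ℝ) : ℂ)⁻¹ * ∫ x, f x * Complex.exp (Complex.I * omegaForm x s)

/-! ### The standard representation of the phase space translations in `L²(ℝⁿ)` -/

/-- The Hilbert space `L²(ℝⁿ)`. -/
abbrev L2 (n : ℕ) : Type := Lp ℂ 2 (volume : Measure (Fin n → ℝ))

/-- The function `y ↦ e^{(i/ħ)(p·y - p·q/2)} u(y - q)`, where `x = (p, q)`. -/
def translateFun {n : ℕ} (ħ : ℝ) (x : PhaseIndex n → ℝ) (u : (Fin n → ℝ) → ℂ)
    (y : Fin n → ℝ) : ℂ :=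
  Complex.exp (Complex.I *
      (((((x ∘ Sum.inl) ⬝ᵥ y) - ((x ∘ Sum.inl) ⬝ᵥ (x ∘ Sum.inr)) / 2) / ħ : ℝ) : ℂ)) *
    u (y - x ∘ Sum.inr)

theorem translateFun_memLp {n : ℕ} (ħ : ℝ) (x : PhaseIndex n → ℝ) {u : (Fin n → ℝ) → ℂ}
    (hu : MemLp u 2 volume) : MemLp (translateFun ħ x u) 2 volume := by
  have h1 : MemLp (fun y => u (y - x ∘ Sum.inr)) 2 volume :=
    hu.comp_measurePreserving (measurePreserving_sub_right volume (x ∘ Sum.inr))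
  refine h1.of_le ?_ (ae_of_all _ fun y => ?_)
  · refine AEStronglyMeasurable.mul (Continuous.aestronglyMeasurable ?_) h1.1
    unfold dotProduct
    fun_prop
  · unfold translateFun
    rw [norm_mul, mul_comm Complex.I, Complex.norm_exp_ofReal_mul_I, one_mul]

/-- The operator `T_x = e^{(i/ħ)(p 𝔮 - q 𝔭)}` on `L²(ℝⁿ)`, `x = (p, q)`; here `𝔮` is the
multiplication by the coordinates and `(i/ħ) 𝔭` is the differentiation, so that
`(T_x u)(y) = e^{(i/ħ)(p·y - p·q/2)} u(y - q)`. -/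
def translateOp {n : ℕ} (ħ : ℝ) (x : PhaseIndex n → ℝ) (u : L2 n) : L2 n :=
  (translateFun_memLp ħ x (Lp.memLp u)).toLp _

/-- `s ↦ f̃(s) e^{(iħ/2) s·Q̃s} T_{ħs} u`. -/
def weylIntegrand {n : ℕ} (ħ : ℝ) (Q : Matrix (PhaseIndex n) (PhaseIndex n) ℂ)
    (f : (PhaseIndex n → ℝ) → ℂ) (u : L2 n) (s : PhaseIndex n → ℝ) : L2 n :=
  (sympFourier f s * Complex.exp (Complex.I * ħ / 2 *
      ((fun i => (s i : ℂ)) ⬝ᵥ (Qtilde Q *ᵥ fun i => (s i : ℂ))))) • translateOp ħ (ħ • s) u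

/-- `𝔣 = (2π)^{-n} ∫ f̃(s) e^{(iħ/2) s·Q̃s} T_{ħs} ds`, as an integral in the strong sense:
for each `u ∈ L²(ℝⁿ)` the `L²(ℝⁿ)`-valued integral for `𝔣 u` converges absolutely. -/
def IsWeylOperator {n : ℕ} (ħ : ℝ) (Q : Matrix (PhaseIndex n) (PhaseIndex n) ℂ)
    (f : (PhaseIndex n → ℝ) → ℂ) (A : L2 n →L[ℂ] L2 n) : Prop :=
  ∀ u : L2 n, Integrable (weylIntegrand ħ Q f u) ∧
    A u = (((2 * Real.pi) ^ n : ℝ) : ℂ)⁻¹ • ∫ s, weylIntegrand ħ Q f u s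

/-! ### The space `W^γ_ρ(ℝⁿ)` -/

section GSSpace

/-- `‖ψ‖_{a,b} ≤ M`, where `‖ψ‖_{a,b} = sup_{q,y} |ψ(q+iy)| e^{a|q|^ρ - b|y|^γ}`. -/
def GSNormLE (γ ρ : ℝ) {n : ℕ} (a b M : ℝ) (ψ : (Fin n → ℂ) → ℂ) : Prop :=
  ∀ q y : Fin n → ℝ, ‖ψ (fun j => (q j : ℂ) + Complex.I * (y j : ℂ))‖ ≤
    M * Real.exp (-(a * ‖q‖ ^ ρ) + b * ‖y‖ ^ γ)

theorem GSNormLE.nonneg {γ ρ : ℝ} {n : ℕ} {a b M : ℝ} {ψ : (Fin n → ℂ) → ℂ}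
    (h : GSNormLE γ ρ a b M ψ) : 0 ≤ M :=
  nonneg_of_mul_nonneg_left ((norm_nonneg _).trans (h 0 0)) (Real.exp_pos _)

theorem GSNormLE.mono {γ ρ : ℝ} {n : ℕ} {a b a' b' M : ℝ} {ψ : (Fin n → ℂ) → ℂ}
    (h : GSNormLE γ ρ a b M ψ) (ha : a' ≤ a) (hb : b ≤ b') : GSNormLE γ ρ a' b' M ψ := by
  intro q y
  refine (h q y).trans (mul_le_mul_of_nonneg_left (Real.exp_le_exp.2 ?_) h.nonneg)
  gcongr

theorem GSNormLE.add {γ ρ : ℝ} {n : ℕ} {a b M N : ℝ} {ψ χ : (Fin n → ℂ) → ℂ}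
    (h : GSNormLE γ ρ a b M ψ) (h' : GSNormLE γ ρ a b N χ) :
    GSNormLE γ ρ a b (M + N) (ψ + χ) := by
  intro q y
  rw [add_mul]
  exact (norm_add_le _ _).trans (add_le_add (h q y) (h' q y))

theorem GSNormLE.smul {γ ρ : ℝ} {n : ℕ} {a b M : ℝ} {ψ : (Fin n → ℂ) → ℂ} (c : ℂ)
    (h : GSNormLE γ ρ a b M ψ) : GSNormLE γ ρ a b (‖c‖ * M) (c • ψ) := by
  intro q y
  rw [Pi.smul_apply, norm_smul, mul_assoc]
  exact mul_le_mul_of_nonneg_left (h q y) (norm_nonneg c)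

variable (γ ρ : ℝ) (n : ℕ)

/-- The entire functions `ψ` on `ℂⁿ` with `|ψ(q+iy)| ≤ C e^{-a|q|^ρ + b|y|^γ}` for some positive
`a`, `b`, `C` that depend on `ψ`. -/
def gsSubmodule : Submodule ℂ ((Fin n → ℂ) → ℂ) where
  carrier := {ψ | Differentiable ℂ ψ ∧ ∃ a b C : ℝ, 0 < a ∧ 0 < b ∧ 0 < C ∧ GSNormLE γ ρ a b C ψ}
  zero_mem' := by
    refine ⟨differentiable_const 0, 1, 1, 1, one_pos, one_pos, one_pos, fun q y => ?_⟩
    simp only [Pi.zero_apply, norm_zero]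
    positivity
  add_mem' := by
    rintro ψ χ ⟨hψ, a, b, C, ha, hb, hC, h⟩ ⟨hχ, a', b', C', ha', hb', hC', h'⟩
    exact ⟨hψ.add hχ, min a a', max b b', C + C', lt_min ha ha', lt_max_of_lt_left hb,
      add_pos hC hC', (h.mono (min_le_left _ _) (le_max_left _ _)).add
        (h'.mono (min_le_right _ _) (le_max_right _ _))⟩
  smul_mem' := by
    rintro c ψ ⟨hψ, a, b, C, ha, hb, hC, h⟩
    refine ⟨hψ.const_smul c, a, b, ‖c‖ * C + 1, ha, hb, by positivity, fun q y => ?_⟩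
    exact (h.smul c q y).trans
      (mul_le_mul_of_nonneg_right (le_add_of_nonneg_right zero_le_one) (Real.exp_pos _).le)

/-- The vector space `W^γ_ρ(ℝⁿ)`; its elements are regarded as functions on `ℝⁿ` by restriction. -/
def GSSpace : Type := ↥(gsSubmodule γ ρ n)

instance : AddCommGroup (GSSpace γ ρ n) := inferInstanceAs (AddCommGroup ↥(gsSubmodule γ ρ n))

instance : Module ℂ (GSSpace γ ρ n) := inferInstanceAs (Module ℂ ↥(gsSubmodule γ ρ n))

instance : CoeFun (GSSpace γ ρ n) (fun _ => (Fin n → ℂ) → ℂ) := ⟨fun ψ => ψ.1⟩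

/-- The seminorms on `W^γ_ρ(ℝⁿ)` whose restriction to each of the Banach spaces
`W^{γ,b}_{ρ,a} = {ψ | ‖ψ‖_{a,b} < ∞}`, `a, b > 0`, is continuous. -/
def IndLimSeminorm : Type :=
  {P : Seminorm ℂ (GSSpace γ ρ n) // ∀ a b : ℝ, 0 < a → 0 < b → ∃ C : ℝ,
    ∀ (ψ : GSSpace γ ρ n) (M : ℝ), GSNormLE γ ρ a b M ψ → P ψ ≤ C * M}

instance : Nonempty (IndLimSeminorm γ ρ n) :=
  ⟨⟨0, fun _ _ _ _ => ⟨0, fun _ _ _ => by simp⟩⟩⟩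

/-- The family of all these seminorms. -/
def gsSeminorms : SeminormFamily ℂ (GSSpace γ ρ n) (IndLimSeminorm γ ρ n) := fun P => P.1

/-- The (locally convex) inductive limit topology of the Banach spaces `W^{γ,b}_{ρ,a}`: it is
defined by all the seminorms whose restrictions to these spaces are continuous. -/
instance : TopologicalSpace (GSSpace γ ρ n) := (gsSeminorms γ ρ n).moduleFilterBasis.topology

theorem gs_withSeminorms : WithSeminorms (gsSeminorms γ ρ n) := ⟨rfl⟩

instance : IsTopologicalAddGroup (GSSpace γ ρ n) := (gs_withSeminorms γ ρ n).topologicalAddGroup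

instance : ContinuousSMul ℂ (GSSpace γ ρ n) := (gs_withSeminorms γ ρ n).continuousSMul

variable {γ ρ n}

/-- The restriction of `ψ` to `ℝⁿ`. -/
def realRestrict (ψ : GSSpace γ ρ n) (q : Fin n → ℝ) : ℂ := ψ (fun j => (q j : ℂ))

theorem realRestrict_memLp (hρ : 1 < ρ) (ψ : GSSpace γ ρ n) :
    MemLp (realRestrict ψ) 2 volume := by
  obtain ⟨hd, a, b, C, ha, hb, hC, h⟩ := ψ.2
  have hcont : Continuous (realRestrict ψ) := by
    unfold realRestrict
    exact hd.continuous.comp (by fun_prop)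
  rw [memLp_two_iff_integrable_sq_norm hcont.aestronglyMeasurable]
  set k : ℕ := n + 1
  have hk : Integrable (fun q : Fin n → ℝ => (1 + ‖q‖) ^ (-(k : ℝ))) volume := by
    apply integrable_one_add_norm
    simp [k]
  refine (hk.const_mul (C ^ 2 * Real.exp (2 * a * 2 + b * 2 * ‖(0 : Fin n → ℝ)‖ ^ γ) *
    ((k ! : ℝ) / (2 * a) ^ k))).mono' (by fun_prop) (ae_of_all _ fun q => ?_)
  have h0 := h q 0
  have h1 : ‖realRestrict ψ q‖ ≤
      C * Real.exp (-(a * ‖q‖ ^ ρ) + b * ‖(0 : Fin n → ℝ)‖ ^ γ) := by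
    simpa [realRestrict] using h0
  have ht : ‖q‖ ≤ 1 + ‖q‖ ^ ρ := by
    rcases le_total ‖q‖ 1 with h | h
    · exact h.trans (le_add_of_nonneg_right (by positivity))
    · calc ‖q‖ = ‖q‖ ^ (1 : ℝ) := (Real.rpow_one _).symm
        _ ≤ ‖q‖ ^ ρ := Real.rpow_le_rpow_of_exponent_le h hρ.le
        _ ≤ _ := le_add_of_nonneg_left zero_le_one
  have hpos : 0 < 1 + ‖q‖ := by positivity
  have hexp : (2 * a * (1 + ‖q‖)) ^ k / (k ! : ℝ) ≤ Real.exp (2 * a * (1 + ‖q‖)) :=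
    Real.pow_div_factorial_le_exp _ (by positivity) k
  have hfac : (0 : ℝ) < k ! := by exact_mod_cast Nat.factorial_pos k
  have h2 : 1 ≤ Real.exp (2 * a * (1 + ‖q‖)) * ((k ! : ℝ) / (2 * a) ^ k) *
      (1 + ‖q‖) ^ (-(k : ℝ)) := by
    rw [Real.rpow_neg hpos.le, Real.rpow_natCast]
    rw [mul_pow, div_le_iff₀ hfac] at hexp
    have : 0 < (2 * a) ^ k := by positivity
    have : 0 < (1 + ‖q‖) ^ k := by positivity
    rw [← div_eq_mul_inv, le_div_iff₀ this, one_mul, ← mul_div_assoc, le_div_iff₀ (by positivity)]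
    linarith
  rw [Real.norm_of_nonneg (by positivity)]
  calc ‖realRestrict ψ q‖ ^ 2
      ≤ (C * Real.exp (-(a * ‖q‖ ^ ρ) + b * ‖(0 : Fin n → ℝ)‖ ^ γ)) ^ 2 := by gcongr
    _ = C ^ 2 * Real.exp (-(2 * a * ‖q‖ ^ ρ) + b * 2 * ‖(0 : Fin n → ℝ)‖ ^ γ) := by
        rw [mul_pow, ← Real.exp_nat_mul]; congr 2; push_cast; ring
    _ ≤ C ^ 2 * Real.exp ((2 * a * 2 + b * 2 * ‖(0 : Fin n → ℝ)‖ ^ γ) +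
          -(2 * a * (1 + ‖q‖))) := by
        refine mul_le_mul_of_nonneg_left (Real.exp_le_exp.2 ?_) (by positivity)
        nlinarith
    _ = C ^ 2 * Real.exp (2 * a * 2 + b * 2 * ‖(0 : Fin n → ℝ)‖ ^ γ) *
          Real.exp (-(2 * a * (1 + ‖q‖))) * 1 := by rw [Real.exp_add]; ring
    _ ≤ C ^ 2 * Real.exp (2 * a * 2 + b * 2 * ‖(0 : Fin n → ℝ)‖ ^ γ) *
          Real.exp (-(2 * a * (1 + ‖q‖))) * (Real.exp (2 * a * (1 + ‖q‖)) *
          ((k ! : ℝ) / (2 * a) ^ k) * (1 + ‖q‖) ^ (-(k : ℝ))) := by gcongr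
    _ = _ := by
        rw [Real.exp_neg]
        have := (Real.exp_pos (2 * a * (1 + ‖q‖))).ne'
        field_simp

/-- The embedding of `W^γ_ρ(ℝⁿ)` in `L²(ℝⁿ)`. -/
def toL2 (hρ : 1 < ρ) (ψ : GSSpace γ ρ n) : L2 n := (realRestrict_memLp hρ ψ).toLp _

end GSSpace

/-- The algebra of the operators which are defined on the subspace `W^γ_ρ(ℝⁿ)` of `L²(ℝⁿ)` and
map it continuously into itself. Its topology is the one Mathlib gives to spaces of continuous
linear maps: uniform convergence on the (von Neumann) bounded subsets of `W^γ_ρ(ℝⁿ)`. -/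
abbrev OperatorAlgebra (γ ρ : ℝ) (n : ℕ) : Type := GSSpace γ ρ n →L[ℂ] GSSpace γ ρ n

/-- `J` extends `j`: for each `f ∈ 𝒲^ρ(ℝ^{2n})`, the operators `J f` and `j f` agree on
`W^γ_ρ(ℝⁿ) ⊂ L²(ℝⁿ)`. -/
def Extends {γ ρ : ℝ} {n : ℕ} (hρ : 1 < ρ)
    (j : wSubmodule ρ (PhaseIndex n) →ₗ[ℂ] (L2 n →L[ℂ] L2 n))
    (J : ESpace ρ (PhaseIndex n) →L[ℂ] OperatorAlgebra γ ρ n) : Prop :=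
  ∀ (f : wSubmodule ρ (PhaseIndex n)) (ψ : GSSpace γ ρ n),
    toL2 hρ (J (f : ESpace ρ (PhaseIndex n)) ψ) = j f (toL2 hρ ψ)

end StarAlgebra

end

open StarAlgebra

/-!
The whole proof rests on the exponentials `e_ξ(x) = e^{i ξ·x}`, `ξ` real. With `σ = 1 - 1/ρ = 1/ρ'`,
the operator which corresponds to `e_ξ` maps an entire function `ψ` to
`G_ψ(z, ξ) = e^{i (ħ/2 ξ·Qξ + ξ_q·z + ħ/2 ξ_q·ξ_p)} ψ(z + ħ ξ_p)` (`weylKernel`). For `ψ ∈ W^{ρ'}_ρ`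
this is an entire function of `ξ` of order `ρ'`, because `ρ' ≥ 2`, and the bounds in `z` are again of
the type of `W^{ρ'}_ρ` (`exists_weylKernel_bound`). By the estimates of Cauchy, its Taylor
coefficients of order `m` are `O(B^m (m!)^{-σ})`, while the derivatives of `f ∈ 𝓔^ρ` at the origin are
`O(L^{-m} (m!)^σ)` for every `L`; hence `G_ψ(z, -i∂) f(0)` converges absolutely. This is the value of
`J(f) ψ` at `z` (`pair`, `weylMap`), and it is `G_ψ(z, ξ)` for `f = e_ξ`.

*Continuity of `J`.* The bounds are uniform on each step of the inductive limit `W^{ρ'}_ρ`, and the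
inductive limit is regular: each bounded set is bounded in one of the steps
(`exists_gsNormLE_of_isVonNBounded`).

*The star product.* For `ρ ≤ 2` the factors `(m!)^{2σ}` in the `m`-th term of the series are
compensated by `1/m!` (`factorial_rpow_le`), so that the series converges, together with the
derivatives, and `⋆` is a continuous operation on `𝓔^ρ` that preserves `𝒲^ρ` (`star_estimate`).

*Homomorphism.* A continuous functional on `𝓔^ρ` is determined by its values on the monomials, and
these are the Taylor coefficients of its values on the exponentials (`functional_eq_zero`). It
suffices therefore to compare `J(f ⋆ g)` with `J(f) J(g)` for exponentials, where the identity says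
that the phase of `G` is a primitive of the cocycle `ħ ξ·ϑη` (`weylPhase_add`).

*The map `j`.* For `f ∈ 𝒲^ρ` the transform `f̃` decreases faster than `e^{-N|s|^{ρ'}}` for every `N`,
and since the translations `T_x` are isometric and strongly continuous, the integral that defines
`j(f)` converges absolutely in `L²(ℝⁿ)`. By Fourier inversion `f` is a superposition of exponentials,
and `J` can be applied under the integral sign (`weylMap_eq_integral`); so `J` extends `j`
(`extends_weylMap`). As `W^{ρ'}_ρ` is dense in `L²(ℝⁿ)`, the homomorphism property of `j` follows from
that of `J`.

*Uniqueness.* If a continuous functional on `𝓔^ρ` vanishes on `𝒲^ρ`, then in particular it vanishes on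
the functions `∫ h(ξ) e_ξ dξ`, where `h` is a test function. So its values on the exponentials vanish,
and it is zero (`eq_zero_of_wSubmodule`).
-/


open StarAlgebra

namespace StarAlgebra

/-! ### Jets of smooth functions and the multi-index bounds -/

section Jets

/-- The iterated directional derivative `∂_{v₁} ⋯ ∂_{v_m} f` along the vectors of a list. -/
noncomputable def listDeriv {E : Type*} [NormedAddCommGroup E] [NormedSpace ℝ E]
    (f : E → ℂ) : List E → E → ℂ
  | [] => f
  | v :: l => fun x => fderiv ℝ (listDeriv f l) x v

section

variable {E : Type*} [NormedAddCommGroup E] [NormedSpace ℝ E] {f : E → ℂ}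

theorem contDiff_listDeriv (hf : ContDiff ℝ ∞ f) (l : List E) :
    ContDiff ℝ ∞ (listDeriv f l) := by
  induction l with
  | nil => exact hf
  | cons v l ih => exact (contDiff_infty_iff_fderiv.1 ih).2.clm_apply contDiff_const

theorem iteratedFDeriv_eq_listDeriv (hf : ContDiff ℝ ∞ f) {m : ℕ} (v : Fin m → E) (x : E) :
    iteratedFDeriv ℝ m f x v = listDeriv f (List.ofFn v) x := by
  induction m generalizing x with
  | zero => simp [listDeriv]
  | succ m ih =>
    rw [iteratedFDeriv_succ_apply_left, List.ofFn_succ]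
    simp only [listDeriv]
    have h1 : listDeriv f (List.ofFn fun i : Fin m => v i.succ)
        = fun y => iteratedFDeriv ℝ m f y (Fin.tail v) := by
      funext y
      rw [ih]
      rfl
    rw [h1, fderiv_continuousMultilinear_apply_const_apply]
    exact (hf.differentiable_iteratedFDeriv (by exact_mod_cast ENat.natCast_lt_top m)) x

/-- Partial derivatives of a smooth function commute. -/
theorem listDeriv_perm (hf : ContDiff ℝ ∞ f) {l l' : List E} (h : l.Perm l') :
    listDeriv f l = listDeriv f l' := by
  induction h with
  | nil => rfl
  | cons v _ ih => simp only [listDeriv, ih]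
  | swap v w l =>
    funext x
    simp only [listDeriv]
    have hg := contDiff_listDeriv hf l
    have hd : DifferentiableAt ℝ (fderiv ℝ (listDeriv f l)) x :=
      (contDiff_infty_iff_fderiv.1 hg).2.differentiable (by simp) x
    rw [fderiv_clm_apply hd (differentiableAt_const _),
      fderiv_clm_apply hd (differentiableAt_const _)]
    simpa using (hg.contDiffAt (x := x)).isSymmSndFDerivAt (by
      simpa using WithTop.coe_le_coe.2 (le_top : (2 : ℕ∞) ≤ ⊤)) w v
  | trans _ _ ih1 ih2 => exact ih1.trans ih2

end

variable {ι : Type} [Fintype ι] [DecidableEq ι]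

theorem count_indexList (κ : ι → ℕ) (j : ι) : (indexList κ).count j = κ j := by
  unfold indexList
  rw [List.count_flatMap]
  have h : (List.count j ∘ fun i => List.replicate (κ i) i) = fun i => if i = j then κ j else 0 := by
    funext i
    simp only [Function.comp, List.count_replicate]
    by_cases h : i = j <;> simp [h]
  rw [h, Finset.sum_map_toList]
  simp

omit [DecidableEq ι] in
theorem length_indexList (κ : ι → ℕ) : (indexList κ).length = order κ := by
  unfold indexList order
  rw [List.length_flatMap]
  simp

/-- Every word derivative of a smooth function is a multi-index derivative. -/
theorem exists_wordDeriv_eq_multiDeriv {m : ℕ} (α : Fin m → ι) :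
    ∃ κ : ι → ℕ, order κ = m ∧ ∀ f : (ι → ℝ) → ℂ, ContDiff ℝ ∞ f → ∀ x,
      wordDeriv α f x = multiDeriv κ f x := by
  have hp : (List.ofFn α).Perm (indexList fun j => (List.ofFn α).count j) := by
    rw [List.perm_iff_count]
    intro j
    rw [count_indexList]
  refine ⟨fun j => (List.ofFn α).count j, ?_, fun f hf x => ?_⟩
  · rw [← length_indexList, ← hp.length_eq, List.length_ofFn]
  · unfold multiDeriv wordDeriv
    rw [iteratedFDeriv_eq_listDeriv hf, iteratedFDeriv_eq_listDeriv hf]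
    refine congrFun (listDeriv_perm hf ?_) x
    have := hp.map fun j => (Pi.single j (1 : ℝ) : ι → ℝ)
    rw [List.map_ofFn] at this
    refine this.trans (List.Perm.of_eq ?_)
    conv_lhs => rw [← List.ofFn_get (indexList fun j => (List.ofFn α).count j), List.map_ofFn]
    rfl

theorem norm_wordDeriv_le {m : ℕ} (α : Fin m → ι) (f : (ι → ℝ) → ℂ) (x : ι → ℝ) :
    ‖wordDeriv α f x‖ ≤ ‖iteratedFDeriv ℝ m f x‖ := by
  refine ((iteratedFDeriv ℝ m f x).le_opNorm _).trans_eq ?_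
  rw [Finset.prod_eq_one fun i _ => by rw [Pi.norm_single, norm_one], mul_one]

/-- Expansion of a multilinear form in the coordinates. -/
theorem multilinear_eq_sum_words {m : ℕ} {𝕜 : Type*} [NontriviallyNormedField 𝕜]
    {F : Type*} [NormedAddCommGroup F] [NormedSpace 𝕜 F]
    (p : ContinuousMultilinearMap 𝕜 (fun _ : Fin m => ι → 𝕜) F) (v : Fin m → ι → 𝕜) :
    p v = ∑ α : Fin m → ι, (∏ i, v i (α i)) • p (fun i => Pi.single (α i) 1) := by
  have hv : v = fun i => ∑ j, v i j • (Pi.single j (1 : 𝕜) : ι → 𝕜) := by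
    funext i
    exact pi_eq_sum_univ' (v i)
  conv_lhs => rw [hv]
  rw [ContinuousMultilinearMap.map_sum]
  refine Finset.sum_congr rfl fun α _ => ?_
  rw [ContinuousMultilinearMap.map_smul_univ]

theorem norm_iteratedFDeriv_le_sum {m : ℕ} (f : (ι → ℝ) → ℂ) (x : ι → ℝ) :
    ‖iteratedFDeriv ℝ m f x‖ ≤ ∑ α : Fin m → ι, ‖wordDeriv α f x‖ := by
  refine ContinuousMultilinearMap.opNorm_le_bound (Finset.sum_nonneg fun _ _ => norm_nonneg _)
    fun v => ?_
  rw [multilinear_eq_sum_words, Finset.sum_mul]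
  refine (norm_sum_le _ _).trans (Finset.sum_le_sum fun α _ => ?_)
  rw [norm_smul, mul_comm, norm_prod]
  refine mul_le_mul_of_nonneg_left ?_ (norm_nonneg _)
  exact Finset.prod_le_prod (fun _ _ => norm_nonneg _) fun i _ => norm_le_pi_norm (v i) (α i)

omit [DecidableEq ι] in
theorem mfact_le (κ : ι → ℕ) : mfact κ ≤ (order κ)! :=
  Nat.le_of_dvd (Nat.factorial_pos _) (Nat.prod_factorial_dvd_factorial_sum _ _)

theorem factorial_add_le (a b : ℕ) : (a + b)! ≤ 2 ^ (a + b) * (a ! * b !) := by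
  rw [← Nat.add_choose_mul_factorial_mul_factorial a b, mul_assoc]
  exact Nat.mul_le_mul_right _ (Nat.choose_le_two_pow _ _)

/-- The converse of `mfact_le`, up to a geometric factor: `(∑ κ_j)! ≤ 2^{d|κ|} ∏ κ_j!`. -/
theorem factorial_order_le (κ : ι → ℕ) :
    (order κ)! ≤ (2 ^ Fintype.card ι) ^ order κ * mfact κ := by
  have key : ∀ s : Finset ι, (∑ j ∈ s, κ j)! ≤ (2 ^ s.card) ^ (∑ j ∈ s, κ j) * ∏ j ∈ s, (κ j)! := by
    intro s
    induction s using Finset.induction_on with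
    | empty => simp
    | insert a s ha ih =>
      rw [Finset.sum_insert ha, Finset.prod_insert ha, Finset.card_insert_of_notMem ha]
      refine (factorial_add_le _ _).trans ?_
      calc 2 ^ (κ a + ∑ j ∈ s, κ j) * ((κ a)! * (∑ j ∈ s, κ j)!)
          ≤ 2 ^ (κ a + ∑ j ∈ s, κ j) * ((κ a)! * ((2 ^ s.card) ^ (κ a + ∑ j ∈ s, κ j) *
            ∏ j ∈ s, (κ j)!)) := by
            gcongr
            refine ih.trans ?_
            gcongr
            · exact Nat.one_le_two_pow
            · omega
        _ = _ := by ring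
  simpa [order, mfact] using key Finset.univ

/-- `‖D^m f(x)‖ ≤ C L^{-m} (m!)^σ w(x)` for all `m` and `x`. -/
def JetBound (σ L C : ℝ) (w : (ι → ℝ) → ℝ) (f : (ι → ℝ) → ℂ) : Prop :=
  ∀ (m : ℕ) (x : ι → ℝ), ‖iteratedFDeriv ℝ m f x‖ ≤ C * ((L ^ m)⁻¹ * (m ! : ℝ) ^ σ * w x)

/-- Bounds of the partial derivatives give a bound of the jets, as a jet of order `m` has `d^m`
components. -/
theorem jetBound_of_multiDeriv {σ L C : ℝ} {w : (ι → ℝ) → ℝ} {f : (ι → ℝ) → ℂ}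
    (hσ : 0 ≤ σ) (hL : 0 < L) (hC : 0 ≤ C) (hw : ∀ x, 0 ≤ w x) (hf : ContDiff ℝ ∞ f)
    (h : ∀ κ x, ‖multiDeriv κ f x‖ ≤
      C * ((L ^ order κ)⁻¹ * (mfact κ : ℝ) ^ σ * w x)) :
    JetBound σ (L / (Fintype.card ι + 1)) C w f := by
  intro m x
  refine (norm_iteratedFDeriv_le_sum f x).trans ?_
  have h1 : ∀ α : Fin m → ι, ‖wordDeriv α f x‖ ≤ C * ((L ^ m)⁻¹ * (m ! : ℝ) ^ σ * w x) := by
    intro α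
    obtain ⟨κ, hκ, hα⟩ := exists_wordDeriv_eq_multiDeriv α
    rw [hα f hf]
    refine (h κ x).trans ?_
    rw [hκ]
    have := hw x
    have h2 : (mfact κ : ℝ) ≤ m ! := by exact_mod_cast hκ ▸ mfact_le κ
    gcongr
  refine (Finset.sum_le_sum fun α _ => h1 α).trans ?_
  rw [Finset.sum_const, nsmul_eq_mul, Finset.card_univ, Fintype.card_fun, Fintype.card_fin]
  push_cast
  rw [div_pow, inv_div]
  have := hw x
  calc (Fintype.card ι : ℝ) ^ m * (C * ((L ^ m)⁻¹ * (m ! : ℝ) ^ σ * w x))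
      ≤ ((Fintype.card ι : ℝ) + 1) ^ m * (C * ((L ^ m)⁻¹ * (m ! : ℝ) ^ σ * w x)) := by
        gcongr; linarith
    _ = _ := by rw [div_eq_mul_inv]; ring

/-- A bound of the jets gives bounds of the partial derivatives; the factor `2^d` comes from the
comparison of `|κ|!` with `κ!`. -/
theorem JetBound.multiDeriv_le {σ L C : ℝ} {w : (ι → ℝ) → ℝ} {f : (ι → ℝ) → ℂ}
    (hσ : 0 ≤ σ) (hσ1 : σ ≤ 1) (hL : 0 < L) (hC : 0 ≤ C) (hw : ∀ x, 0 ≤ w x)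
    (h : JetBound σ L C w f) (κ : ι → ℕ) (x : ι → ℝ) :
    ‖multiDeriv κ f x‖ ≤
      C * (((L / 2 ^ Fintype.card ι) ^ order κ)⁻¹ * (mfact κ : ℝ) ^ σ * w x) := by
  have h1 : ‖multiDeriv κ f x‖ ≤ C * ((L ^ order κ)⁻¹ * ((order κ)! : ℝ) ^ σ * w x) := by
    refine (norm_wordDeriv_le _ _ _).trans ?_
    rw [← length_indexList]
    exact h _ x
  refine h1.trans ?_
  have h2 : ((order κ)! : ℝ) ^ σ ≤ (2 ^ Fintype.card ι) ^ order κ * (mfact κ : ℝ) ^ σ := by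
    have h3 : ((order κ)! : ℝ) ≤ (2 ^ Fintype.card ι) ^ order κ * (mfact κ : ℝ) := by
      exact_mod_cast factorial_order_le κ
    refine (Real.rpow_le_rpow (by positivity) h3 hσ).trans ?_
    rw [Real.mul_rpow (by positivity) (by positivity)]
    gcongr
    refine (Real.rpow_le_rpow_of_exponent_le ?_ hσ1).trans_eq (Real.rpow_one _)
    exact one_le_pow₀ (one_le_pow₀ one_le_two)
  have := hw x
  calc C * ((L ^ order κ)⁻¹ * ((order κ)! : ℝ) ^ σ * w x)
      ≤ C * ((L ^ order κ)⁻¹ * ((2 ^ Fintype.card ι) ^ order κ * (mfact κ : ℝ) ^ σ) * w x) := by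
        gcongr
    _ = _ := by rw [div_pow, inv_div, div_eq_mul_inv]; ring

end Jets

/-! ### Termwise differentiation of locally convergent series -/

section LocalSeries

variable {𝕜 E F : Type*} [RCLike 𝕜] [NormedAddCommGroup E] [NormedSpace 𝕜 E]
  [NormedAddCommGroup F] [NormedSpace 𝕜 F] [CompleteSpace F]

theorem hasFDerivAt_tsum_of_locally {f : ℕ → E → F} (hf : ∀ i, Differentiable 𝕜 (f i))
    (h0 : ∀ x, Summable fun i => f i x)
    (h1 : ∀ R : ℝ, ∃ u : ℕ → ℝ, Summable u ∧ ∀ i x, ‖x‖ < R → ‖fderiv 𝕜 (f i) x‖ ≤ u i) (x : E) :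
    HasFDerivAt (fun y => ∑' i, f i y) (∑' i, fderiv 𝕜 (f i) x) x := by
  obtain ⟨u, hu, hb⟩ := h1 (‖x‖ + 1)
  have hx : x ∈ Metric.ball (0 : E) (‖x‖ + 1) := by simp
  let _ : NormedSpace ℝ E := NormedSpace.restrictScalars ℝ 𝕜 E
  exact hasFDerivAt_tsum_of_isPreconnected hu Metric.isOpen_ball
    (convex_ball (0 : E) (‖x‖ + 1)).isPreconnected (fun i y _ => (hf i y).hasFDerivAt)
    (fun i y hy => hb i y (by simpa using hy)) hx (h0 x) hx

/-- If the series of the derivatives of each order converge normally on bounded sets, then the sum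
is smooth and can be differentiated termwise. -/
theorem contDiff_tsum_of_locally {f : ℕ → E → F} (hf : ∀ i, ContDiff 𝕜 ∞ (f i))
    (hb : ∀ (k : ℕ) (R : ℝ), ∃ u : ℕ → ℝ, Summable u ∧
      ∀ i x, ‖x‖ < R → ‖iteratedFDeriv 𝕜 k (f i) x‖ ≤ u i) :
    ContDiff 𝕜 ∞ (fun x => ∑' i, f i x) ∧
      ∀ k x, iteratedFDeriv 𝕜 k (fun y => ∑' i, f i y) x = ∑' i, iteratedFDeriv 𝕜 k (f i) x := by
  have hs : ∀ k x, Summable fun i => iteratedFDeriv 𝕜 k (f i) x := by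
    intro k x
    obtain ⟨u, hu, h⟩ := hb k (‖x‖ + 1)
    exact .of_norm_bounded hu fun i => h i x (by simp)
  have hd : ∀ (k i : ℕ), Differentiable 𝕜 (iteratedFDeriv 𝕜 k (f i)) := fun k i =>
    (hf i).differentiable_iteratedFDeriv (by exact_mod_cast ENat.natCast_lt_top k)
  have hD : ∀ k x, HasFDerivAt (fun y => ∑' i, iteratedFDeriv 𝕜 k (f i) y)
      (∑' i, fderiv 𝕜 (iteratedFDeriv 𝕜 k (f i)) x) x := by
    intro k x
    refine hasFDerivAt_tsum_of_locally (fun i => hd k i) (fun x => hs k x) (fun R => ?_) x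
    obtain ⟨u, hu, h⟩ := hb (k + 1) R
    exact ⟨u, hu, fun i x hx => by rw [norm_fderiv_iteratedFDeriv]; exact h i x hx⟩
  have key : ∀ k, iteratedFDeriv 𝕜 k (fun y => ∑' i, f i y)
      = fun x => ∑' i, iteratedFDeriv 𝕜 k (f i) x := by
    intro k
    induction k with
    | zero =>
      ext1 x
      simp_rw [iteratedFDeriv_zero_eq_comp]
      exact (continuousMultilinearCurryFin0 𝕜 E F).symm.toContinuousLinearEquiv.map_tsum
    | succ k ih =>
      funext x
      simp_rw [iteratedFDeriv_succ_eq_comp_left, ih, Function.comp_apply]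
      rw [(hD k x).fderiv]
      exact (continuousMultilinearCurryLeftEquiv 𝕜
        (fun _ : Fin (k + 1) => E) F).symm.toContinuousLinearEquiv.map_tsum
  refine ⟨contDiff_of_differentiable_iteratedFDeriv fun k _ => ?_, fun k x => by rw [key]⟩
  rw [key]
  exact fun x => (hD k x).differentiableAt

end LocalSeries

/-! ### Estimates for the star product -/

section StarEstimates

theorem norm_iteratedFDeriv_listDeriv_le {E : Type*} [NormedAddCommGroup E] [NormedSpace ℝ E]
    {f : E → ℂ} (hf : ContDiff ℝ ∞ f) (l : List E) (hl : ∀ v ∈ l, ‖v‖ ≤ 1) (k : ℕ) (x : E) :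
    ‖iteratedFDeriv ℝ k (listDeriv f l) x‖ ≤ ‖iteratedFDeriv ℝ (k + l.length) f x‖ := by
  induction l generalizing k with
  | nil => exact le_rfl
  | cons v l ih =>
    have hg := contDiff_listDeriv hf l
    have h1 : listDeriv f (v :: l) =
        (ContinuousLinearMap.apply ℝ ℂ v) ∘ fderiv ℝ (listDeriv f l) := rfl
    rw [h1]
    refine ((ContinuousLinearMap.apply ℝ ℂ v).norm_iteratedFDeriv_comp_left
      (contDiff_infty_iff_fderiv.1 hg).2.contDiffAt (by exact_mod_cast le_top)).trans ?_
    have h2 : ‖ContinuousLinearMap.apply ℝ ℂ v‖ ≤ 1 := by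
      refine ContinuousLinearMap.opNorm_le_bound _ zero_le_one fun T => ?_
      rw [ContinuousLinearMap.apply_apply, one_mul]
      refine (T.le_opNorm v).trans ?_
      exact mul_le_of_le_one_right (norm_nonneg _) (hl v (by simp))
    refine (mul_le_of_le_one_left (norm_nonneg _) h2).trans ?_
    rw [norm_iteratedFDeriv_fderiv]
    refine (ih (fun w hw => hl w (by simp [hw])) (k + 1)).trans_eq ?_
    rw [List.length_cons, add_right_comm, add_assoc]

variable {ι : Type} [Fintype ι] [DecidableEq ι]

theorem wordDeriv_eq_listDeriv {f : (ι → ℝ) → ℂ} (hf : ContDiff ℝ ∞ f) {m : ℕ} (α : Fin m → ι) :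
    wordDeriv α f = listDeriv f (List.ofFn fun i => Pi.single (α i) (1 : ℝ)) := by
  funext x
  exact iteratedFDeriv_eq_listDeriv hf _ x

theorem contDiff_wordDeriv {f : (ι → ℝ) → ℂ} (hf : ContDiff ℝ ∞ f) {m : ℕ} (α : Fin m → ι) :
    ContDiff ℝ ∞ (wordDeriv α f) := by
  rw [wordDeriv_eq_listDeriv hf]
  exact contDiff_listDeriv hf _

theorem norm_iteratedFDeriv_wordDeriv_le {f : (ι → ℝ) → ℂ} (hf : ContDiff ℝ ∞ f) {m : ℕ}
    (α : Fin m → ι) (k : ℕ) (x : ι → ℝ) :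
    ‖iteratedFDeriv ℝ k (wordDeriv α f) x‖ ≤ ‖iteratedFDeriv ℝ (k + m) f x‖ := by
  rw [wordDeriv_eq_listDeriv hf]
  refine (norm_iteratedFDeriv_listDeriv_le hf _ (fun v hv => ?_) k x).trans_eq ?_
  · rw [List.mem_ofFn] at hv
    obtain ⟨i, rfl⟩ := hv
    rw [Pi.norm_single, norm_one]
  · rw [List.length_ofFn]

/-- The inequality for factorials behind the convergence of the star product; it is here that
`σ ≤ 1/2`, that is, `ρ ≤ 2`, is needed. -/
theorem factorial_rpow_le {σ : ℝ} (hσ : 0 ≤ σ) (hσ2 : σ ≤ 1 / 2) (m i j : ℕ) :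
    ((i + m)! : ℝ) ^ σ * ((j + m)! : ℝ) ^ σ ≤ 16 ^ m * 2 ^ (i + j) * m ! * ((i + j)! : ℝ) ^ σ := by
  have h1 : (i + m)! * (j + m)! ≤ 16 ^ m * 2 ^ (i + j) * (m ! * m !) * (i + j)! := by
    have ha : (i + m)! * (j + m)! ≤ ((m + m) + (i + j))! := by
      refine (Nat.le_of_dvd (Nat.factorial_pos _)
        (Nat.factorial_mul_factorial_dvd_factorial_add (i + m) (j + m))).trans_eq ?_
      congr 1
      omega
    refine (ha.trans (factorial_add_le _ _)).trans ?_
    calc 2 ^ (m + m + (i + j)) * ((m + m)! * (i + j)!)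
        ≤ 2 ^ (m + m + (i + j)) * ((2 ^ (m + m) * (m ! * m !)) * (i + j)!) := by
          gcongr; exact factorial_add_le _ _
      _ = _ := by
        rw [show (16 : ℕ) = 2 ^ 4 by norm_num, ← pow_mul]
        ring
  rw [← Real.mul_rpow (by positivity) (by positivity)]
  have h2 : ((i + m)! : ℝ) * ((j + m)! : ℝ) ≤ (16 ^ m * 2 ^ (i + j)) * (m ! * m !) * (i + j)! := by
    exact_mod_cast h1
  refine (Real.rpow_le_rpow (by positivity) h2 hσ).trans ?_
  rw [Real.mul_rpow (by positivity) (by positivity), Real.mul_rpow (by positivity) (by positivity)]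
  gcongr
  · refine (Real.rpow_le_rpow_of_exponent_le ?_ (hσ2.trans (by norm_num))).trans_eq
      (Real.rpow_one _)
    have : (1 : ℝ) ≤ 16 ^ m := one_le_pow₀ (by norm_num)
    have : (1 : ℝ) ≤ 2 ^ (i + j) := one_le_pow₀ (by norm_num)
    nlinarith
  · have h3 : (1 : ℝ) ≤ m ! := by exact_mod_cast Nat.one_le_iff_ne_zero.2 (Nat.factorial_ne_zero m)
    refine (Real.rpow_le_rpow_of_exponent_le (by nlinarith) hσ2).trans_eq ?_
    rw [← Real.sqrt_eq_rpow, Real.sqrt_mul_self (by positivity)]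

/-- The constant `16 |ħ| ∑_{j,k} |ϑ^{jk}|`, which governs the convergence of the star product. -/
noncomputable def starConst (ħ : ℝ) (ϑ : Matrix ι ι ℂ) : ℝ := 16 * (|ħ| * ∑ j, ∑ k, ‖ϑ j k‖)

omit [DecidableEq ι] in
theorem starConst_nonneg (ħ : ℝ) (ϑ : Matrix ι ι ℂ) : 0 ≤ starConst ħ ϑ := by
  unfold starConst; positivity

omit [DecidableEq ι] in
theorem sum_words_prod {R : Type*} [CommRing R] (A : ι → ι → R) (m : ℕ) :
    ∑ α : Fin m → ι, ∑ β : Fin m → ι, ∏ i, A (α i) (β i) = (∑ j, ∑ k, A j k) ^ m := by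
  have h1 : ∀ α : Fin m → ι, ∑ β : Fin m → ι, ∏ i, A (α i) (β i) = ∏ i, ∑ k, A (α i) k :=
    fun α => (Fintype.prod_sum fun i k => A (α i) k).symm
  simp_rw [h1]
  rw [← Fintype.prod_sum fun (_ : Fin m) j => ∑ k, A j k, Finset.prod_const, Finset.card_univ,
    Fintype.card_fin]

theorem contDiff_starTerm (ħ : ℝ) (ϑ : Matrix ι ι ℂ) {f g : (ι → ℝ) → ℂ} (hf : ContDiff ℝ ∞ f)
    (hg : ContDiff ℝ ∞ g) (m : ℕ) : ContDiff ℝ ∞ (starTerm ħ ϑ f g m) := by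
  unfold starTerm
  refine contDiff_const.mul (ContDiff.sum fun α _ => ContDiff.sum fun β _ => contDiff_const.mul ?_)
  exact (contDiff_wordDeriv hf α).mul (contDiff_wordDeriv hg β)

/-- The `m`-th term of the star product is bounded, with all its derivatives, by the `m`-th term of
a geometric series with the ratio `starConst ħ ϑ / L²`. -/
theorem norm_iteratedFDeriv_starTerm_le {σ L Cf Cg : ℝ} (hσ : 0 ≤ σ) (hσ2 : σ ≤ 1 / 2) (hL : 0 < L)
    (hCf : 0 ≤ Cf) (hCg : 0 ≤ Cg) {u v : (ι → ℝ) → ℝ} (hu : ∀ x, 0 ≤ u x) (hv : ∀ x, 0 ≤ v x)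
    (ħ : ℝ) (ϑ : Matrix ι ι ℂ) {f g : (ι → ℝ) → ℂ} (hf : ContDiff ℝ ∞ f)
    (hg : ContDiff ℝ ∞ g) (hbf : JetBound σ L Cf u f) (hbg : JetBound σ L Cg v g) (m k : ℕ)
    (x : ι → ℝ) :
    ‖iteratedFDeriv ℝ k (starTerm ħ ϑ f g m) x‖ ≤
      (starConst ħ ϑ / L ^ 2) ^ m *
        (Cf * Cg * (((L / 4) ^ k)⁻¹ * (k ! : ℝ) ^ σ * (u x * v x))) := by
  have hux := hu x
  have hvx := hv x
  set B : ℝ := 16 ^ m * m ! * (L ^ (2 * m))⁻¹ *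
    (Cf * Cg * (((L / 4) ^ k)⁻¹ * (k ! : ℝ) ^ σ * (u x * v x))) with hB
  -- the Leibniz rule for the product of two word derivatives; the binomial coefficients sum up to `2^k`,
  -- which together with the factor `2^k` from `factorial_rpow_le` turns `L` into `L / 4`
  have hprod : ∀ α β : Fin m → ι,
      ‖iteratedFDeriv ℝ k (fun y => wordDeriv α f y * wordDeriv β g y) x‖ ≤ B := by
    intro α β
    refine (norm_iteratedFDeriv_mul_le (contDiff_wordDeriv hf α)
      (contDiff_wordDeriv hg β) x (by exact_mod_cast le_top)).trans ?_
    have hterm : ∀ i ∈ Finset.range (k + 1), (k.choose i : ℝ) *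
        ‖iteratedFDeriv ℝ i (wordDeriv α f) x‖ * ‖iteratedFDeriv ℝ (k - i) (wordDeriv β g) x‖ ≤
        (k.choose i : ℝ) * (16 ^ m * 2 ^ k * m ! * (k ! : ℝ) ^ σ * (L ^ (2 * m + k))⁻¹ *
          (Cf * Cg * (u x * v x))) := by
      intro i hi
      have hik : i + (k - i) = k := Nat.add_sub_cancel' (Nat.lt_succ_iff.1 (Finset.mem_range.1 hi))
      rw [mul_assoc]
      refine mul_le_mul_of_nonneg_left ?_ (Nat.cast_nonneg _)
      calc ‖iteratedFDeriv ℝ i (wordDeriv α f) x‖ * ‖iteratedFDeriv ℝ (k - i) (wordDeriv β g) x‖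
          ≤ (Cf * ((L ^ (i + m))⁻¹ * ((i + m)! : ℝ) ^ σ * u x)) *
            (Cg * ((L ^ (k - i + m))⁻¹ * ((k - i + m)! : ℝ) ^ σ * v x)) := by
            refine mul_le_mul ((norm_iteratedFDeriv_wordDeriv_le hf α i x).trans (hbf _ x))
              ((norm_iteratedFDeriv_wordDeriv_le hg β _ x).trans (hbg _ x)) (norm_nonneg _)
              (by positivity)
        _ = (((i + m)! : ℝ) ^ σ * ((k - i + m)! : ℝ) ^ σ) * (L ^ (2 * m + k))⁻¹ *
            (Cf * Cg * (u x * v x)) := by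
            have : 2 * m + k = (i + m) + (k - i + m) := by omega
            rw [this, pow_add L, mul_inv]
            ring
        _ ≤ _ := by
            have := factorial_rpow_le hσ hσ2 m i (k - i)
            rw [hik] at this
            gcongr
    refine (Finset.sum_le_sum hterm).trans_eq ?_
    rw [← Finset.sum_mul]
    have : ∑ i ∈ Finset.range (k + 1), (k.choose i : ℝ) = 2 ^ k := by
      exact_mod_cast Nat.sum_range_choose k
    rw [this, hB, div_pow, inv_div, pow_add, mul_inv, show (4 : ℝ) = 2 * 2 by norm_num, mul_pow]
    field_simp
  have hsm : ∀ α β : Fin m → ι, ContDiff ℝ ∞ fun y => wordDeriv α f y * wordDeriv β g y :=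
    fun α β => (contDiff_wordDeriv hf α).mul (contDiff_wordDeriv hg β)
  have hle : ∀ {h : (ι → ℝ) → ℂ}, ContDiff ℝ ∞ h → ContDiffAt ℝ k h x := fun h =>
    (h.of_le (by exact_mod_cast le_top)).contDiffAt
  have heq : starTerm ħ ϑ f g m = ((Complex.I * ħ) ^ m / (m ! : ℂ)) •
      fun y => ∑ α : Fin m → ι, ∑ β : Fin m → ι,
        (∏ i, ϑ (α i) (β i)) • (wordDeriv α f y * wordDeriv β g y) := rfl
  rw [heq, iteratedFDeriv_const_smul_apply (hle (ContDiff.sum fun α _ => ContDiff.sum fun β _ =>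
    (hsm α β).const_smul _)), norm_smul]
  have h1 : ‖iteratedFDeriv ℝ k (fun y => ∑ α : Fin m → ι, ∑ β : Fin m → ι,
        (∏ i, ϑ (α i) (β i)) • (wordDeriv α f y * wordDeriv β g y)) x‖ ≤
      (∑ j, ∑ l, ‖ϑ j l‖) ^ m * B := by
    rw [iteratedFDeriv_fun_sum_apply fun α _ => hle (ContDiff.sum fun β _ =>
      (hsm α β).const_smul _)]
    rw [← sum_words_prod, Finset.sum_mul]
    refine norm_sum_le_of_le _ fun α _ => ?_
    rw [iteratedFDeriv_fun_sum_apply fun β _ => hle ((hsm α β).const_smul _), Finset.sum_mul]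
    refine norm_sum_le_of_le _ fun β _ => ?_
    rw [iteratedFDeriv_const_smul_apply' (hle (hsm α β)), norm_smul, norm_prod]
    exact mul_le_mul_of_nonneg_left (hprod α β) (by positivity)
  refine (mul_le_mul_of_nonneg_left h1 (norm_nonneg _)).trans_eq ?_
  rw [norm_div, norm_pow, norm_mul, Complex.norm_I, one_mul, Complex.norm_real, Real.norm_eq_abs,
    Complex.norm_natCast, hB, starConst, div_pow _ (L ^ 2) m, mul_pow, mul_pow, ← pow_mul]
  have : (m ! : ℝ) ≠ 0 := by exact_mod_cast Nat.factorial_ne_zero m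
  field_simp

/-- The star product of two functions converges if their jets are bounded by
`L^{-m} (m!)^σ` with large enough `L`, and it satisfies a bound of the same kind. -/
theorem star_estimate {σ L Cf Cg : ℝ} (hσ : 0 ≤ σ) (hσ2 : σ ≤ 1 / 2) (hL : 0 < L)
    (hCf : 0 ≤ Cf) (hCg : 0 ≤ Cg) {u v : (ι → ℝ) → ℝ} (hu : ∀ x, 0 ≤ u x) (hv : ∀ x, 0 ≤ v x)
    (huv : ∀ R : ℝ, ∃ D : ℝ, ∀ x, ‖x‖ < R → u x * v x ≤ D)
    (ħ : ℝ) (ϑ : Matrix ι ι ℂ) (hL2 : starConst ħ ϑ / L ^ 2 ≤ 1 / 2)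
    {f g : (ι → ℝ) → ℂ} (hf : ContDiff ℝ ∞ f)
    (hg : ContDiff ℝ ∞ g) (hbf : JetBound σ L Cf u f) (hbg : JetBound σ L Cg v g) :
    IsStarProduct ħ ϑ f g (fun x => ∑' m, starTerm ħ ϑ f g m x) ∧
    ContDiff ℝ ∞ (fun x => ∑' m, starTerm ħ ϑ f g m x) ∧
    JetBound σ (L / 4) (2 * (Cf * Cg)) (fun x => u x * v x)
      (fun x => ∑' m, starTerm ħ ϑ f g m x) := by
  have hr0 : 0 ≤ starConst ħ ϑ / L ^ 2 := div_nonneg (starConst_nonneg _ _) (by positivity)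
  have hr1 : starConst ħ ϑ / L ^ 2 < 1 := by linarith
  have hgeo := summable_geometric_of_lt_one hr0 hr1
  have hb := norm_iteratedFDeriv_starTerm_le hσ hσ2 hL hCf hCg hu hv ħ ϑ hf hg hbf hbg
  obtain ⟨hsm, hder⟩ := contDiff_tsum_of_locally (𝕜 := ℝ) (f := starTerm ħ ϑ f g)
    (contDiff_starTerm ħ ϑ hf hg) (by
      intro k R
      obtain ⟨D, hD⟩ := huv R
      refine ⟨fun m => (starConst ħ ϑ / L ^ 2) ^ m *
        (Cf * Cg * (((L / 4) ^ k)⁻¹ * (k ! : ℝ) ^ σ * D)), hgeo.mul_right _, fun m x hx => ?_⟩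
      refine (hb m k x).trans ?_
      have := hD x hx
      have : 0 ≤ (starConst ħ ϑ / L ^ 2) ^ m := pow_nonneg hr0 m
      dsimp only
      gcongr)
  refine ⟨fun x => Summable.hasSum ?_, hsm, fun k x => ?_⟩
  · refine .of_norm_bounded (hgeo.mul_right
      (Cf * Cg * (((L / 4) ^ 0)⁻¹ * (0 ! : ℝ) ^ σ * (u x * v x)))) fun m => ?_
    refine le_trans ?_ (hb m 0 x)
    rw [norm_iteratedFDeriv_zero]
  · rw [hder]
    have hux := hu x
    have hvx := hv x
    refine tsum_of_norm_bounded (hgeo.hasSum.mul_right _) (fun m => hb m k x) |>.trans ?_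
    rw [tsum_geometric_of_lt_one hr0 hr1, mul_assoc 2]
    refine mul_le_mul_of_nonneg_right ?_ (by positivity)
    rw [inv_le_comm₀ (by linarith) two_pos]
    linarith

end StarEstimates

/-! ### Entire functions of several complex variables -/

section SeveralVariables

/-- Taylor coefficients along a line. -/
theorem iteratedDeriv_comp_smul {𝕜 E F : Type*} [NontriviallyNormedField 𝕜]
    [NormedAddCommGroup E] [NormedSpace 𝕜 E] [NormedAddCommGroup F] [NormedSpace 𝕜 F]
    {f : E → F} (hf : ContDiff 𝕜 ∞ f) (m : ℕ) (v : E) (t : 𝕜) :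
    iteratedDeriv m (fun s : 𝕜 => f (s • v)) t = iteratedFDeriv 𝕜 m f (t • v) fun _ => v := by
  have h := (ContinuousLinearMap.toSpanSingleton 𝕜 v).iteratedFDeriv_comp_right hf t
    (i := m) (by exact_mod_cast le_top)
  have h2 : (f ∘ ContinuousLinearMap.toSpanSingleton 𝕜 v) = fun s : 𝕜 => f (s • v) := by
    funext s; simp
  rw [h2] at h
  rw [iteratedDeriv_eq_iteratedFDeriv, h]
  simp

section

variable {E : Type*} [NormedAddCommGroup E] [NormedSpace ℂ E]

/-- Cauchy's estimate for the differential. -/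
theorem norm_fderiv_le_of_bounded {F : Type*} [NormedAddCommGroup F] [NormedSpace ℂ F]
    {f : E → F} (hf : Differentiable ℂ f) {x : E} {R M : ℝ} (hR : 0 < R)
    (hM : ∀ y, ‖y - x‖ ≤ R → ‖f y‖ ≤ M) : ‖fderiv ℂ f x‖ ≤ M / R := by
  have hM0 : 0 ≤ M := (norm_nonneg _).trans (hM x (by simpa using hR.le))
  refine ContinuousLinearMap.opNorm_le_bound _ (by positivity) fun v => ?_
  rcases eq_or_ne v 0 with rfl | hv
  · simp
  have hv' : 0 < ‖v‖ := norm_pos_iff.2 hv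
  have hg : Differentiable ℂ fun t : ℂ => f (x + t • v) := by fun_prop
  have hd : deriv (fun t : ℂ => f (x + t • v)) 0 = fderiv ℂ f x v := by
    have h1 : HasFDerivAt f (fderiv ℂ f x) (x + (0 : ℂ) • v) := by
      simpa using (hf x).hasFDerivAt
    have h2 : HasDerivAt (fun t : ℂ => x + t • v) v 0 := by
      simpa using ((hasDerivAt_id (0 : ℂ)).smul_const v).const_add x
    exact (h1.comp_hasDerivAt (0 : ℂ) h2).deriv
  rw [← hd]
  refine (Complex.norm_deriv_le_of_forall_mem_sphere_norm_le (R := R / ‖v‖) (C := M)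
    (by positivity) hg.diffContOnCl fun t ht => hM _ ?_).trans_eq (by field_simp)
  rw [mem_sphere_zero_iff_norm] at ht
  rw [add_sub_cancel_left, norm_smul, ht]
  exact (div_mul_cancel₀ _ hv'.ne').le

variable [FiniteDimensional ℂ E]

/-- The derivatives of an entire function are entire: by Cauchy's formula on the line `x + t v`, the
derivative is a circle integral that depends holomorphically on `x`. -/
theorem differentiable_fderiv_apply {f : E → ℂ} (hf : Differentiable ℂ f) (v : E) :
    Differentiable ℂ fun x => fderiv ℂ f x v := by
  let _ : MeasurableSpace E := borel E
  have : BorelSpace E := ⟨rfl⟩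
  have : ProperSpace E := FiniteDimensional.proper ℂ E
  have : ProperSpace (E →L[ℂ] ℂ) := FiniteDimensional.proper ℂ _
  have hform : ∀ x, fderiv ℂ f x v = (2 * Real.pi * Complex.I : ℂ)⁻¹ •
      ∮ t in C(0, 1), (t ^ 2)⁻¹ • f (x + t • v) := by
    intro x
    have hg : Differentiable ℂ fun t : ℂ => f (x + t • v) := by fun_prop
    have h1 : HasFDerivAt f (fderiv ℂ f x) (x + (0 : ℂ) • v) := by
      simpa using (hf x).hasFDerivAt
    have h2 : HasDerivAt (fun t : ℂ => x + t • v) v 0 := by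
      simpa using ((hasDerivAt_id (0 : ℂ)).smul_const v).const_add x
    have hd : deriv (fun t : ℂ => f (x + t • v)) 0 = fderiv ℂ f x v :=
      (h1.comp_hasDerivAt (0 : ℂ) h2).deriv
    have := hg.diffContOnCl (s := Metric.ball 0 1) |>.deriv_eq_smul_circleIntegral one_pos
    rw [← hd]
    simp only [sub_zero, one_div] at this
    rw [this, smul_smul, inv_mul_cancel₀ Complex.two_pi_I_ne_zero, one_smul]
  have hfun : (fun x => fderiv ℂ f x v) = fun x => (2 * Real.pi * Complex.I : ℂ)⁻¹ •
      ∮ t in C(0, 1), (t ^ 2)⁻¹ • f (x + t • v) := funext hform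
  rw [hfun]
  refine Differentiable.fun_const_smul ?_ _
  intro x₀
  -- a bound for the differential of `f` near the circle `x₀ + t v`, `|t| = 1`
  obtain ⟨M, hM⟩ : ∃ M, ∀ y ∈ Metric.closedBall x₀ (‖v‖ + 2), ‖f y‖ ≤ M :=
    (isCompact_closedBall x₀ (‖v‖ + 2)).exists_bound_of_continuousOn hf.continuous.continuousOn
  have hbound : ∀ x ∈ Metric.ball x₀ 1, ∀ t : ℂ, ‖t‖ = 1 → ‖fderiv ℂ f (x + t • v)‖ ≤ M := by
    intro x hx t ht
    refine (norm_fderiv_le_of_bounded hf one_pos fun y hy => hM y ?_).trans_eq (div_one M)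
    rw [mem_closedBall_iff_norm]
    rw [mem_ball_iff_norm] at hx
    calc ‖y - x₀‖ = ‖(y - (x + t • v)) + (x - x₀) + t • v‖ := by congr 1; abel
      _ ≤ ‖y - (x + t • v)‖ + ‖x - x₀‖ + ‖t • v‖ := norm_add₃_le
      _ ≤ ‖v‖ + 2 := by rw [norm_smul, ht]; linarith
  have hc : ∀ x, Continuous fun θ : ℝ =>
      deriv (circleMap 0 1) θ • ((circleMap 0 1 θ) ^ 2)⁻¹ • f (x + circleMap 0 1 θ • v) := by
    intro x
    have h3 : Continuous fun θ : ℝ => ((circleMap 0 1 θ) ^ 2)⁻¹ :=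
      ((continuous_circleMap 0 1).pow 2).inv₀ fun θ =>
        pow_ne_zero 2 (circleMap_ne_center one_ne_zero)
    have h4 : Continuous (deriv (circleMap 0 1)) := by
      rw [show deriv (circleMap 0 1) = fun θ => circleMap 0 1 θ * Complex.I from
        funext fun θ => deriv_circleMap 0 1 θ]
      fun_prop
    exact h4.smul (h3.smul (hf.continuous.comp (by fun_prop)))
  unfold circleIntegral
  refine (intervalIntegral.hasFDerivAt_integral_of_dominated_of_fderiv_le
    (F' := fun x θ => deriv (circleMap 0 1) θ • ((circleMap 0 1 θ) ^ 2)⁻¹ •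
      fderiv ℂ f (x + circleMap 0 1 θ • v)) (bound := fun _ => M)
    (Metric.ball_mem_nhds x₀ one_pos) (Eventually.of_forall fun x => (hc x).aestronglyMeasurable)
    ((hc x₀).intervalIntegrable _ _) ?_ ?_ intervalIntegrable_const ?_).differentiableAt
  · refine Measurable.aestronglyMeasurable ?_
    have h5 : Measurable fun θ : ℝ => fderiv ℂ f (x₀ + circleMap 0 1 θ • v) :=
      (measurable_fderiv ℂ f).comp (Continuous.measurable (by fun_prop))
    have h6 : Measurable fun θ : ℝ => ((circleMap 0 1 θ) ^ 2)⁻¹ :=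
      ((continuous_circleMap 0 1).measurable.pow_const 2).inv
    have h7 : Measurable (deriv (circleMap 0 1)) := measurable_deriv _
    exact h7.smul (h6.smul h5)
  · refine ae_of_all _ fun θ _ x hx => ?_
    rw [norm_smul, norm_smul, deriv_circleMap, norm_mul, norm_inv, norm_pow]
    simp only [norm_circleMap_zero, Complex.norm_I, abs_one, one_pow, inv_one, one_mul]
    exact hbound x hx _ (by simp)
  · refine ae_of_all _ fun θ _ x hx => ?_
    have h9 : HasFDerivAt (fun y => f (y + circleMap 0 1 θ • v))
        (fderiv ℂ f (x + circleMap 0 1 θ • v)) x :=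
      (hasFDerivAt_comp_add_right _).2 (hf _).hasFDerivAt
    exact (h9.const_smul ((circleMap 0 1 θ ^ 2)⁻¹)).const_smul (deriv (circleMap 0 1) θ)

/-- A complex differentiable function of several variables is smooth. -/
theorem contDiff_of_differentiable {f : E → ℂ} (hf : Differentiable ℂ f) : ContDiff ℂ ∞ f := by
  rw [contDiff_infty]
  intro n
  induction n generalizing f with
  | zero => exact contDiff_zero.2 hf.continuous
  | succ n ih =>
    push_cast
    rw [contDiff_succ_iff_fderiv_apply]
    refine ⟨hf, fun h => ?_, fun v => ih (differentiable_fderiv_apply hf v)⟩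
    exact absurd h (by exact_mod_cast WithTop.coe_ne_top)

/-- Cauchy's estimates. -/
theorem norm_iteratedFDeriv_le_of_bounded {f : E → ℂ} (hf : Differentiable ℂ f) {δ M : ℝ}
    (hδ : 0 < δ) (m : ℕ) (x : E) (hM : ∀ y, ‖y - x‖ ≤ m * δ → ‖f y‖ ≤ M) :
    ‖iteratedFDeriv ℂ m f x‖ ≤ M / δ ^ m := by
  induction m generalizing x with
  | zero => simpa using hM x (by simp)
  | succ m ih =>
    rw [← norm_fderiv_iteratedFDeriv, pow_succ, ← div_div]
    refine norm_fderiv_le_of_bounded ((contDiff_of_differentiable hf).differentiable_iteratedFDeriv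
      (by exact_mod_cast ENat.natCast_lt_top m)) hδ fun y hy => ih y fun z hz => hM z ?_
    calc ‖z - x‖ = ‖(z - y) + (y - x)‖ := by congr 1; abel
      _ ≤ m * δ + δ := (norm_add_le _ _).trans (add_le_add hz hy)
      _ = _ := by push_cast; ring

omit [FiniteDimensional ℂ E] in
/-- A series of entire functions that converges normally on bounded sets has an entire sum. -/
theorem differentiable_tsum_of_locally {f : ℕ → E → ℂ} (hf : ∀ i, Differentiable ℂ (f i))
    (hb : ∀ R : ℝ, ∃ u : ℕ → ℝ, Summable u ∧ ∀ i x, ‖x‖ < R → ‖f i x‖ ≤ u i) :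
    Differentiable ℂ fun x => ∑' i, f i x := by
  intro x
  refine (hasFDerivAt_tsum_of_locally hf (fun x => ?_) (fun R => ?_) x).differentiableAt
  · obtain ⟨u, hu, h⟩ := hb (‖x‖ + 1)
    exact .of_norm_bounded hu fun i => h i x (by simp)
  · obtain ⟨u, hu, h⟩ := hb (R + 1 + 1)
    refine ⟨u, hu, fun i x hx => ?_⟩
    refine (norm_fderiv_le_of_bounded (hf i) one_pos fun y hy => h i y ?_).trans_eq (div_one _)
    calc ‖y‖ = ‖(y - x) + x‖ := by simp
      _ ≤ ‖y - x‖ + ‖x‖ := norm_add_le _ _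
      _ < _ := by linarith

/-- The Taylor expansion of an entire function at the origin. -/
theorem hasSum_taylor_entire {f : E → ℂ} (hf : Differentiable ℂ f) (x : E) :
    HasSum (fun m : ℕ => (m ! : ℂ)⁻¹ * iteratedFDeriv ℂ m f 0 fun _ => x) (f x) := by
  have hg : Differentiable ℂ fun t : ℂ => f (t • x) := by fun_prop
  have := Complex.hasSum_taylorSeries_of_entire hg 0 1
  simp only [iteratedDeriv_comp_smul (contDiff_of_differentiable hf)] at this
  simpa using this

end

end SeveralVariables

/-! ### The space `𝓔^ρ`: jets, exponentials, monomials, Taylor expansion -/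

section Inequalities

theorem pow_div_factorial_rpow_le {σ : ℝ} (hσ : 0 < σ) {s : ℝ} (hs : 0 ≤ s) (m : ℕ) :
    s ^ m * ((m ! : ℝ) ^ σ)⁻¹ ≤ Real.exp (σ * s ^ σ⁻¹) := by
  have h1 : (s ^ σ⁻¹) ^ m / (m ! : ℝ) ≤ Real.exp (s ^ σ⁻¹) :=
    Real.pow_div_factorial_le_exp _ (by positivity) m
  have h2 := Real.rpow_le_rpow (by positivity) h1 hσ.le
  rw [← Real.exp_mul, mul_comm _ σ, Real.div_rpow (by positivity) (by positivity),
    ← Real.rpow_natCast, ← Real.rpow_mul hs, ← Real.rpow_mul hs] at h2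
  rw [show σ⁻¹ * (m : ℝ) * σ = m by field_simp, Real.rpow_natCast] at h2
  rwa [← div_eq_mul_inv]

/-- The terms `(B t)^m / (m!)^σ` are dominated by a geometric series. -/
theorem mul_pow_div_factorial_rpow_le {σ : ℝ} (hσ : 0 < σ) {s : ℝ} (hs : 0 ≤ s) (m : ℕ) :
    s ^ m * ((m ! : ℝ) ^ σ)⁻¹ ≤ (1 / 2) ^ m * Real.exp (σ * (2 * s) ^ σ⁻¹) := by
  refine le_trans (le_of_eq ?_) (mul_le_mul_of_nonneg_left
    (pow_div_factorial_rpow_le hσ (by positivity : 0 ≤ 2 * s) m) (by positivity))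
  rw [mul_pow, ← mul_assoc, ← mul_assoc, ← mul_pow]
  norm_num

/-- `t^j ≤ (j!)^{1/ρ} e^{t^ρ}`. -/
theorem pow_le_factorial_rpow_mul_exp {ρ : ℝ} (hρ : 1 < ρ) {t : ℝ} (ht : 0 ≤ t) (j : ℕ) :
    t ^ j ≤ (j ! : ℝ) ^ (1 / ρ) * Real.exp (t ^ ρ) := by
  have h0 : 0 < 1 / ρ := by positivity
  have h := pow_div_factorial_rpow_le h0 ht j
  have hj : (0 : ℝ) < (j ! : ℝ) ^ (1 / ρ) := by positivity
  rw [← div_eq_mul_inv, div_le_iff₀ hj, mul_comm] at h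
  refine h.trans (mul_le_mul_of_nonneg_left (Real.exp_le_exp.2 ?_) hj.le)
  rw [one_div, inv_inv]
  exact mul_le_of_le_one_left (by positivity) (inv_le_one_of_one_le₀ hρ.le)

end Inequalities

section ESpaceBasics

variable {ρ : ℝ} {ι : Type} [Fintype ι] [DecidableEq ι]

/-- The growth factor `e^{|x/L|^ρ}`. -/
noncomputable def growth (ρ L : ℝ) (x : ι → ℝ) : ℝ := Real.exp ((‖x‖ / L) ^ ρ)

omit [DecidableEq ι] in
theorem growth_pos (ρ L : ℝ) (x : ι → ℝ) : 0 < growth ρ L x := Real.exp_pos _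

omit [DecidableEq ι] in
theorem one_le_growth (ρ : ℝ) {L : ℝ} (hL : 0 < L) (x : ι → ℝ) : 1 ≤ growth ρ L x :=
  Real.one_le_exp (by positivity)

omit [DecidableEq ι] in
theorem growth_anti (hρ : 0 ≤ ρ) {L L' : ℝ} (hL : 0 < L) (h : L ≤ L') (x : ι → ℝ) :
    growth ρ L' x ≤ growth ρ L x := by
  have hL' : 0 < L' := hL.trans_le h
  unfold growth
  gcongr

theorem ESpace.ext {f g : ESpace ρ ι} (h : ∀ x, f x = g x) : f = g := Subtype.ext (funext h)

/-- The norm `‖f‖_L` bounds the jets of `f`. -/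
theorem ESpace.jetBound (hρ : 1 < ρ) (f : ESpace ρ ι) {L : ℝ} (hL : 0 < L) :
    JetBound (1 - 1 / ρ) (L / (Fintype.card ι + 1)) (eSeminorms ρ ι ⟨L, hL⟩ f) (growth ρ L) f := by
  have hσ : 0 ≤ 1 - 1 / ρ := by
    rw [sub_nonneg, div_le_one (by linarith)]
    exact hρ.le
  refine jetBound_of_multiDeriv hσ hL (apply_nonneg _ _) (fun x => (growth_pos ρ L x).le)
    f.contDiff fun κ x => ?_
  have h1 : ‖eWeighted L f (κ, x)‖ ≤ eSeminorms ρ ι ⟨L, hL⟩ f := le_ciSup (eWeighted_bdd hL f) (κ, x)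
  have hm : (0 : ℝ) < (mfact κ : ℝ) ^ (1 - 1 / ρ) :=
    Real.rpow_pos_of_pos (by exact_mod_cast mfact_pos κ) _
  have hLk : 0 < L ^ order κ := pow_pos hL _
  have hw : 0 < L ^ order κ / (mfact κ : ℝ) ^ (1 - 1 / ρ) * Real.exp (-(‖x‖ / L) ^ ρ) := by
    positivity
  change ‖((_ : ℝ) : ℂ) * multiDeriv κ f x‖ ≤ _ at h1
  rw [norm_mul, Complex.norm_real, Real.norm_of_nonneg hw.le] at h1
  rw [← le_div_iff₀' hw] at h1
  refine h1.trans_eq ?_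
  unfold growth
  rw [Real.exp_neg]
  have := (Real.exp_pos ((‖x‖ / L) ^ ρ)).ne'
  field_simp

/-- The converse of `ESpace.jetBound`, with a loss in the index of the norm. -/
theorem eSeminorm_le_of_jetBound (hρ : 1 < ρ) (f : ESpace ρ ι) {L C : ℝ} (hL : 0 < L) (hC : 0 ≤ C)
    (h : JetBound (1 - 1 / ρ) L C (growth ρ L) f) :
    eSeminorms ρ ι ⟨L / 2 ^ Fintype.card ι, by positivity⟩ f ≤ C := by
  have hσ : 0 ≤ 1 - 1 / ρ := by
    rw [sub_nonneg, div_le_one (by linarith)]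
    exact hρ.le
  have hσ1 : 1 - 1 / ρ ≤ 1 := by
    have : 0 < 1 / ρ := by positivity
    linarith
  set L' := L / 2 ^ Fintype.card ι with hL'
  have hL'0 : 0 < L' := by positivity
  refine Real.iSup_le (fun kx => ?_) hC
  obtain ⟨κ, x⟩ := kx
  have h1 := h.multiDeriv_le hσ hσ1 hL hC (fun x => (growth_pos ρ L x).le) κ x
  have hm : (0 : ℝ) < (mfact κ : ℝ) ^ (1 - 1 / ρ) :=
    Real.rpow_pos_of_pos (by exact_mod_cast mfact_pos κ) _
  have hLk : 0 < L' ^ order κ := pow_pos hL'0 _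
  have hw : 0 < L' ^ order κ / (mfact κ : ℝ) ^ (1 - 1 / ρ) * Real.exp (-(‖x‖ / L') ^ ρ) := by
    positivity
  change ‖((_ : ℝ) : ℂ) * multiDeriv κ f x‖ ≤ _
  rw [norm_mul, Complex.norm_real, Real.norm_of_nonneg hw.le]
  have h2 : growth ρ L x ≤ growth ρ L' x :=
    growth_anti (by linarith) hL'0 (div_le_self hL.le (one_le_pow₀ one_le_two)) x
  calc _ ≤ L' ^ order κ / (mfact κ : ℝ) ^ (1 - 1 / ρ) * Real.exp (-(‖x‖ / L') ^ ρ) *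
        (C * ((L' ^ order κ)⁻¹ * (mfact κ : ℝ) ^ (1 - 1 / ρ) * growth ρ L' x)) := by
        refine mul_le_mul_of_nonneg_left (h1.trans ?_) hw.le
        gcongr
    _ = C := by
      unfold growth
      rw [Real.exp_neg]
      have := (Real.exp_pos ((‖x‖ / L') ^ ρ)).ne'
      generalize (mfact κ : ℝ) ^ (1 - 1 / ρ) = A at hm
      field_simp

theorem exists_jetBound_of_eSpace (hρ : 1 < ρ) (f : ESpace ρ ι) {L : ℝ} (hL : 0 < L) :
    ∃ C, 0 ≤ C ∧ JetBound (1 - 1 / ρ) L C (growth ρ L) f := by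
  have hd : (0 : ℝ) < Fintype.card ι + 1 := by positivity
  have hLd : 0 < L * (Fintype.card ι + 1) := by positivity
  refine ⟨_, apply_nonneg (eSeminorms ρ ι ⟨_, hLd⟩) f, fun m x => ?_⟩
  have h := f.jetBound hρ hLd m x
  rw [mul_div_cancel_right₀ _ hd.ne'] at h
  refine h.trans ?_
  have h2 : growth ρ (L * (Fintype.card ι + 1)) x ≤ growth ρ L x :=
    growth_anti (by linarith) hL (le_mul_of_one_le_right hL.le (by linarith)) x
  have : 0 ≤ eSeminorms ρ ι ⟨_, hLd⟩ f := apply_nonneg _ _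
  gcongr

/-- A smooth function whose jets satisfy the bounds for all `L` is an element of `𝓔^ρ`. -/
def ESpace.ofJet (hρ : 1 < ρ) (f : (ι → ℝ) → ℂ) (hf : ContDiff ℝ ∞ f)
    (h : ∀ L : ℝ, 0 < L → ∃ C, 0 ≤ C ∧ JetBound (1 - 1 / ρ) L C (growth ρ L) f) : ESpace ρ ι :=
  ⟨f, hf, fun L hL => by
    have hσ : 0 ≤ 1 - 1 / ρ := by
      rw [sub_nonneg, div_le_one (by linarith)]
      exact hρ.le
    have hσ1 : 1 - 1 / ρ ≤ 1 := by
      have : 0 < 1 / ρ := by positivity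
      linarith
    have hL' : 0 < L * 2 ^ Fintype.card ι := by positivity
    obtain ⟨C, hC, hb⟩ := h _ hL'
    refine ⟨C, fun κ x => ?_⟩
    refine (hb.multiDeriv_le hσ hσ1 hL' hC (fun x => (growth_pos ρ _ x).le) κ x).trans ?_
    rw [mul_div_cancel_right₀ _ (by positivity)]
    have h2 : growth ρ (L * 2 ^ Fintype.card ι) x ≤ growth ρ L x :=
      growth_anti (by linarith) hL
        (le_mul_of_one_le_right hL.le (one_le_pow₀ one_le_two)) x
    change _ ≤ C * ((L ^ order κ)⁻¹ * (mfact κ : ℝ) ^ (1 - 1 / ρ) * growth ρ L x)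
    gcongr⟩

/-! #### Exponentials -/

/-- The exponential `e^{i ξ·x}`. -/
noncomputable def expFun (ξ x : ι → ℝ) : ℂ := Complex.exp (Complex.I * (ξ ⬝ᵥ x : ℝ))

omit [DecidableEq ι] in
theorem norm_expFun (ξ x : ι → ℝ) : ‖expFun ξ x‖ = 1 := by
  unfold expFun
  rw [mul_comm, Complex.norm_exp_ofReal_mul_I]

omit [DecidableEq ι] in
theorem contDiff_expFun (ξ : ι → ℝ) : ContDiff ℝ ∞ (expFun ξ) := by
  have h : ContDiff ℝ ∞ fun x : ι → ℝ => ∑ i, ξ i * x i :=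
    ContDiff.sum fun i _ => contDiff_const.mul (contDiff_apply ℝ ℝ i)
  exact (contDiff_const.mul (Complex.ofRealCLM.contDiff.comp h)).cexp

omit [DecidableEq ι] in
theorem fderiv_expFun (ξ x v : ι → ℝ) :
    fderiv ℝ (expFun ξ) x v = Complex.I * (ξ ⬝ᵥ v : ℝ) * expFun ξ x := by
  have h : ∀ t : ℝ, expFun ξ (x + t • v) = expFun ξ x * Complex.exp ((t : ℂ) * (Complex.I * (ξ ⬝ᵥ v : ℝ))) := by
    intro t
    unfold expFun
    rw [dotProduct_add, dotProduct_smul, ← Complex.exp_add]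
    congr 1
    push_cast [smul_eq_mul]
    ring
  have hd : HasDerivAt (fun t : ℝ => expFun ξ (x + t • v)) (fderiv ℝ (expFun ξ) x v) 0 := by
    have h1 : HasFDerivAt (expFun ξ) (fderiv ℝ (expFun ξ) x) (x + (0 : ℝ) • v) := by
      simpa using ((contDiff_expFun ξ).differentiable (by simp) x).hasFDerivAt
    have h2 : HasDerivAt (fun t : ℝ => x + t • v) v 0 := by
      simpa using ((hasDerivAt_id (0 : ℝ)).smul_const v).const_add x
    exact h1.comp_hasDerivAt (0 : ℝ) h2
  refine hd.unique ?_
  simp_rw [h]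
  have h3 : HasDerivAt (fun t : ℝ => (t : ℂ) * (Complex.I * (ξ ⬝ᵥ v : ℝ)))
      (1 * (Complex.I * (ξ ⬝ᵥ v : ℝ))) 0 := (Complex.ofRealCLM.hasDerivAt (x := 0)).mul_const _
  simpa [mul_comm] using h3.cexp.const_mul (expFun ξ x)

theorem wordDeriv_expFun (ξ : ι → ℝ) {m : ℕ} (α : Fin m → ι) (x : ι → ℝ) :
    wordDeriv α (expFun ξ) x = (∏ i, Complex.I * (ξ (α i) : ℂ)) * expFun ξ x := by
  have key : ∀ l : List ι, listDeriv (expFun ξ) (l.map fun j => Pi.single j (1 : ℝ)) =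
      fun x => (l.map fun j => Complex.I * (ξ j : ℂ)).prod * expFun ξ x := by
    intro l
    induction l with
    | nil => funext x; simp [listDeriv]
    | cons j l ih =>
      funext x
      simp only [List.map_cons, listDeriv, ih, List.prod_cons]
      rw [fderiv_const_mul ((contDiff_expFun ξ).differentiable (by simp) x)]
      change _ * fderiv ℝ (expFun ξ) x (Pi.single j 1) = _
      rw [fderiv_expFun, dotProduct_single, mul_one]
      ring
  rw [wordDeriv_eq_listDeriv (contDiff_expFun ξ)]
  have h2 : (List.ofFn fun i => (Pi.single (α i) (1 : ℝ) : ι → ℝ)) =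
      (List.ofFn α).map fun j => Pi.single j (1 : ℝ) := by
    rw [List.map_ofFn]; rfl
  rw [h2, key, List.map_ofFn, List.prod_ofFn]
  rfl

theorem norm_iteratedFDeriv_expFun_le (ξ x : ι → ℝ) (m : ℕ) :
    ‖iteratedFDeriv ℝ m (expFun ξ) x‖ ≤ (Fintype.card ι * ‖ξ‖) ^ m := by
  refine (norm_iteratedFDeriv_le_sum _ x).trans ?_
  have h : ∀ α : Fin m → ι, ‖wordDeriv α (expFun ξ) x‖ ≤ ‖ξ‖ ^ m := by
    intro α
    rw [wordDeriv_expFun, norm_mul, norm_expFun, mul_one, norm_prod]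
    refine (Finset.prod_le_prod (g := fun _ => ‖ξ‖) (fun _ _ => norm_nonneg _)
      fun i _ => ?_).trans_eq (by simp)
    rw [norm_mul, Complex.norm_I, one_mul, Complex.norm_real]
    exact norm_le_pi_norm ξ _
  refine (Finset.sum_le_card_nsmul _ _ _ fun α _ => h α).trans_eq ?_
  rw [Finset.card_univ, Fintype.card_fun, Fintype.card_fin, nsmul_eq_mul, mul_pow]
  push_cast
  rfl

variable (ι) in
theorem sigma_pos (hρ : 1 < ρ) : 0 < 1 - 1 / ρ := by
  rw [sub_pos, div_lt_one (by linarith)]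
  exact hρ

/-- The exponential `e^{i ξ·x}` as an element of `𝓔^ρ`. -/
noncomputable def expE (hρ : 1 < ρ) (ξ : ι → ℝ) : ESpace ρ ι :=
  ESpace.ofJet hρ (expFun ξ) (contDiff_expFun ξ) fun L hL => by
    refine ⟨Real.exp ((1 - 1 / ρ) * (Fintype.card ι * ‖ξ‖ * L) ^ (1 - 1 / ρ)⁻¹),
      (Real.exp_pos _).le, fun m x => ?_⟩
    refine (norm_iteratedFDeriv_expFun_le ξ x m).trans ?_
    have h := pow_div_factorial_rpow_le (sub_pos.2 ((div_lt_one (by linarith)).2 hρ))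
      (by positivity : 0 ≤ Fintype.card ι * ‖ξ‖ * L) m
    have hm : (0 : ℝ) < (m ! : ℝ) ^ (1 - 1 / ρ) := by positivity
    rw [← div_eq_mul_inv, div_le_iff₀ hm, mul_pow, ← le_div_iff₀ (by positivity)] at h
    refine h.trans ?_
    rw [div_eq_mul_inv, mul_assoc, mul_comm ((m ! : ℝ) ^ _)]
    refine mul_le_mul_of_nonneg_left ?_ (Real.exp_pos _).le
    exact le_mul_of_one_le_right (by positivity) (one_le_growth ρ hL x)

/-! #### Monomials -/

/-- The monomial `x_{α 0} ⋯ x_{α (m-1)}`. -/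
def monoFun {m : ℕ} (α : Fin m → ι) (x : ι → ℝ) : ℂ := ((∏ i, x (α i) : ℝ) : ℂ)

omit [Fintype ι] [DecidableEq ι] in
theorem monoFun_comp_perm {m : ℕ} (α : Fin m → ι) (τ : Equiv.Perm (Fin m)) :
    monoFun (α ∘ τ) = monoFun α := by
  funext x
  unfold monoFun
  congr 1
  exact Equiv.prod_comp τ fun i => x (α i)

omit [DecidableEq ι] in
theorem contDiff_monoFun {m : ℕ} (α : Fin m → ι) : ContDiff ℝ ∞ (monoFun α) := by
  have h : ContDiff ℝ ∞ fun x : ι → ℝ => ∏ i, x (α i) :=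
    contDiff_prod fun i _ => contDiff_apply ℝ ℝ (α i)
  exact Complex.ofRealCLM.contDiff.comp h

omit [DecidableEq ι] in
theorem norm_iteratedFDeriv_monoFun_le {m : ℕ} (α : Fin m → ι) (k : ℕ) (x : ι → ℝ) :
    ‖iteratedFDeriv ℝ k (monoFun α) x‖ ≤ m.descFactorial k * ‖x‖ ^ (m - k) := by
  set g : (ι → ℝ) →L[ℝ] (Fin m → ℝ) :=
    ContinuousLinearMap.pi fun i => ContinuousLinearMap.proj (α i) with hg
  set P := ContinuousMultilinearMap.mkPiAlgebra ℝ (Fin m) ℝ with hP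
  have hPc : ContDiff ℝ ∞ P := P.contDiff
  have hg1 : ‖g‖ ≤ 1 := by
    refine ContinuousLinearMap.opNorm_le_bound _ zero_le_one fun v => ?_
    rw [one_mul, pi_norm_le_iff_of_nonneg (norm_nonneg _)]
    exact fun i => norm_le_pi_norm v (α i)
  have hgx : ‖g x‖ ≤ ‖x‖ := by simpa using g.le_of_opNorm_le hg1 x
  have h1 : monoFun α = Complex.ofRealLI ∘ (P ∘ g) := by
    funext y
    simp [monoFun, hg, hP]
  rw [h1, Complex.ofRealLI.norm_iteratedFDeriv_comp_left (n := k)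
    ((hPc.comp g.contDiff).of_le (by exact_mod_cast le_top)).contDiffAt le_rfl,
    g.iteratedFDeriv_comp_right hPc x (by exact_mod_cast le_top)]
  refine (ContinuousMultilinearMap.norm_compContinuousLinearMap_le _ _).trans ?_
  have h2 : ∏ _i : Fin k, ‖g‖ ≤ 1 := Finset.prod_le_one (fun _ _ => norm_nonneg _) fun _ _ => hg1
  refine (mul_le_of_le_one_right (norm_nonneg _) h2).trans ?_
  refine (P.norm_iteratedFDeriv_le k (g x)).trans ?_
  rw [Fintype.card_fin]
  have h3 : ‖P‖ = 1 := ContinuousMultilinearMap.norm_mkPiAlgebra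
  rw [h3, mul_one]
  gcongr

omit [DecidableEq ι] in
/-- `‖x^α‖_L ≤ (m!)^{1-σ} (2L)^m`, up to the change of the norm. -/
theorem jetBound_monoFun (hρ : 1 < ρ) {L : ℝ} (hL : 0 < L) {m : ℕ} (α : Fin m → ι) :
    JetBound (1 - 1 / ρ) L (m ! * ((2 * L) ^ m * ((m ! : ℝ) ^ (1 - 1 / ρ))⁻¹)) (growth ρ L)
      (monoFun α) := by
  intro k x
  have hσ := sigma_pos hρ
  set σ := 1 - 1 / ρ with hσdef
  refine (norm_iteratedFDeriv_monoFun_le α k x).trans ?_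
  -- the derivatives of order `k > m` vanish
  rcases lt_or_ge m k with hmk | hkm
  · rw [Nat.descFactorial_eq_zero_iff_lt.2 hmk]
    have := growth_pos ρ L x
    rw [Nat.cast_zero, zero_mul]
    positivity
  obtain ⟨j, rfl⟩ := Nat.exists_eq_add_of_le hkm
  rw [Nat.add_sub_cancel_left]
  have hxj : ‖x‖ ^ j ≤ L ^ j * ((j ! : ℝ) * ((j ! : ℝ) ^ σ)⁻¹ * growth ρ L x) := by
    have h := pow_le_factorial_rpow_mul_exp hρ (by positivity : 0 ≤ ‖x‖ / L) j
    rw [div_pow, div_le_iff₀' (by positivity)] at h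
    refine h.trans_eq ?_
    have : (j ! : ℝ) ^ (1 / ρ) = (j ! : ℝ) * ((j ! : ℝ) ^ σ)⁻¹ := by
      rw [← Real.rpow_neg (by positivity), show 1 / ρ = 1 + -σ by rw [hσdef]; ring,
        Real.rpow_add (by positivity), Real.rpow_one]
    rw [this]
    rfl
  have hfac : ((k + j)! : ℝ) ^ σ ≤ 2 ^ (k + j) * ((k ! : ℝ) ^ σ * (j ! : ℝ) ^ σ) := by
    have h : ((k + j)! : ℝ) ≤ 2 ^ (k + j) * ((k ! : ℝ) * (j ! : ℝ)) := by
      exact_mod_cast factorial_add_le k j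
    refine (Real.rpow_le_rpow (by positivity) h hσ.le).trans ?_
    rw [Real.mul_rpow (by positivity) (by positivity), Real.mul_rpow (by positivity) (by positivity)]
    gcongr
    refine (Real.rpow_le_rpow_of_exponent_le (one_le_pow₀ one_le_two) ?_).trans_eq
      (Real.rpow_one _)
    rw [hσdef]
    have : 0 < 1 / ρ := by positivity
    linarith
  have hdesc : (((k + j).descFactorial k : ℕ) : ℝ) * (j ! : ℝ) = (k + j)! := by
    have := Nat.factorial_mul_descFactorial hkm
    rw [Nat.add_sub_cancel_left] at this
    rw [mul_comm]
    exact_mod_cast this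
  have hg := growth_pos ρ L x
  have hk0 : (0 : ℝ) < (k ! : ℝ) ^ σ := by positivity
  have hj0 : (0 : ℝ) < (j ! : ℝ) ^ σ := by positivity
  have hkj0 : (0 : ℝ) < ((k + j)! : ℝ) ^ σ := by positivity
  calc (((k + j).descFactorial k : ℕ) : ℝ) * ‖x‖ ^ j
      ≤ (((k + j).descFactorial k : ℕ) : ℝ) *
        (L ^ j * ((j ! : ℝ) * ((j ! : ℝ) ^ σ)⁻¹ * growth ρ L x)) := by gcongr
    _ = ((k + j)! : ℝ) * L ^ j * growth ρ L x * (((j ! : ℝ) ^ σ)⁻¹ * 1) := by rw [← hdesc]; ring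
    _ ≤ ((k + j)! : ℝ) * L ^ j * growth ρ L x *
        (((j ! : ℝ) ^ σ)⁻¹ * (2 ^ (k + j) * ((k ! : ℝ) ^ σ * (j ! : ℝ) ^ σ) *
          (((k + j)! : ℝ) ^ σ)⁻¹)) := by
        gcongr
        rw [← div_eq_mul_inv, one_le_div hkj0]
        exact hfac
    _ = _ := by
        rw [mul_pow 2 L, pow_add L]
        field_simp

/-- The monomials as elements of `𝓔^ρ`. -/
noncomputable def monoE (hρ : 1 < ρ) {m : ℕ} (α : Fin m → ι) : ESpace ρ ι :=
  ESpace.ofJet hρ (monoFun α) (contDiff_monoFun α) fun _ hL =>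
    ⟨_, by positivity, jetBound_monoFun hρ hL α⟩

/-! #### Taylor expansion -/

omit [DecidableEq ι] in
/-- Taylor's theorem with a bound of the remainder, on a segment from the origin. -/
theorem norm_sub_taylor_le {f : (ι → ℝ) → ℂ} (hf : ContDiff ℝ ∞ f) (x : ι → ℝ) (m : ℕ) {C : ℝ}
    (hC : ∀ y, ‖y‖ ≤ ‖x‖ → ‖iteratedFDeriv ℝ (m + 1) f y‖ ≤ C) :
    ‖f x - ∑ k ∈ Finset.range (m + 1), ((k ! : ℝ)⁻¹ : ℝ) • iteratedFDeriv ℝ k f 0 (fun _ => x)‖ ≤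
      C * ‖x‖ ^ (m + 1) / m ! := by
  have hg : ContDiff ℝ ∞ fun t : ℝ => f (t • x) := hf.comp (by fun_prop)
  have hw : ∀ (k : ℕ) (t : ℝ), t ∈ Set.Icc (0 : ℝ) 1 →
      iteratedDerivWithin k (fun t : ℝ => f (t • x)) (Set.Icc 0 1) t =
        iteratedFDeriv ℝ k f (t • x) fun _ => x := by
    intro k t ht
    rw [iteratedDerivWithin_eq_iteratedDeriv (uniqueDiffOn_Icc one_pos)
      ((hg.of_le (by exact_mod_cast le_top)).contDiffAt) ht, iteratedDeriv_comp_smul hf]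
  have h := taylor_mean_remainder_bound (f := fun t : ℝ => f (t • x)) (n := m)
    (C := C * ‖x‖ ^ (m + 1)) zero_le_one
    ((hg.of_le (by exact_mod_cast le_top)).contDiffOn) (Set.right_mem_Icc.2 zero_le_one) (by
      intro t ht
      rw [hw _ t ht]
      refine (ContinuousMultilinearMap.le_opNorm _ _).trans ?_
      rw [Finset.prod_const, Finset.card_univ, Fintype.card_fin]
      refine mul_le_mul_of_nonneg_right (hC _ ?_) (by positivity)
      rw [norm_smul, Real.norm_of_nonneg ht.1]
      exact mul_le_of_le_one_left (norm_nonneg _) ht.2)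
  rw [taylor_within_apply] at h
  simp only [sub_zero, one_pow, mul_one, one_smul] at h
  simp only [hw _ 0 (Set.left_mem_Icc.2 zero_le_one), zero_smul] at h
  exact h

/-- The homogeneous part of degree `m` of the Taylor series of `f` at the origin. -/
noncomputable def taylorPart (hρ : 1 < ρ) (f : ESpace ρ ι) (m : ℕ) : ESpace ρ ι :=
  ∑ α : Fin m → ι, ((m ! : ℂ)⁻¹ * wordDeriv α f 0) • monoE hρ α

theorem ESpace.coe_sum {T : Type*} (s : Finset T) (F : T → ESpace ρ ι) :
    ((∑ i ∈ s, F i : ESpace ρ ι) : (ι → ℝ) → ℂ) = ∑ i ∈ s, (F i).1 := by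
  induction s using Finset.cons_induction with
  | empty => rfl
  | cons a s ha ih => rw [Finset.sum_cons, Finset.sum_cons, ESpace.add_coe, ih]

theorem taylorPart_coe (hρ : 1 < ρ) (f : ESpace ρ ι) (m : ℕ) :
    ((taylorPart hρ f m : ESpace ρ ι) : (ι → ℝ) → ℂ) =
      fun x => ∑ α : Fin m → ι, ((m ! : ℂ)⁻¹ * wordDeriv α f 0) • monoFun α x := by
  unfold taylorPart
  rw [ESpace.coe_sum]
  funext x
  rw [Finset.sum_apply]
  rfl

theorem taylorPart_apply (hρ : 1 < ρ) (f : ESpace ρ ι) (m : ℕ) (x : ι → ℝ) :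
    taylorPart hρ f m x = ((m ! : ℝ)⁻¹ : ℝ) • iteratedFDeriv ℝ m f 0 (fun _ => x) := by
  rw [taylorPart_coe, multilinear_eq_sum_words, Finset.smul_sum]
  refine Finset.sum_congr rfl fun α _ => ?_
  unfold wordDeriv monoFun
  simp only [Complex.real_smul, smul_eq_mul]
  push_cast
  ring

/-- The jets of the Taylor parts are dominated by a geometric series. -/
theorem jetBound_taylorPart (hρ : 1 < ρ) (f : ESpace ρ ι) {L : ℝ} (hL : 0 < L) :
    ∃ C, 0 ≤ C ∧ ∀ m, JetBound (1 - 1 / ρ) L (C * (1 / 2) ^ m) (growth ρ L) (taylorPart hρ f m) := by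
  set σ := 1 - 1 / ρ with hσdef
  set d : ℝ := (Fintype.card ι : ℝ) with hd
  have hd0 : 0 ≤ d := by positivity
  have hK : 0 < (d + 1) * (2 * L) * 2 := by positivity
  obtain ⟨C, hC, hb⟩ := exists_jetBound_of_eSpace hρ f hK
  refine ⟨C * growth ρ ((d + 1) * (2 * L) * 2) (0 : ι → ℝ),
    mul_nonneg hC (growth_pos _ _ _).le, fun m k x => ?_⟩
  set K := (d + 1) * (2 * L) * 2 with hKdef
  have hg0 := growth_pos ρ K (0 : ι → ℝ)
  have hg := growth_pos ρ L x
  have hle : ∀ {h : (ι → ℝ) → ℂ}, ContDiff ℝ ∞ h → ContDiffAt ℝ k h x := fun h =>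
    (h.of_le (by exact_mod_cast le_top)).contDiffAt
  rw [taylorPart_coe, iteratedFDeriv_fun_sum_apply fun α _ =>
    hle ((contDiff_monoFun α).const_smul _)]
  have hm0 : (0 : ℝ) < (m ! : ℝ) ^ σ := by positivity
  have hterm : ∀ α : Fin m → ι, ‖iteratedFDeriv ℝ k
      (fun x => ((m ! : ℂ)⁻¹ * wordDeriv α f 0) • monoFun α x) x‖ ≤
      ((m ! : ℝ)⁻¹ * (C * ((K ^ m)⁻¹ * (m ! : ℝ) ^ σ * growth ρ K (0 : ι → ℝ)))) *
      ((m ! * ((2 * L) ^ m * ((m ! : ℝ) ^ σ)⁻¹)) *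
        ((L ^ k)⁻¹ * (k ! : ℝ) ^ σ * growth ρ L x)) := by
    intro α
    rw [iteratedFDeriv_const_smul_apply' (hle (contDiff_monoFun α)), norm_smul, norm_mul, norm_inv,
      Complex.norm_natCast]
    have h1 := (norm_wordDeriv_le α f 0).trans (hb m 0)
    have h2 := jetBound_monoFun hρ hL α k x
    gcongr
  refine (norm_sum_le _ _).trans ((Finset.sum_le_card_nsmul _ _ _ fun α _ => hterm α).trans ?_)
  rw [Finset.card_univ, Fintype.card_fun, Fintype.card_fin, nsmul_eq_mul]
  push_cast
  rw [← hd]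
  have hm1 : (0 : ℝ) < m ! := by positivity
  calc d ^ m * (((m ! : ℝ)⁻¹ * (C * ((K ^ m)⁻¹ * (m ! : ℝ) ^ σ * growth ρ K (0 : ι → ℝ)))) *
      ((m ! * ((2 * L) ^ m * ((m ! : ℝ) ^ σ)⁻¹)) *
        ((L ^ k)⁻¹ * (k ! : ℝ) ^ σ * growth ρ L x)))
      ≤ (d + 1) ^ m * (((m ! : ℝ)⁻¹ * (C * ((K ^ m)⁻¹ * (m ! : ℝ) ^ σ * growth ρ K (0 : ι → ℝ)))) *
      ((m ! * ((2 * L) ^ m * ((m ! : ℝ) ^ σ)⁻¹)) *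
        ((L ^ k)⁻¹ * (k ! : ℝ) ^ σ * growth ρ L x))) := by
        gcongr; linarith
    _ = _ := by
        rw [hKdef, mul_pow, mul_pow, one_div, inv_pow]
        field_simp

/-- The Taylor series of `f ∈ 𝓔^ρ` converges to `f` pointwise. -/
theorem hasSum_taylorPart_apply (hρ : 1 < ρ) (f : ESpace ρ ι) (x : ι → ℝ) :
    HasSum (fun m => taylorPart hρ f m x) (f x) := by
  have hσ := sigma_pos hρ
  have hσ1 : 1 - 1 / ρ ≤ 1 := by
    have : 0 < 1 / ρ := by positivity
    linarith
  have hs : Summable fun m => taylorPart hρ f m x := by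
    obtain ⟨C, hC, hb⟩ := jetBound_taylorPart hρ f one_pos
    refine .of_norm_bounded ((summable_geometric_two.mul_left C).mul_right
      ((1 ^ 0)⁻¹ * (0 ! : ℝ) ^ (1 - 1 / ρ) * growth ρ 1 x)) fun m => ?_
    rw [← norm_iteratedFDeriv_zero (𝕜 := ℝ) (f := (taylorPart hρ f m).1)]
    exact hb m 0 x
  refine (hs.hasSum_iff_tendsto_nat).2 ?_
  have hL : 0 < 2 * (‖x‖ + 1) := by positivity
  obtain ⟨C, hC, hb⟩ := exists_jetBound_of_eSpace hρ f hL
  have hmain : ∀ m : ℕ, ‖f x - ∑ k ∈ Finset.range (m + 1), taylorPart hρ f k x‖ ≤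
      C * growth ρ (2 * (‖x‖ + 1)) x * ((m + 1 : ℕ) * (1 / 2 : ℝ) ^ (m + 1)) := by
    intro m
    simp_rw [taylorPart_apply]
    refine (norm_sub_taylor_le f.contDiff x m
      (C := C * (((2 * (‖x‖ + 1)) ^ (m + 1))⁻¹ * ((m + 1)! : ℝ) * growth ρ (2 * (‖x‖ + 1)) x))
      fun y hy => ?_).trans ?_
    · refine (hb (m + 1) y).trans ?_
      have h1 : growth ρ (2 * (‖x‖ + 1)) y ≤ growth ρ (2 * (‖x‖ + 1)) x := by
        unfold growth; gcongr
      have h2 : ((m + 1)! : ℝ) ^ (1 - 1 / ρ) ≤ (m + 1)! := by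
        refine (Real.rpow_le_rpow_of_exponent_le ?_ hσ1).trans_eq (Real.rpow_one _)
        exact_mod_cast Nat.one_le_iff_ne_zero.2 (Nat.factorial_ne_zero _)
      have := growth_pos ρ (2 * (‖x‖ + 1)) y
      gcongr
    · have hg := growth_pos ρ (2 * (‖x‖ + 1)) x
      have h3 : ‖x‖ ^ (m + 1) * ((‖x‖ + 1) ^ (m + 1))⁻¹ ≤ 1 := by
        rw [← div_eq_mul_inv, div_le_one (by positivity)]
        gcongr; linarith
      rw [Nat.factorial_succ, mul_pow, mul_inv]
      push_cast
      have hm : (0 : ℝ) < m ! := by positivity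
      calc _ = C * growth ρ (2 * (‖x‖ + 1)) x * ((m + 1) * (1 / 2) ^ (m + 1)) *
            (‖x‖ ^ (m + 1) * ((‖x‖ + 1) ^ (m + 1))⁻¹) := by
            rw [one_div, inv_pow]; field_simp
        _ ≤ _ := mul_le_of_le_one_right (by positivity) h3
  rw [← tendsto_add_atTop_iff_nat 1, tendsto_iff_norm_sub_tendsto_zero]
  have ht : Tendsto (fun m : ℕ => C * growth ρ (2 * (‖x‖ + 1)) x *
      ((m + 1 : ℕ) * (1 / 2 : ℝ) ^ (m + 1))) atTop (𝓝 0) := by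
    have h4 := (tendsto_add_atTop_iff_nat (f := fun m : ℕ => (m : ℝ) * (1 / 2 : ℝ) ^ m) 1).2
      (tendsto_self_mul_const_pow_of_lt_one (by norm_num) (by norm_num))
    simpa using h4.const_mul (C * growth ρ (2 * (‖x‖ + 1)) x)
  refine squeeze_zero (fun _ => norm_nonneg _) (fun m => ?_) ht
  rw [norm_sub_rev]
  exact hmain m

/-- The Taylor series of `f ∈ 𝓔^ρ` converges to `f` in each of the norms of `𝓔^ρ`. -/
theorem tendsto_eSeminorm_sub_taylor (hρ : 1 < ρ) (f : ESpace ρ ι) (L : {L : ℝ // 0 < L}) :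
    Tendsto (fun M => eSeminorms ρ ι L (f - ∑ m ∈ Finset.range M, taylorPart hρ f m)) atTop
      (𝓝 0) := by
  obtain ⟨L, hL⟩ := L
  have hL' : 0 < L * 2 ^ Fintype.card ι := by positivity
  obtain ⟨C, hC, hb⟩ := jetBound_taylorPart hρ f hL'
  have hgeo : ∀ M : ℕ, HasSum (fun m => C * (1 / 2 : ℝ) ^ (m + M)) (C * (2 * (1 / 2) ^ M)) := by
    intro M
    refine HasSum.mul_left C ?_
    simp_rw [pow_add]
    exact hasSum_geometric_two.mul_right _
  have key : ∀ M : ℕ, JetBound (1 - 1 / ρ) (L * 2 ^ Fintype.card ι) (C * (2 * (1 / 2) ^ M))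
      (growth ρ (L * 2 ^ Fintype.card ι)) (f - ∑ m ∈ Finset.range M, taylorPart hρ f m : ESpace ρ ι) := by
    intro M
    have hcoe : ((f - ∑ m ∈ Finset.range M, taylorPart hρ f m : ESpace ρ ι) : (ι → ℝ) → ℂ) =
        fun x => ∑' m, taylorPart hρ f (m + M) x := by
      funext x
      have h1 := ((hasSum_nat_add_iff' M).2 (hasSum_taylorPart_apply hρ f x)).tsum_eq
      rw [h1, ← Finset.sum_apply, ← ESpace.coe_sum]
      rfl
    obtain ⟨_, hder⟩ := contDiff_tsum_of_locally (𝕜 := ℝ)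
      (f := fun m => (taylorPart hρ f (m + M)).1) (fun m => (taylorPart hρ f (m + M)).contDiff) (by
        intro k R
        refine ⟨fun m => C * (1 / 2 : ℝ) ^ (m + M) * (((L * 2 ^ Fintype.card ι) ^ k)⁻¹ *
          (k ! : ℝ) ^ (1 - 1 / ρ) * Real.exp ((R / (L * 2 ^ Fintype.card ι)) ^ ρ)),
          (hgeo M).summable.mul_right _, fun m x hx => (hb (m + M) k x).trans ?_⟩
        dsimp only
        unfold growth
        gcongr)
    intro k x
    rw [hcoe, hder]
    exact tsum_of_norm_bounded ((hgeo M).mul_right _) fun m => hb (m + M) k x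
  refine squeeze_zero (fun _ => apply_nonneg _ _) (g := fun M : ℕ => C * (2 * (1 / 2 : ℝ) ^ M))
    (fun M => ?_) ?_
  · have h2 := eSeminorm_le_of_jetBound hρ _ hL' (by positivity) (key M)
    simpa only [mul_div_cancel_right₀ L (by positivity : (2 : ℝ) ^ Fintype.card ι ≠ 0)] using h2
  · simpa using ((tendsto_pow_atTop_nhds_zero_of_lt_one (by norm_num : (0 : ℝ) ≤ 1 / 2)
      (by norm_num)).const_mul 2).const_mul C

end ESpaceBasics

/-! ### Continuous functionals on `𝓔^ρ` -/

section Functionals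

variable {ρ : ℝ} {ι : Type} [Fintype ι] [DecidableEq ι]

omit [DecidableEq ι] in
theorem growth_zero (hρ : 1 < ρ) (L : ℝ) : growth ρ L (0 : ι → ℝ) = 1 := by
  unfold growth
  rw [norm_zero, zero_div, Real.zero_rpow (by linarith), Real.exp_zero]

/-- `∑_α |c_α| ≤ A B^m (m!)^{-σ}`, where the sum is over the words of length `m`. -/
def CoefBound (σ A B : ℝ) (c : ∀ m : ℕ, (Fin m → ι) → ℂ) : Prop :=
  ∀ m, ∑ α, ‖c m α‖ ≤ A * (B ^ m * ((m ! : ℝ) ^ σ)⁻¹)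

/-- The functional `f ↦ ∑_m ∑_α c_α ∂^α f(0)`, where `α` ranges over the words of length `m`. -/
noncomputable def pair (c : ∀ m : ℕ, (Fin m → ι) → ℂ) (f : (ι → ℝ) → ℂ) : ℂ :=
  ∑' m, ∑ α : Fin m → ι, c m α * wordDeriv α f 0

theorem norm_pair_term_le {σ A B C L : ℝ} (hL : 0 < L) (hC : 0 ≤ C)
    {c : ∀ m : ℕ, (Fin m → ι) → ℂ} (hc : CoefBound σ A B c) {f : (ι → ℝ) → ℂ}
    (hf : ∀ m, ‖iteratedFDeriv ℝ m f 0‖ ≤ C * ((L ^ m)⁻¹ * (m ! : ℝ) ^ σ)) (m : ℕ) :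
    ‖∑ α : Fin m → ι, c m α * wordDeriv α f 0‖ ≤ A * C * (B / L) ^ m := by
  calc ‖∑ α : Fin m → ι, c m α * wordDeriv α f 0‖
      ≤ ∑ α : Fin m → ι, ‖c m α‖ * (C * ((L ^ m)⁻¹ * (m ! : ℝ) ^ σ)) := by
        refine norm_sum_le_of_le _ fun α _ => ?_
        rw [norm_mul]
        exact mul_le_mul_of_nonneg_left ((norm_wordDeriv_le α f 0).trans (hf m)) (norm_nonneg _)
    _ ≤ A * (B ^ m * ((m ! : ℝ) ^ σ)⁻¹) * (C * ((L ^ m)⁻¹ * (m ! : ℝ) ^ σ)) := by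
        rw [← Finset.sum_mul]
        exact mul_le_mul_of_nonneg_right (hc m) (by positivity)
    _ = _ := by
        have : (0 : ℝ) < (m ! : ℝ) ^ σ := by positivity
        rw [div_pow]
        field_simp

theorem summable_pair {σ A B C L : ℝ} (hB : 0 ≤ B) (hL : 0 < L) (hC : 0 ≤ C) (hBL : B / L ≤ 1 / 2)
    {c : ∀ m : ℕ, (Fin m → ι) → ℂ} (hc : CoefBound σ A B c) {f : (ι → ℝ) → ℂ}
    (hf : ∀ m, ‖iteratedFDeriv ℝ m f 0‖ ≤ C * ((L ^ m)⁻¹ * (m ! : ℝ) ^ σ)) :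
    (Summable fun m => ∑ α : Fin m → ι, c m α * wordDeriv α f 0) ∧ ‖pair c f‖ ≤ 2 * (A * C) := by
  have hA : 0 ≤ A := by
    have h := hc 0
    simp only [pow_zero, Nat.factorial_zero, Nat.cast_one, Real.one_rpow, inv_one, mul_one] at h
    exact (Finset.sum_nonneg fun _ _ => norm_nonneg _).trans h
  have hb : ∀ m, ‖∑ α : Fin m → ι, c m α * wordDeriv α f 0‖ ≤ A * C * (1 / 2) ^ m := fun m =>
    (norm_pair_term_le hL hC hc hf m).trans (by gcongr)
  refine ⟨.of_norm_bounded (summable_geometric_two.mul_left _) hb, ?_⟩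
  refine (tsum_of_norm_bounded (hasSum_geometric_two.mul_left _) hb).trans_eq ?_
  ring

/-- The index of the norm of `𝓔^ρ` that dominates a functional with the constant `B`. -/
noncomputable def pairIndex (ι : Type) [Fintype ι] (B : ℝ) : ℝ := 2 * (B + 1) * (Fintype.card ι + 1)

omit [DecidableEq ι] in
theorem pairIndex_pos {B : ℝ} (hB : 0 ≤ B) : 0 < pairIndex ι B := by
  unfold pairIndex; positivity

theorem ESpace.iteratedFDeriv_zero_le (hρ : 1 < ρ) {B : ℝ} (hB : 0 ≤ B) (f : ESpace ρ ι) (m : ℕ) :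
    ‖iteratedFDeriv ℝ m f.1 0‖ ≤ eSeminorms ρ ι ⟨pairIndex ι B, pairIndex_pos hB⟩ f *
      (((2 * (B + 1)) ^ m)⁻¹ * (m ! : ℝ) ^ (1 - 1 / ρ)) := by
  have h := f.jetBound hρ (pairIndex_pos (ι := ι) hB) m 0
  rw [growth_zero hρ, mul_one] at h
  have : pairIndex ι B / (Fintype.card ι + 1) = 2 * (B + 1) := by
    unfold pairIndex
    field_simp
  rwa [this] at h

theorem ESpace.summable_pair (hρ : 1 < ρ) {A B : ℝ} (hB : 0 ≤ B) {c : ∀ m : ℕ, (Fin m → ι) → ℂ}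
    (hc : CoefBound (1 - 1 / ρ) A B c) (f : ESpace ρ ι) :
    (Summable fun m => ∑ α : Fin m → ι, c m α * wordDeriv α f 0) ∧
      ‖pair c f‖ ≤ 2 * (A * eSeminorms ρ ι ⟨pairIndex ι B, pairIndex_pos hB⟩ f) := by
  refine StarAlgebra.summable_pair hB (by positivity) (apply_nonneg _ _) ?_ hc
    (f.iteratedFDeriv_zero_le hρ hB)
  rw [div_le_div_iff₀ (by positivity) two_pos]
  linarith

theorem wordDeriv_add {m : ℕ} (α : Fin m → ι) {f g : (ι → ℝ) → ℂ} (hf : ContDiff ℝ ∞ f)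
    (hg : ContDiff ℝ ∞ g) (x : ι → ℝ) :
    wordDeriv α (f + g) x = wordDeriv α f x + wordDeriv α g x := by
  unfold wordDeriv
  rw [iteratedFDeriv_add_apply ((hf.of_le (by exact_mod_cast le_top)).contDiffAt)
    ((hg.of_le (by exact_mod_cast le_top)).contDiffAt)]
  rfl

theorem wordDeriv_smul {m : ℕ} (α : Fin m → ι) (c : ℂ) {f : (ι → ℝ) → ℂ} (hf : ContDiff ℝ ∞ f)
    (x : ι → ℝ) : wordDeriv α (c • f) x = c * wordDeriv α f x := by
  unfold wordDeriv
  rw [iteratedFDeriv_const_smul_apply ((hf.of_le (by exact_mod_cast le_top)).contDiffAt)]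
  rfl

/-- The functional `pair c` as a linear map on `𝓔^ρ`. -/
noncomputable def pairLin (hρ : 1 < ρ) {A B : ℝ} (hB : 0 ≤ B) {c : ∀ m : ℕ, (Fin m → ι) → ℂ}
    (hc : CoefBound (1 - 1 / ρ) A B c) : ESpace ρ ι →ₗ[ℂ] ℂ where
  toFun f := pair c f
  map_add' f g := by
    unfold pair
    rw [← (f.summable_pair hρ hB hc).1.tsum_add (g.summable_pair hρ hB hc).1]
    refine tsum_congr fun m => ?_
    rw [← Finset.sum_add_distrib]
    refine Finset.sum_congr rfl fun α _ => ?_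
    rw [ESpace.add_coe, wordDeriv_add α f.contDiff g.contDiff, mul_add]
  map_smul' a f := by
    unfold pair
    rw [RingHom.id_apply, smul_eq_mul, ← tsum_mul_left]
    refine tsum_congr fun m => ?_
    rw [Finset.mul_sum]
    refine Finset.sum_congr rfl fun α _ => ?_
    rw [ESpace.smul_coe, wordDeriv_smul α a f.contDiff]
    ring

theorem eSeminorms_mono (hρ : 1 < ρ) {L L' : ℝ} (hL : 0 < L) (hLL' : L ≤ L') (f : ESpace ρ ι) :
    eSeminorms ρ ι ⟨L, hL⟩ f ≤ eSeminorms ρ ι ⟨L', hL.trans_le hLL'⟩ f := by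
  refine Real.iSup_le (fun kx => ?_) (apply_nonneg _ _)
  refine le_trans ?_ (le_ciSup (eWeighted_bdd (hL.trans_le hLL') f) kx)
  change ‖((_ : ℝ) : ℂ) * multiDeriv kx.1 f kx.2‖ ≤ ‖((_ : ℝ) : ℂ) * multiDeriv kx.1 f kx.2‖
  have hm : (0 : ℝ) < (mfact kx.1 : ℝ) ^ (1 - 1 / ρ) :=
    Real.rpow_pos_of_pos (by exact_mod_cast mfact_pos kx.1) _
  have hL' := hL.trans_le hLL'
  rw [norm_mul, norm_mul, Complex.norm_real, Complex.norm_real, Real.norm_of_nonneg (by positivity),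
    Real.norm_of_nonneg (by positivity)]
  gcongr

theorem e_withSeminorms : WithSeminorms (eSeminorms ρ ι) := ⟨rfl⟩

instance : IsTopologicalAddGroup (ESpace ρ ι) := e_withSeminorms.topologicalAddGroup

/-- A continuous seminorm on `𝓔^ρ` is dominated by one of the norms `‖·‖_L`. -/
theorem exists_le_eSeminorm (hρ : 1 < ρ) {q : Seminorm ℂ (ESpace ρ ι)} (hq : Continuous q) :
    ∃ (L : ℝ) (hL : 0 < L) (C : ℝ), 0 ≤ C ∧ ∀ f, q f ≤ C * eSeminorms ρ ι ⟨L, hL⟩ f := by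
  obtain ⟨s, C, -, hC⟩ := Seminorm.bound_of_continuous e_withSeminorms q hq
  obtain ⟨L, hL⟩ : ∃ L : {L : ℝ // 0 < L}, ∀ i ∈ s, i ≤ L := by
    obtain ⟨L, hL⟩ := s.exists_le
    exact ⟨L, hL⟩
  refine ⟨L.1, L.2, C, C.2, fun f => (hC f).trans ?_⟩
  rw [smul_apply, NNReal.smul_def, smul_eq_mul]
  refine mul_le_mul_of_nonneg_left ?_ C.2
  exact Seminorm.finset_sup_apply_le (apply_nonneg _ _) fun i hi => eSeminorms_mono hρ i.2 (hL i hi) f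

/-- Every continuous functional on `𝓔^ρ` is determined by its values on the monomials. -/
theorem functional_eq_pair (hρ : 1 < ρ) (T : ESpace ρ ι →ₗ[ℂ] ℂ) {L C : ℝ} (hL : 0 < L)
    (hC : 0 ≤ C) (hT : ∀ f, ‖T f‖ ≤ C * eSeminorms ρ ι ⟨L, hL⟩ f) :
    (∃ B, 0 < B ∧ CoefBound (1 - 1 / ρ) C B
      fun m (α : Fin m → ι) => (m ! : ℂ)⁻¹ * T (monoE hρ α)) ∧
    ∀ f : ESpace ρ ι, T f = pair (fun m (α : Fin m → ι) => (m ! : ℂ)⁻¹ * T (monoE hρ α)) f := by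
  have hL' : 0 < L * 2 ^ Fintype.card ι := by positivity
  have hcb : ∃ B, 0 < B ∧ CoefBound (1 - 1 / ρ) C B
      fun m (α : Fin m → ι) => (m ! : ℂ)⁻¹ * T (monoE hρ α) := by
    refine ⟨(Fintype.card ι + 1) * (2 * (L * 2 ^ Fintype.card ι)), by positivity, fun m => ?_⟩
    have h1 : ∀ α : Fin m → ι, ‖(m ! : ℂ)⁻¹ * T (monoE hρ α)‖ ≤
        C * ((2 * (L * 2 ^ Fintype.card ι)) ^ m * ((m ! : ℝ) ^ (1 - 1 / ρ))⁻¹) := by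
      intro α
      have h2 := eSeminorm_le_of_jetBound hρ (monoE hρ α) hL' (by positivity)
        (jetBound_monoFun hρ hL' α)
      simp only [mul_div_cancel_right₀ L (by positivity : (2 : ℝ) ^ Fintype.card ι ≠ 0)] at h2
      rw [norm_mul, norm_inv, Complex.norm_natCast, inv_mul_le_iff₀ (by positivity)]
      refine (hT _).trans ((mul_le_mul_of_nonneg_left h2 hC).trans_eq ?_)
      ring
    refine (Finset.sum_le_card_nsmul _ _ _ fun α _ => h1 α).trans ?_
    rw [Finset.card_univ, Fintype.card_fun, Fintype.card_fin, nsmul_eq_mul, mul_pow ((Fintype.card ι : ℝ) + 1)]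
    push_cast
    calc (Fintype.card ι : ℝ) ^ m *
          (C * ((2 * (L * 2 ^ Fintype.card ι)) ^ m * ((m ! : ℝ) ^ (1 - 1 / ρ))⁻¹))
        ≤ ((Fintype.card ι : ℝ) + 1) ^ m *
          (C * ((2 * (L * 2 ^ Fintype.card ι)) ^ m * ((m ! : ℝ) ^ (1 - 1 / ρ))⁻¹)) := by
          gcongr; linarith
      _ = _ := by ring
  refine ⟨hcb, fun f => ?_⟩
  · have h3 : Tendsto (fun M => ∑ m ∈ Finset.range M, T (taylorPart hρ f m)) atTop (𝓝 (T f)) := by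
      rw [tendsto_iff_norm_sub_tendsto_zero]
      have h4 := (tendsto_eSeminorm_sub_taylor hρ f ⟨L, hL⟩).const_mul C
      rw [mul_zero] at h4
      refine squeeze_zero (fun _ => norm_nonneg _) (fun M => ?_) h4
      rw [← map_sum, ← map_sub, ← norm_neg, ← map_neg, neg_sub]
      exact hT _
    have h5 : ∀ m, T (taylorPart hρ f m) = ∑ α : Fin m → ι,
        ((m ! : ℂ)⁻¹ * T (monoE hρ α)) * wordDeriv α f 0 := by
      intro m
      unfold taylorPart
      rw [map_sum]
      refine Finset.sum_congr rfl fun α _ => ?_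
      rw [map_smul, smul_eq_mul]
      ring
    simp_rw [h5] at h3
    obtain ⟨B, hB, hc⟩ := hcb
    exact tendsto_nhds_unique h3 (f.summable_pair hρ hB.le hc).1.hasSum.tendsto_sum_nat

omit [DecidableEq ι] in
theorem coefBound_nonneg {σ A B : ℝ} {c : ∀ m : ℕ, (Fin m → ι) → ℂ} (hc : CoefBound σ A B c) :
    0 ≤ A := by
  have h := hc 0
  simp only [pow_zero, Nat.factorial_zero, Nat.cast_one, Real.one_rpow, inv_one, mul_one] at h
  exact (Finset.sum_nonneg fun _ _ => norm_nonneg _).trans h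

/-- The multilinear form `(v₁, …, v_m) ↦ i^m ∑_α c_α (v₁)_{α 1} ⋯ (v_m)_{α m}`. -/
noncomputable def coefForm (c : ∀ m : ℕ, (Fin m → ι) → ℂ) : FormalMultilinearSeries ℝ (ι → ℝ) ℂ :=
  fun m => ∑ α : Fin m → ι, (ContinuousMultilinearMap.mkPiAlgebra ℝ (Fin m) ℝ
    |>.compContinuousLinearMap fun i => ContinuousLinearMap.proj (α i)).smulRight
      (Complex.I ^ m * c m α)

omit [DecidableEq ι] in
theorem coefForm_apply (c : ∀ m : ℕ, (Fin m → ι) → ℂ) (m : ℕ) (v : Fin m → ι → ℝ) :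
    coefForm c m v = ∑ α : Fin m → ι, (∏ i, v i (α i) : ℝ) • (Complex.I ^ m * c m α) := by
  unfold coefForm
  simp

theorem pair_expFun (c : ∀ m : ℕ, (Fin m → ι) → ℂ) (ξ : ι → ℝ) :
    pair c (expFun ξ) = ∑' m, coefForm c m fun _ => ξ := by
  unfold pair
  refine tsum_congr fun m => ?_
  rw [coefForm_apply]
  refine Finset.sum_congr rfl fun α _ => ?_
  have h0 : expFun ξ 0 = 1 := by simp [expFun]
  rw [wordDeriv_expFun, h0, mul_one, Finset.prod_mul_distrib, Finset.prod_const, Finset.card_univ,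
    Fintype.card_fin, Complex.real_smul]
  push_cast
  ring

omit [DecidableEq ι] in
theorem norm_coefForm_le {σ A B : ℝ} (hσ : 0 ≤ σ) (hB : 0 ≤ B) {c : ∀ m : ℕ, (Fin m → ι) → ℂ}
    (hc : CoefBound σ A B c) (m : ℕ) : ‖coefForm c m‖ ≤ A * B ^ m := by
  have hA := coefBound_nonneg hc
  refine ContinuousMultilinearMap.opNorm_le_bound (by positivity) fun v => ?_
  rw [coefForm_apply]
  have h1 : ‖∑ α : Fin m → ι, (∏ i, v i (α i) : ℝ) • (Complex.I ^ m * c m α)‖ ≤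
      ∑ α : Fin m → ι, ‖c m α‖ * ∏ i, ‖v i‖ := by
    refine norm_sum_le_of_le _ fun α _ => ?_
    rw [norm_smul, norm_mul, norm_pow, Complex.norm_I, one_pow, one_mul, mul_comm, norm_prod]
    refine mul_le_mul_of_nonneg_left ?_ (norm_nonneg _)
    exact Finset.prod_le_prod (fun _ _ => norm_nonneg _) fun i _ => norm_le_pi_norm (v i) (α i)
  refine h1.trans ?_
  rw [← Finset.sum_mul]
  refine mul_le_mul_of_nonneg_right ((hc m).trans ?_) (Finset.prod_nonneg fun _ _ => norm_nonneg _)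
  refine mul_le_mul_of_nonneg_left (mul_le_of_le_one_right (by positivity) ?_) hA
  refine inv_le_one_of_one_le₀ (Real.one_le_rpow ?_ hσ)
  exact_mod_cast Nat.one_le_iff_ne_zero.2 (Nat.factorial_ne_zero m)

/-- A continuous functional on `𝓔^ρ` that vanishes on the exponentials `e^{i ξ·x}`, `ξ` real,
vanishes: `ξ ↦ T(e^{i ξ·x})` is a power series whose coefficients are the values of `T` on the
monomials. -/
theorem functional_eq_zero (hρ : 1 < ρ) (T : ESpace ρ ι →ₗ[ℂ] ℂ) {L C : ℝ} (hL : 0 < L)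
    (hC : 0 ≤ C) (hT : ∀ f, ‖T f‖ ≤ C * eSeminorms ρ ι ⟨L, hL⟩ f)
    (h0 : ∀ ξ, T (expE hρ ξ) = 0) : T = 0 := by
  obtain ⟨⟨B, hB, hc⟩, hpair⟩ := functional_eq_pair hρ T hL hC hT
  set c := fun m (α : Fin m → ι) => (m ! : ℂ)⁻¹ * T (monoE hρ α) with hcdef
  have hσ := (sigma_pos hρ).le
  -- the power series of `ξ ↦ T(e^{i ξ·x}) = 0` converges at least for `|ξ| < 1 / B`
  obtain ⟨r, hr⟩ : ∃ r : NNReal, (r : ℝ) = B⁻¹ / 2 :=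
    ⟨(B⁻¹ / 2).toNNReal, Real.coe_toNNReal _ (by positivity)⟩
  have hps : HasFPowerSeriesOnBall (fun _ : ι → ℝ => (0 : ℂ)) (coefForm c) 0 r := by
    have hb : ∀ m : ℕ, ‖coefForm c m‖ * (r : ℝ) ^ m ≤ C * (1 / 2) ^ m := by
      intro m
      refine (mul_le_mul_of_nonneg_right (norm_coefForm_le hσ hB.le hc m)
        (by positivity)).trans_eq ?_
      rw [mul_assoc, ← mul_pow, hr]
      congr 2
      field_simp
    refine ⟨FormalMultilinearSeries.le_radius_of_bound _ C fun m => (hb m).trans ?_, ?_, ?_⟩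
    · exact mul_le_of_le_one_right hC (pow_le_one₀ (by norm_num) (by norm_num))
    · rw [ENNReal.coe_pos, ← NNReal.coe_pos]
      rw [hr]
      positivity
    · intro y hy
      have hy' : ‖y‖ ≤ r := by
        rw [Metric.eball_coe, mem_ball_zero_iff] at hy
        exact hy.le
      have hs : Summable fun m => coefForm c m fun _ => y := by
        refine .of_norm_bounded (summable_geometric_two.mul_left C) fun m => ?_
        refine ((coefForm c m).le_opNorm _).trans (le_trans ?_ (hb m))
        rw [Finset.prod_const, Finset.card_univ, Fintype.card_fin]
        gcongr
      have h1 := hs.hasSum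
      rw [← pair_expFun] at h1
      have h2 : pair c (expFun y) = 0 := by
        rw [← h0 y, hpair]
        rfl
      rwa [h2] at h1
  -- the form `coefForm c m` is symmetric, hence determined by its polynomial, since the values of
  -- `T` on the monomials do not depend on the order of the factors
  have hc0 : ∀ (m : ℕ) (β : Fin m → ι), c m β = 0 := by
    intro m β
    have h1 := hps.iteratedFDeriv_eq_sum_of_completeSpace fun i : Fin m =>
      (Pi.single (β i) (1 : ℝ) : ι → ℝ)
    have h2 : iteratedFDeriv ℝ m (fun _ : ι → ℝ => (0 : ℂ)) 0 = 0 :=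
      congrFun (iteratedFDeriv_fun_zero (𝕜 := ℝ) (n := m)) 0
    rw [h2] at h1
    have h3 : ∀ τ : Equiv.Perm (Fin m),
        coefForm c m (fun i => (Pi.single (β (τ i)) (1 : ℝ) : ι → ℝ)) = Complex.I ^ m * c m β := by
      intro τ
      rw [coefForm_apply, Finset.sum_eq_single (β ∘ τ)]
      · have h4 : ∏ i, (Pi.single (β (τ i)) (1 : ℝ) : ι → ℝ) ((β ∘ τ) i) = 1 :=
          Finset.prod_eq_one fun i _ => by simp
        rw [h4, one_smul]
        have h5 : monoE hρ (β ∘ τ) = monoE hρ β := Subtype.ext (monoFun_comp_perm β τ)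
        simp only [hcdef, h5]
      · intro α _ hα
        obtain ⟨i, hi⟩ : ∃ i, α i ≠ β (τ i) := by
          by_contra! h
          exact hα (funext h)
        rw [Finset.prod_eq_zero (Finset.mem_univ i), zero_smul]
        rw [Pi.single_apply, if_neg hi]
      · intro h
        exact absurd (Finset.mem_univ _) h
    rw [Finset.sum_congr rfl fun τ _ => h3 τ, Finset.sum_const, Finset.card_univ,
      Fintype.card_perm, Fintype.card_fin, nsmul_eq_mul] at h1
    have h6 : ((m ! : ℕ) : ℂ) ≠ 0 := by exact_mod_cast Nat.factorial_ne_zero m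
    have h7 : Complex.I ^ m ≠ 0 := pow_ne_zero _ Complex.I_ne_zero
    have h8 : (m ! : ℂ) * (Complex.I ^ m * c m β) = 0 := h1.symm
    simpa [h6, h7] using h8
  ext f
  rw [hpair f]
  unfold pair
  simp [hc0]

/-- If `f` is a superposition of exponentials, then a functional can be applied under the
integral sign. -/
theorem pair_integral {σ A B : ℝ} (hσ : 0 < σ) (hB : 0 < B) {c : ∀ m : ℕ, (Fin m → ι) → ℂ}
    (hc : CoefBound σ A B c) {X : Type*} [MeasurableSpace X] {μ : Measure X} {a : X → ℂ}
    {ξ : X → ι → ℝ} (ha : AEStronglyMeasurable a μ) (hξ : AEStronglyMeasurable ξ μ)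
    (hint : Integrable (fun s => ‖a s‖ * Real.exp (σ * (2 * (B * ‖ξ s‖)) ^ σ⁻¹)) μ)
    {f : (ι → ℝ) → ℂ}
    (hf : ∀ (m : ℕ) (α : Fin m → ι),
      wordDeriv α f 0 = ∫ s, a s * ∏ i, (Complex.I * (ξ s (α i) : ℂ)) ∂μ) :
    pair c f = ∫ s, a s * pair c (expFun (ξ s)) ∂μ := by
  have hA := coefBound_nonneg hc
  have hmeas : ∀ (m : ℕ) (α : Fin m → ι),
      AEStronglyMeasurable (fun s => a s * ∏ i, (Complex.I * (ξ s (α i) : ℂ))) μ := by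
    intro m α
    refine ha.mul ?_
    have hcont : Continuous fun v : ι → ℝ => ∏ i, (Complex.I * (v (α i) : ℂ)) := by fun_prop
    exact hcont.comp_aestronglyMeasurable hξ
  have hbd : ∀ (m : ℕ) (α : Fin m → ι) (s : X),
      ‖a s * ∏ i, (Complex.I * (ξ s (α i) : ℂ))‖ ≤
        ‖a s‖ * Real.exp (σ * (2 * (B * ‖ξ s‖)) ^ σ⁻¹) *
          ((1 / 2) ^ m * ((B ^ m)⁻¹ * (m ! : ℝ) ^ σ)) := by
    intro m α s
    rw [norm_mul, mul_assoc]
    refine mul_le_mul_of_nonneg_left ?_ (norm_nonneg _)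
    have h1 : ‖∏ i, (Complex.I * (ξ s (α i) : ℂ))‖ ≤ ‖ξ s‖ ^ m := by
      rw [norm_prod]
      refine (Finset.prod_le_prod (g := fun _ => ‖ξ s‖) (fun _ _ => norm_nonneg _)
        fun i _ => ?_).trans_eq (by simp)
      rw [norm_mul, Complex.norm_I, one_mul, Complex.norm_real]
      exact norm_le_pi_norm (ξ s) _
    have h2 := mul_pow_div_factorial_rpow_le hσ (by positivity : 0 ≤ B * ‖ξ s‖) m
    have hm : (0 : ℝ) < (m ! : ℝ) ^ σ := by positivity
    rw [← div_eq_mul_inv, div_le_iff₀ hm, mul_pow, ← le_div_iff₀' (by positivity)] at h2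
    refine h1.trans (h2.trans_eq ?_)
    field_simp
  have hI : ∀ (m : ℕ) (α : Fin m → ι),
      Integrable (fun s => a s * ∏ i, (Complex.I * (ξ s (α i) : ℂ))) μ := fun m α =>
    (hint.mul_const _).mono' (hmeas m α) (ae_of_all _ (hbd m α))
  set F : ℕ → X → ℂ := fun m s =>
    ∑ α : Fin m → ι, c m α * (a s * ∏ i, (Complex.I * (ξ s (α i) : ℂ))) with hF
  have hFI : ∀ m, Integrable (F m) μ := fun m =>
    integrable_finsetSum _ fun α _ => (hI m α).const_mul _
  have hFb : ∀ m s, ‖F m s‖ ≤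
      ‖a s‖ * Real.exp (σ * (2 * (B * ‖ξ s‖)) ^ σ⁻¹) * (A * (1 / 2) ^ m) := by
    intro m s
    have h1 : ‖F m s‖ ≤ ∑ α : Fin m → ι, ‖c m α‖ *
        (‖a s‖ * Real.exp (σ * (2 * (B * ‖ξ s‖)) ^ σ⁻¹) *
          ((1 / 2) ^ m * ((B ^ m)⁻¹ * (m ! : ℝ) ^ σ))) := by
      refine norm_sum_le_of_le _ fun α _ => ?_
      rw [norm_mul]
      exact mul_le_mul_of_nonneg_left (hbd m α s) (norm_nonneg _)
    refine h1.trans ?_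
    rw [← Finset.sum_mul]
    refine (mul_le_mul_of_nonneg_right (hc m) (by positivity)).trans_eq ?_
    have hm : (0 : ℝ) < (m ! : ℝ) ^ σ := by positivity
    field_simp
  have hsum : Summable fun m => ∫ s, ‖F m s‖ ∂μ := by
    refine .of_nonneg_of_le (fun m => integral_nonneg fun _ => norm_nonneg _) (fun m => ?_)
      (summable_geometric_two.mul_left
        ((∫ s, ‖a s‖ * Real.exp (σ * (2 * (B * ‖ξ s‖)) ^ σ⁻¹) ∂μ) * A))
    rw [mul_assoc, ← integral_mul_const]
    exact integral_mono (hFI m).norm (hint.mul_const _) (hFb m)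
  have h1 := (hasSum_integral_of_summable_integral_norm hFI hsum).tsum_eq
  have h2 : pair c f = ∑' m, ∫ s, F m s ∂μ := by
    unfold pair
    refine tsum_congr fun m => ?_
    rw [hF, integral_finsetSum _ fun α _ => (hI m α).const_mul _]
    refine Finset.sum_congr rfl fun α _ => ?_
    rw [integral_const_mul, hf]
  rw [h2, h1]
  refine integral_congr_ae (ae_of_all _ fun s => ?_)
  unfold pair
  dsimp only
  rw [← tsum_mul_left]
  refine tsum_congr fun m => ?_
  have h0 : expFun (ξ s) 0 = 1 := by simp [expFun]
  rw [hF, Finset.mul_sum]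
  refine Finset.sum_congr rfl fun α _ => ?_
  rw [wordDeriv_expFun, h0, mul_one]
  ring

/-- The coefficients of the functional on `𝓔^ρ` which takes the value `G(ξ)` at `e^{i ξ·x}`. -/
noncomputable def taylorCoef (G : (ι → ℂ) → ℂ) (m : ℕ) (α : Fin m → ι) : ℂ :=
  (-Complex.I) ^ m * ((m ! : ℂ)⁻¹ * iteratedFDeriv ℂ m G 0 fun i => Pi.single (α i) 1)

/-- Cauchy's estimates for the coefficients of an entire function of order `1/σ`. -/
theorem coefBound_taylorCoef {σ K N : ℝ} (hσ : 0 < σ) (hN : 0 ≤ N) {G : (ι → ℂ) → ℂ}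
    (hG : Differentiable ℂ G) (hb : ∀ ξ, ‖G ξ‖ ≤ K * Real.exp (N * ‖ξ‖ ^ σ⁻¹)) :
    CoefBound σ (K * Real.exp (N + 1)) ((Fintype.card ι + 1) * Real.exp (N + 1)) (taylorCoef G) := by
  intro m
  have hK : 0 ≤ K := by
    refine nonneg_of_mul_nonneg_left ((norm_nonneg _).trans (hb 0)) (Real.exp_pos _)
  -- the radius `R = (m+1)^σ` is optimal up to constants
  set R : ℝ := ((m : ℝ) + 1) ^ σ with hR
  have hR0 : 0 < R := by positivity
  have hδ : 0 < R / (m + 1) := by positivity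
  have hcauchy := norm_iteratedFDeriv_le_of_bounded hG hδ m 0 (M := K * Real.exp (N * (m + 1)))
    fun y hy => by
      refine (hb y).trans ?_
      have h1 : ‖y‖ ≤ R := by
        rw [sub_zero] at hy
        refine hy.trans ?_
        rw [← mul_div_assoc, div_le_iff₀ (by positivity), mul_comm]
        gcongr
        linarith
      have h2 : ‖y‖ ^ σ⁻¹ ≤ m + 1 := by
        refine (Real.rpow_le_rpow (norm_nonneg _) h1 (by positivity)).trans_eq ?_
        rw [hR, ← Real.rpow_mul (by positivity), mul_inv_cancel₀ hσ.ne', Real.rpow_one]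
      gcongr
  have hm : (0 : ℝ) < m ! := by positivity
  have hfin : (m ! : ℝ)⁻¹ * ‖iteratedFDeriv ℂ m G 0‖ ≤
      K * Real.exp (N + 1) * (Real.exp (N + 1) ^ m * ((m ! : ℝ) ^ σ)⁻¹) := by
    have h3 : ((m : ℝ) + 1) ^ m / m ! ≤ Real.exp (m + 1) :=
      Real.pow_div_factorial_le_exp _ (by positivity) m
    have h4 : (R ^ m)⁻¹ ≤ ((m ! : ℝ) ^ σ)⁻¹ := by
      refine inv_anti₀ (by positivity) ?_
      rw [hR, ← Real.rpow_natCast, ← Real.rpow_mul (by positivity), mul_comm σ,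
        Real.rpow_mul (by positivity), Real.rpow_natCast]
      refine Real.rpow_le_rpow (by positivity) ?_ hσ.le
      refine le_trans (?_ : (m ! : ℝ) ≤ (m : ℝ) ^ m) (by gcongr; linarith)
      exact_mod_cast Nat.factorial_le_pow m
    calc (m ! : ℝ)⁻¹ * ‖iteratedFDeriv ℂ m G 0‖
        ≤ (m ! : ℝ)⁻¹ * (K * Real.exp (N * (m + 1)) / (R / (m + 1)) ^ m) := by gcongr
      _ = K * Real.exp (N * (m + 1)) * ((((m : ℝ) + 1) ^ m / m !) * (R ^ m)⁻¹) := by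
          rw [div_pow]; field_simp
      _ ≤ K * Real.exp (N * (m + 1)) * (Real.exp (m + 1) * ((m ! : ℝ) ^ σ)⁻¹) := by gcongr
      _ = _ := by
          rw [← Real.exp_nat_mul, show N * ((m : ℝ) + 1) = N + m * N by ring,
            show (m : ℝ) * (N + 1) = m * N + m by ring]
          simp only [Real.exp_add]
          ring
  have h5 : ∀ α : Fin m → ι, ‖taylorCoef G m α‖ ≤
      K * Real.exp (N + 1) * (Real.exp (N + 1) ^ m * ((m ! : ℝ) ^ σ)⁻¹) := by
    intro α
    refine le_trans ?_ hfin
    unfold taylorCoef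
    rw [norm_mul, norm_pow, norm_neg, Complex.norm_I, one_pow, one_mul, norm_mul, norm_inv,
      Complex.norm_natCast]
    refine mul_le_mul_of_nonneg_left ?_ (by positivity)
    refine (ContinuousMultilinearMap.le_opNorm _ _).trans_eq ?_
    rw [Finset.prod_eq_one fun i _ => by rw [Pi.norm_single, norm_one], mul_one]
  refine (Finset.sum_le_card_nsmul _ _ _ fun α _ => h5 α).trans ?_
  rw [Finset.card_univ, Fintype.card_fun, Fintype.card_fin, nsmul_eq_mul,
    mul_pow ((Fintype.card ι : ℝ) + 1)]
  push_cast
  calc (Fintype.card ι : ℝ) ^ m *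
        (K * Real.exp (N + 1) * (Real.exp (N + 1) ^ m * ((m ! : ℝ) ^ σ)⁻¹))
      ≤ ((Fintype.card ι : ℝ) + 1) ^ m *
        (K * Real.exp (N + 1) * (Real.exp (N + 1) ^ m * ((m ! : ℝ) ^ σ)⁻¹)) := by
        gcongr; linarith
    _ = _ := by ring

theorem pair_taylorCoef_expFun {G : (ι → ℂ) → ℂ} (hG : Differentiable ℂ G) (ξ : ι → ℝ) :
    pair (taylorCoef G) (expFun ξ) = G fun j => (ξ j : ℂ) := by
  rw [← (hasSum_taylor_entire hG fun j => (ξ j : ℂ)).tsum_eq]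
  unfold pair
  refine tsum_congr fun m => ?_
  rw [multilinear_eq_sum_words, Finset.mul_sum]
  refine Finset.sum_congr rfl fun α _ => ?_
  have h0 : expFun ξ 0 = 1 := by simp [expFun]
  have hI : (-Complex.I) ^ m * Complex.I ^ m = 1 := by
    rw [← mul_pow, neg_mul, Complex.I_mul_I, neg_neg, one_pow]
  rw [wordDeriv_expFun, h0, mul_one, Finset.prod_mul_distrib, Finset.prod_const, Finset.card_univ,
    Fintype.card_fin, taylorCoef, smul_eq_mul]
  linear_combination ((m ! : ℂ)⁻¹ * (iteratedFDeriv ℂ m G 0 fun i => Pi.single (α i) 1) *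
    ∏ i, (ξ (α i) : ℂ)) * hI

end Functionals

/-! ### The action of symbols on the space `W^γ_ρ` -/

section ScalarInequalities

theorem rpow_le_one_add_rpow {t p γ : ℝ} (ht : 0 ≤ t) (hp : 0 ≤ p) (hpγ : p ≤ γ) :
    t ^ p ≤ 1 + t ^ γ := by
  rcases le_total t 1 with h | h
  · exact (Real.rpow_le_one ht h hp).trans (le_add_of_nonneg_right (by positivity))
  · exact (Real.rpow_le_rpow_of_exponent_le h hpγ).trans (le_add_of_nonneg_left zero_le_one)

theorem add_rpow_le_two_rpow {s t p : ℝ} (hs : 0 ≤ s) (ht : 0 ≤ t) (hp : 0 ≤ p) :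
    (s + t) ^ p ≤ 2 ^ p * (s ^ p + t ^ p) := by
  have h : (s + t) ≤ 2 * max s t := by
    rw [two_mul]; exact add_le_add (le_max_left _ _) (le_max_right _ _)
  have h2 : (max s t) ^ p ≤ s ^ p + t ^ p := by
    have := Real.rpow_nonneg hs p
    have := Real.rpow_nonneg ht p
    rcases max_cases s t with ⟨h, _⟩ | ⟨h, _⟩ <;> rw [h] <;> linarith
  calc (s + t) ^ p ≤ (2 * max s t) ^ p := Real.rpow_le_rpow (by positivity) h hp
    _ = 2 ^ p * (max s t) ^ p := Real.mul_rpow zero_le_two (le_max_of_le_left hs)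
    _ ≤ _ := by gcongr

/-- Young's inequality with a small constant. -/
theorem exists_young {ρ γ : ℝ} (h : ρ.HolderConjugate γ) {ε : ℝ} (hε : 0 < ε) :
    ∃ C : ℝ, 0 ≤ C ∧ ∀ s t : ℝ, 0 ≤ s → 0 ≤ t → s * t ≤ ε * t ^ ρ + C * s ^ γ := by
  have hρ := h.pos
  have hγ := h.symm.pos
  set δ : ℝ := ε ^ ρ⁻¹ with hδ
  have hδ0 : 0 < δ := by positivity
  refine ⟨(δ⁻¹) ^ γ, by positivity, fun s t hs ht => ?_⟩
  have h1 := Real.young_inequality_of_nonneg (by positivity : 0 ≤ δ * t)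
    (by positivity : 0 ≤ δ⁻¹ * s) h
  have h2 : δ * t * (δ⁻¹ * s) = s * t := by field_simp
  rw [h2, Real.mul_rpow hδ0.le ht, Real.mul_rpow (by positivity) hs] at h1
  have h3 : δ ^ ρ = ε := by
    rw [hδ, ← Real.rpow_mul hε.le, inv_mul_cancel₀ hρ.ne', Real.rpow_one]
  rw [h3] at h1
  refine h1.trans (add_le_add ?_ ?_)
  · exact div_le_self (by positivity) h.lt.le
  · exact div_le_self (by positivity) h.symm.lt.le

theorem two_le_of_holderConjugate {ρ γ : ℝ} (hconj : ρ.HolderConjugate γ) (hρ2 : ρ ≤ 2) : 2 ≤ γ := by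
  have h1 := hconj.inv_add_inv_eq_one
  have h2 : (2 : ℝ)⁻¹ ≤ ρ⁻¹ := inv_anti₀ hconj.pos hρ2
  have h3 : γ⁻¹ ≤ (2 : ℝ)⁻¹ := by linarith
  exact (inv_le_inv₀ hconj.symm.pos two_pos).1 h3

theorem norm_dotProduct_le {κ : Type*} [Fintype κ] (v w : κ → ℂ) :
    ‖v ⬝ᵥ w‖ ≤ Fintype.card κ * (‖v‖ * ‖w‖) := by
  unfold dotProduct
  refine (norm_sum_le _ _).trans ?_
  refine (Finset.sum_le_card_nsmul _ _ (‖v‖ * ‖w‖) fun j _ => ?_).trans_eq (by simp)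
  rw [norm_mul]
  exact mul_le_mul (norm_le_pi_norm v j) (norm_le_pi_norm w j) (norm_nonneg _) (norm_nonneg _)

theorem norm_mulVec_le {κ : Type*} [Fintype κ] (Q : Matrix κ κ ℂ) (v : κ → ℂ) :
    ‖Q *ᵥ v‖ ≤ (∑ j, ∑ k, ‖Q j k‖) * ‖v‖ := by
  rw [pi_norm_le_iff_of_nonneg (by positivity)]
  intro j
  unfold Matrix.mulVec dotProduct
  calc ‖∑ k, Q j k * v k‖ ≤ ∑ k, ‖Q j k‖ * ‖v‖ := by
        refine norm_sum_le_of_le _ fun k _ => ?_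
        rw [norm_mul]
        exact mul_le_mul_of_nonneg_left (norm_le_pi_norm v k) (norm_nonneg _)
    _ = (∑ k, ‖Q j k‖) * ‖v‖ := by rw [Finset.sum_mul]
    _ ≤ _ := by
        refine mul_le_mul_of_nonneg_right ?_ (norm_nonneg _)
        exact Finset.single_le_sum (f := fun j => ∑ k, ‖Q j k‖) (fun _ _ => by positivity)
          (Finset.mem_univ j)

end ScalarInequalities

section Kernel

variable {n : ℕ}

/-- The phase `ħ/2 ξ·Qξ + ξ_q·z + ħ/2 ξ_q·ξ_p`, where `ξ = (ξ_p, ξ_q)`. -/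
noncomputable def weylPhase (ħ : ℝ) (Q : Matrix (PhaseIndex n) (PhaseIndex n) ℂ) (z : Fin n → ℂ)
    (ξ : PhaseIndex n → ℂ) : ℂ :=
  ħ / 2 * (ξ ⬝ᵥ (Q *ᵥ ξ)) + (fun j => ξ (Sum.inr j)) ⬝ᵥ z +
    ħ / 2 * ((fun j => ξ (Sum.inr j)) ⬝ᵥ fun j => ξ (Sum.inl j))

/-- The value at `z` of the function to which the operator with the symbol `e^{i ξ·x}` maps `ψ`;
for real `ξ` it is `e^{(iħ/2) ξ·Qξ} (T_{ħΩξ} ψ)(z)`. -/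
noncomputable def weylKernel (ħ : ℝ) (Q : Matrix (PhaseIndex n) (PhaseIndex n) ℂ)
    (ψ : (Fin n → ℂ) → ℂ) (z : Fin n → ℂ) (ξ : PhaseIndex n → ℂ) : ℂ :=
  Complex.exp (Complex.I * weylPhase ħ Q z ξ) * ψ fun j => z j + ħ * ξ (Sum.inl j)

theorem differentiable_weylKernel (ħ : ℝ) (Q : Matrix (PhaseIndex n) (PhaseIndex n) ℂ)
    {ψ : (Fin n → ℂ) → ℂ} (hψ : Differentiable ℂ ψ) :
    Differentiable ℂ fun p : (Fin n → ℂ) × (PhaseIndex n → ℂ) => weylKernel ħ Q ψ p.1 p.2 := by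
  unfold weylKernel weylPhase dotProduct Matrix.mulVec dotProduct
  refine Differentiable.mul ?_ (hψ.comp ?_)
  · refine ((differentiable_const _).mul ?_).cexp
    fun_prop
  · fun_prop

theorem norm_weylPhase_le (ħ : ℝ) (Q : Matrix (PhaseIndex n) (PhaseIndex n) ℂ) (z : Fin n → ℂ)
    (ξ : PhaseIndex n → ℂ) :
    ‖weylPhase ħ Q z ξ‖ ≤
      |ħ| * ((n + n) * (∑ j, ∑ k, ‖Q j k‖) + n) * ‖ξ‖ ^ 2 + n * (‖ξ‖ * ‖z‖) := by
  have hinr : ‖fun j : Fin n => ξ (Sum.inr j)‖ ≤ ‖ξ‖ := by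
    rw [pi_norm_le_iff_of_nonneg (norm_nonneg _)]
    exact fun j => norm_le_pi_norm ξ _
  have hinl : ‖fun j : Fin n => ξ (Sum.inl j)‖ ≤ ‖ξ‖ := by
    rw [pi_norm_le_iff_of_nonneg (norm_nonneg _)]
    exact fun j => norm_le_pi_norm ξ _
  have hħ : ‖(ħ / 2 : ℂ)‖ ≤ |ħ| := by
    rw [norm_div, Complex.norm_real, Real.norm_eq_abs]
    simp only [Complex.norm_ofNat]
    have := abs_nonneg ħ
    linarith
  have h1 : ‖(ħ / 2 : ℂ) * (ξ ⬝ᵥ (Q *ᵥ ξ))‖ ≤ |ħ| * ((n + n) * (‖ξ‖ * ((∑ j, ∑ k, ‖Q j k‖) * ‖ξ‖))) := by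
    rw [norm_mul]
    refine mul_le_mul hħ ?_ (norm_nonneg _) (abs_nonneg _)
    refine (norm_dotProduct_le _ _).trans ?_
    simp only [Fintype.card_sum, Fintype.card_fin]
    push_cast
    gcongr
    exact norm_mulVec_le Q ξ
  have h2 : ‖(fun j => ξ (Sum.inr j)) ⬝ᵥ z‖ ≤ n * (‖ξ‖ * ‖z‖) := by
    refine (norm_dotProduct_le _ _).trans ?_
    rw [Fintype.card_fin]
    gcongr
  have h3 : ‖(ħ / 2 : ℂ) * ((fun j => ξ (Sum.inr j)) ⬝ᵥ fun j : Fin n => ξ (Sum.inl j))‖ ≤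
      |ħ| * (n * (‖ξ‖ * ‖ξ‖)) := by
    rw [norm_mul]
    refine mul_le_mul hħ ?_ (norm_nonneg _) (abs_nonneg _)
    refine (norm_dotProduct_le _ _).trans ?_
    rw [Fintype.card_fin]
    gcongr
  unfold weylPhase
  refine norm_add₃_le.trans ((add_le_add_three h1 h2 h3).trans_eq ?_)
  ring

/-- The growth of the kernel. The constants do not depend on `ψ`. -/
theorem exists_weylKernel_bound {ρ γ : ℝ} (hconj : ρ.HolderConjugate γ) (hρ2 : ρ ≤ 2) (ħ : ℝ)
    (Q : Matrix (PhaseIndex n) (PhaseIndex n) ℂ) {a b : ℝ} (ha : 0 < a) (hb : 0 < b) :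
    ∃ a' b' N K : ℝ, 0 < a' ∧ 0 < b' ∧ 0 ≤ N ∧ ∀ (ψ : (Fin n → ℂ) → ℂ) (M : ℝ),
      GSNormLE γ ρ a b M ψ → ∀ (q y : Fin n → ℝ) (ξ : PhaseIndex n → ℂ),
        ‖weylKernel ħ Q ψ (fun j => (q j : ℂ) + Complex.I * (y j : ℂ)) ξ‖ ≤
          M * Real.exp K * Real.exp (-(a' * ‖q‖ ^ ρ) + b' * ‖y‖ ^ γ) * Real.exp (N * ‖ξ‖ ^ γ) := by
  have hρ0 := hconj.pos
  have hγ0 := hconj.symm.pos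
  have hγ2 := two_le_of_holderConjugate hconj hρ2
  set c : ℝ := |ħ| * ((n + n) * (∑ j, ∑ k, ‖Q j k‖) + n) with hc
  have hc0 : 0 ≤ c := by positivity
  -- the shift of the argument of `ψ` by `ħ ξ_p` reduces `a` to `a / 2^ρ`, and half of the rest is
  -- spent on the term `ξ_q·q` of the phase, by the inequality of Young
  set a₁ : ℝ := a / 2 ^ ρ with ha₁
  have ha₁0 : 0 < a₁ := by positivity
  obtain ⟨C, hC, hyoung⟩ := exists_young hconj (half_pos ha₁0)
  refine ⟨a₁ / 2, n + b * 2 ^ γ + 1, (c + n) + C * n ^ γ + a * |ħ| ^ ρ + b * 2 ^ γ * |ħ| ^ γ,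
    c + 2 * n + a * |ħ| ^ ρ, by positivity, by positivity, by positivity,
    fun ψ M hψ q y ξ => ?_⟩
  have hM := hψ.nonneg
  set z : Fin n → ℂ := fun j => (q j : ℂ) + Complex.I * (y j : ℂ) with hz
  set X := ‖ξ‖ with hX
  have hX0 : 0 ≤ X := norm_nonneg _
  set α : Fin n → ℝ := fun j => (ξ (Sum.inl j)).re with hα
  set β : Fin n → ℝ := fun j => (ξ (Sum.inl j)).im with hβ
  have hαX : ‖α‖ ≤ X := by
    rw [pi_norm_le_iff_of_nonneg hX0]
    exact fun j => (Complex.abs_re_le_norm _).trans (norm_le_pi_norm ξ _)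
  have hβX : ‖β‖ ≤ X := by
    rw [pi_norm_le_iff_of_nonneg hX0]
    exact fun j => (Complex.abs_im_le_norm _).trans (norm_le_pi_norm ξ _)
  have hznorm : ‖z‖ ≤ ‖q‖ + ‖y‖ := by
    rw [pi_norm_le_iff_of_nonneg (by positivity)]
    intro j
    refine (norm_add_le _ _).trans (add_le_add ?_ ?_)
    · rw [Complex.norm_real]; exact norm_le_pi_norm q j
    · rw [norm_mul, Complex.norm_I, one_mul, Complex.norm_real]; exact norm_le_pi_norm y j
  -- `ψ` is evaluated at the point with the real part `q + ħα` and the imaginary part `y + ħβ`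
  have hshift : (fun j => z j + ħ * ξ (Sum.inl j)) =
      fun j => (((q + ħ • α) j : ℝ) : ℂ) + Complex.I * (((y + ħ • β) j : ℝ) : ℂ) := by
    funext j
    conv_lhs => rw [← Complex.re_add_im (ξ (Sum.inl j))]
    simp only [hz, hα, hβ, Pi.add_apply, Pi.smul_apply, smul_eq_mul]
    push_cast
    ring
  have hpsi := hψ (q + ħ • α) (y + ħ • β)
  rw [← hshift] at hpsi
  have hq : ‖q‖ ^ ρ ≤ 2 ^ ρ * (‖q + ħ • α‖ ^ ρ + (|ħ| * X) ^ ρ) := by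
    refine le_trans ?_ (add_rpow_le_two_rpow (norm_nonneg _) (by positivity) hρ0.le)
    refine Real.rpow_le_rpow (norm_nonneg _) ?_ hρ0.le
    calc ‖q‖ = ‖(q + ħ • α) - ħ • α‖ := by rw [add_sub_cancel_right]
      _ ≤ ‖q + ħ • α‖ + ‖ħ • α‖ := norm_sub_le _ _
      _ ≤ _ := by
        rw [norm_smul, Real.norm_eq_abs]
        gcongr
  have hy : ‖y + ħ • β‖ ^ γ ≤ 2 ^ γ * (‖y‖ ^ γ + (|ħ| * X) ^ γ) := by
    refine le_trans ?_ (add_rpow_le_two_rpow (norm_nonneg _) (by positivity) hγ0.le)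
    refine Real.rpow_le_rpow (norm_nonneg _) ?_ hγ0.le
    refine (norm_add_le _ _).trans ?_
    rw [norm_smul, Real.norm_eq_abs]
    gcongr
  rw [Real.mul_rpow (abs_nonneg _) hX0] at hq hy
  have hXρ : X ^ ρ ≤ 1 + X ^ γ := rpow_le_one_add_rpow hX0 hρ0.le (hρ2.trans hγ2)
  have hX2 : X ^ 2 ≤ 1 + X ^ γ := by
    have := rpow_le_one_add_rpow hX0 zero_le_two hγ2
    rwa [Real.rpow_two] at this
  have hy2 : ‖y‖ ^ 2 ≤ 1 + ‖y‖ ^ γ := by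
    have := rpow_le_one_add_rpow (norm_nonneg y) zero_le_two hγ2
    rwa [Real.rpow_two] at this
  have hyg := hyoung (n * X) ‖q‖ (by positivity) (norm_nonneg _)
  rw [Real.mul_rpow (Nat.cast_nonneg n) hX0] at hyg
  have hXy : X * ‖y‖ ≤ X ^ 2 + ‖y‖ ^ 2 := by nlinarith [sq_nonneg (X - ‖y‖), sq_nonneg X, sq_nonneg ‖y‖]
  have e1 : ‖weylPhase ħ Q z ξ‖ ≤ c * (1 + X ^ γ) + (a₁ / 2 * ‖q‖ ^ ρ + C * (n ^ γ * X ^ γ)) +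
      n * ((1 + X ^ γ) + (1 + ‖y‖ ^ γ)) := by
    refine (norm_weylPhase_le ħ Q z ξ).trans ?_
    calc c * X ^ 2 + n * (X * ‖z‖) ≤ c * (1 + X ^ γ) + n * (X * (‖q‖ + ‖y‖)) := by gcongr
      _ = c * (1 + X ^ γ) + n * X * ‖q‖ + n * (X * ‖y‖) := by ring
      _ ≤ _ := by
        have : (n : ℝ) * (X * ‖y‖) ≤ n * ((1 + X ^ γ) + (1 + ‖y‖ ^ γ)) := by
          gcongr; linarith
        linarith
  have e2 : -(a * ‖q + ħ • α‖ ^ ρ) ≤ -(a₁ * ‖q‖ ^ ρ) + a * (|ħ| ^ ρ * (1 + X ^ γ)) := by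
    have h2 : (0 : ℝ) < 2 ^ ρ := by positivity
    have h3 : a₁ * ‖q‖ ^ ρ ≤ a * (‖q + ħ • α‖ ^ ρ + |ħ| ^ ρ * X ^ ρ) := by
      rw [ha₁, div_mul_eq_mul_div, div_le_iff₀ h2]
      calc a * ‖q‖ ^ ρ ≤ a * (2 ^ ρ * (‖q + ħ • α‖ ^ ρ + |ħ| ^ ρ * X ^ ρ)) := by gcongr
        _ = _ := by ring
    have h4 : a * (|ħ| ^ ρ * X ^ ρ) ≤ a * (|ħ| ^ ρ * (1 + X ^ γ)) := by gcongr
    linarith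
  have e3 : b * ‖y + ħ • β‖ ^ γ ≤ b * (2 ^ γ * (‖y‖ ^ γ + |ħ| ^ γ * X ^ γ)) := by gcongr
  unfold weylKernel
  rw [norm_mul, Complex.norm_exp]
  have hre : (Complex.I * weylPhase ħ Q z ξ).re ≤ ‖weylPhase ħ Q z ξ‖ := by
    refine (Complex.re_le_norm _).trans_eq ?_
    rw [norm_mul, Complex.norm_I, one_mul]
  calc _ ≤ Real.exp ‖weylPhase ħ Q z ξ‖ *
        (M * Real.exp (-(a * ‖q + ħ • α‖ ^ ρ) + b * ‖y + ħ • β‖ ^ γ)) := by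
        refine mul_le_mul (Real.exp_le_exp.2 hre) hpsi (norm_nonneg _) (Real.exp_pos _).le
    _ = M * Real.exp (‖weylPhase ħ Q z ξ‖ + (-(a * ‖q + ħ • α‖ ^ ρ) + b * ‖y + ħ • β‖ ^ γ)) := by
        rw [Real.exp_add ‖weylPhase ħ Q z ξ‖]; ring
    _ ≤ M * Real.exp ((c + 2 * n + a * |ħ| ^ ρ) + (-(a₁ / 2 * ‖q‖ ^ ρ) +
          (n + b * 2 ^ γ + 1) * ‖y‖ ^ γ) +
          ((c + n) + C * n ^ γ + a * |ħ| ^ ρ + b * 2 ^ γ * |ħ| ^ γ) * X ^ γ) := by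
        refine mul_le_mul_of_nonneg_left (Real.exp_le_exp.2 ?_) hM
        have : 0 ≤ ‖y‖ ^ γ := by positivity
        linarith
    _ = _ := by rw [Real.exp_add, Real.exp_add]; ring

end Kernel

/-! ### The operator with a given symbol -/

section Linearity

variable {ι : Type} [Fintype ι] [DecidableEq ι]

theorem taylorCoef_add {G₁ G₂ : (ι → ℂ) → ℂ} (h₁ : Differentiable ℂ G₁) (h₂ : Differentiable ℂ G₂)
    (m : ℕ) (α : Fin m → ι) :
    taylorCoef (fun ξ => G₁ ξ + G₂ ξ) m α = taylorCoef G₁ m α + taylorCoef G₂ m α := by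
  have : (fun ξ => G₁ ξ + G₂ ξ) = G₁ + G₂ := rfl
  unfold taylorCoef
  rw [this, iteratedFDeriv_add_apply
    (((contDiff_of_differentiable h₁).of_le (by exact_mod_cast le_top)).contDiffAt)
    (((contDiff_of_differentiable h₂).of_le (by exact_mod_cast le_top)).contDiffAt)]
  simp only [add_apply]
  ring

theorem taylorCoef_smul {G : (ι → ℂ) → ℂ} (h : Differentiable ℂ G) (c : ℂ)
    (m : ℕ) (α : Fin m → ι) :
    taylorCoef (fun ξ => c * G ξ) m α = c * taylorCoef G m α := by
  have : (fun ξ => c * G ξ) = c • G := rfl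
  unfold taylorCoef
  rw [this, iteratedFDeriv_const_smul_apply
    (((contDiff_of_differentiable h).of_le (by exact_mod_cast le_top)).contDiffAt)]
  simp only [smul_apply, smul_eq_mul]
  ring

theorem differentiable_taylorCoef {E : Type*} [NormedAddCommGroup E] [NormedSpace ℂ E]
    [FiniteDimensional ℂ E] {H : E × (ι → ℂ) → ℂ} (hH : Differentiable ℂ H) (m : ℕ)
    (α : Fin m → ι) : Differentiable ℂ fun z => taylorCoef (fun ξ => H (z, ξ)) m α := by
  have hH' := contDiff_of_differentiable hH
  have key : ∀ z, iteratedFDeriv ℂ m (fun ξ => H (z, ξ)) 0 =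
      (iteratedFDeriv ℂ m H (z, 0)).compContinuousLinearMap
        fun _ => ContinuousLinearMap.inr ℂ E (ι → ℂ) := by
    intro z
    have h1 : (fun ξ => H (z, ξ)) =
        (fun p => H ((z, 0) + p)) ∘ ContinuousLinearMap.inr ℂ E (ι → ℂ) := by
      funext ξ; simp
    have h2 : ContDiff ℂ ∞ fun p => H ((z, 0) + p) :=
      hH'.comp (contDiff_const.add contDiff_id)
    rw [h1, ContinuousLinearMap.iteratedFDeriv_comp_right _ h2 _
      (by exact_mod_cast le_top), iteratedFDeriv_comp_add_left]
    simp
  unfold taylorCoef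
  simp only [key, ContinuousMultilinearMap.compContinuousLinearMap_apply]
  refine (differentiable_const _).mul ((differentiable_const _).mul ?_)
  have h3 : Differentiable ℂ (iteratedFDeriv ℂ m H) :=
    hH'.differentiable_iteratedFDeriv (by exact_mod_cast WithTop.coe_lt_top _)
  have h4 : Differentiable ℂ fun z : E => iteratedFDeriv ℂ m H (z, 0) :=
    h3.comp (differentiable_id.prodMk (differentiable_const _))
  exact (ContinuousMultilinearMap.apply ℂ (fun _ : Fin m => E × (ι → ℂ)) ℂ
    fun i => ContinuousLinearMap.inr ℂ E (ι → ℂ) (Pi.single (α i) 1)).differentiable.comp h4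

theorem ESpace.pair_add {ρ : ℝ} (hρ : 1 < ρ) {A B A' B' : ℝ} (hB : 0 ≤ B) (hB' : 0 ≤ B')
    {c d : ∀ m : ℕ, (Fin m → ι) → ℂ} (hc : CoefBound (1 - 1 / ρ) A B c)
    (hd : CoefBound (1 - 1 / ρ) A' B' d) (f : ESpace ρ ι) :
    pair (fun m α => c m α + d m α) f = pair c f + pair d f := by
  unfold pair
  rw [← (f.summable_pair hρ hB hc).1.tsum_add (f.summable_pair hρ hB' hd).1]
  refine tsum_congr fun m => ?_
  rw [← Finset.sum_add_distrib]
  exact Finset.sum_congr rfl fun α _ => add_mul _ _ _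

theorem pair_smul (k : ℂ) (c : ∀ m : ℕ, (Fin m → ι) → ℂ) (f : (ι → ℝ) → ℂ) :
    pair (fun m α => k * c m α) f = k * pair c f := by
  unfold pair
  rw [← tsum_mul_left]
  refine tsum_congr fun m => ?_
  rw [Finset.mul_sum]
  exact Finset.sum_congr rfl fun α _ => mul_assoc _ _ _

/-- If the coefficients depend holomorphically on a parameter, so does the functional. -/
theorem differentiable_pair {ρ : ℝ} (hρ : 1 < ρ) {E : Type*} [NormedAddCommGroup E]
    [NormedSpace ℂ E] [FiniteDimensional ℂ E] {c : E → ∀ m : ℕ, (Fin m → ι) → ℂ}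
    (hc : ∀ m α, Differentiable ℂ fun z => c z m α) {B : ℝ} (hB : 0 ≤ B)
    (hb : ∀ R : ℝ, ∃ A, ∀ z, ‖z‖ < R → CoefBound (1 - 1 / ρ) A B (c z)) (f : ESpace ρ ι) :
    Differentiable ℂ fun z => pair (c z) f := by
  refine differentiable_tsum_of_locally (fun m => ?_) fun R => ?_
  · exact Differentiable.fun_sum fun α _ => (hc m α).mul_const _
  · obtain ⟨A, hA⟩ := hb R
    set p := eSeminorms ρ ι ⟨pairIndex ι B, pairIndex_pos hB⟩ f
    refine ⟨fun m => A * p * (B / (2 * (B + 1))) ^ m, ?_, fun m z hz => ?_⟩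
    · refine (summable_geometric_of_lt_one (by positivity) ?_).mul_left _
      rw [div_lt_one (by positivity)]
      linarith
    · exact norm_pair_term_le (by positivity) (apply_nonneg _ _) (hA z hz)
        (f.iteratedFDeriv_zero_le hρ hB) m

end Linearity

section Operator

variable {n : ℕ} {ρ γ : ℝ}

theorem holderConjugate_inv (hconj : ρ.HolderConjugate γ) : (1 - 1 / ρ)⁻¹ = γ := by
  have := hconj.inv_add_inv_eq_one
  rw [one_div, show 1 - ρ⁻¹ = γ⁻¹ by linarith, inv_inv]

/-- The function `J(f) ψ`: the kernel `G(ξ)` of `ψ` at `z` is the symbol of a differential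
operator of infinite order, which is applied to `f` at the origin. -/
noncomputable def weylFun (ħ : ℝ) (Q : Matrix (PhaseIndex n) (PhaseIndex n) ℂ)
    (f : (PhaseIndex n → ℝ) → ℂ) (ψ : (Fin n → ℂ) → ℂ) (z : Fin n → ℂ) : ℂ :=
  pair (taylorCoef (weylKernel ħ Q ψ z)) f

theorem differentiable_weylKernel_right (ħ : ℝ) (Q : Matrix (PhaseIndex n) (PhaseIndex n) ℂ)
    {ψ : (Fin n → ℂ) → ℂ} (hψ : Differentiable ℂ ψ) (z : Fin n → ℂ) :
    Differentiable ℂ (weylKernel ħ Q ψ z) := by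
  unfold weylKernel weylPhase dotProduct Matrix.mulVec dotProduct
  refine Differentiable.mul ?_ (hψ.comp ?_)
  · refine ((differentiable_const _).mul ?_).cexp
    fun_prop
  · fun_prop

theorem eq_re_add_I_mul_im (z : Fin n → ℂ) :
    (fun j => (((fun j => (z j).re) j : ℝ) : ℂ) + Complex.I * (((fun j => (z j).im) j : ℝ) : ℂ)) = z := by
  funext j
  simp only
  rw [mul_comm]
  exact Complex.re_add_im (z j)

theorem norm_im_le (z : Fin n → ℂ) : ‖fun j => (z j).im‖ ≤ ‖z‖ := by
  rw [pi_norm_le_iff_of_nonneg (norm_nonneg _)]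
  exact fun j => (Complex.abs_im_le_norm _).trans (norm_le_pi_norm z j)

theorem exists_coefBound_weylKernel (hconj : ρ.HolderConjugate γ) (hρ2 : ρ ≤ 2) (ħ : ℝ)
    (Q : Matrix (PhaseIndex n) (PhaseIndex n) ℂ) {a b : ℝ} (ha : 0 < a) (hb : 0 < b) :
    ∃ a' b' B C : ℝ, 0 < a' ∧ 0 < b' ∧ 0 < B ∧ 0 ≤ C ∧ ∀ (ψ : (Fin n → ℂ) → ℂ) (M : ℝ),
      Differentiable ℂ ψ → GSNormLE γ ρ a b M ψ → ∀ (q y : Fin n → ℝ),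
        CoefBound (1 - 1 / ρ) (C * M * Real.exp (-(a' * ‖q‖ ^ ρ) + b' * ‖y‖ ^ γ)) B
          (taylorCoef (weylKernel ħ Q ψ fun j => (q j : ℂ) + Complex.I * (y j : ℂ))) := by
  obtain ⟨a', b', N, K, ha', hb', hN, h⟩ := exists_weylKernel_bound hconj hρ2 ħ Q ha hb
  refine ⟨a', b', (Fintype.card (PhaseIndex n) + 1) * Real.exp (N + 1),
    Real.exp K * Real.exp (N + 1), ha', hb', by positivity, by positivity, fun ψ M hψ hM q y => ?_⟩
  have := coefBound_taylorCoef (sigma_pos hconj.lt) hN (differentiable_weylKernel_right ħ Q hψ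
    fun j => (q j : ℂ) + Complex.I * (y j : ℂ)) (K := M * Real.exp K *
      Real.exp (-(a' * ‖q‖ ^ ρ) + b' * ‖y‖ ^ γ)) fun ξ => by
    rw [holderConjugate_inv hconj]
    exact h ψ M hM q y ξ
  convert this using 1
  ring

theorem exists_coefBound_weylKernel_of_gsSpace (hconj : ρ.HolderConjugate γ) (hρ2 : ρ ≤ 2) (ħ : ℝ)
    (Q : Matrix (PhaseIndex n) (PhaseIndex n) ℂ) (ψ : GSSpace γ ρ n) (z : Fin n → ℂ) :
    ∃ A B, 0 < B ∧ CoefBound (1 - 1 / ρ) A B (taylorCoef (weylKernel ħ Q ψ z)) := by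
  obtain ⟨hd, a, b, M, ha, hb, hM, h⟩ := ψ.2
  obtain ⟨a', b', B, C, ha', hb', hB, hC, hbd⟩ := exists_coefBound_weylKernel hconj hρ2 ħ Q ha hb
  have := hbd ψ M hd h (fun j => (z j).re) fun j => (z j).im
  rw [eq_re_add_I_mul_im] at this
  exact ⟨_, B, hB, this⟩

/-- The operators `J(f)` map each step of the inductive limit into another one, which does not
depend on `f`, and the bound is uniform on the bounded subsets of `𝓔^ρ`. -/
theorem exists_weylFun_bound (hconj : ρ.HolderConjugate γ) (hρ2 : ρ ≤ 2) (ħ : ℝ)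
    (Q : Matrix (PhaseIndex n) (PhaseIndex n) ℂ) {a b : ℝ} (ha : 0 < a) (hb : 0 < b) :
    ∃ (a' b' C L : ℝ) (hL : 0 < L), 0 < a' ∧ 0 < b' ∧ 0 ≤ C ∧
      ∀ (ψ : (Fin n → ℂ) → ℂ) (M : ℝ), Differentiable ℂ ψ → GSNormLE γ ρ a b M ψ →
        ∀ f : ESpace ρ (PhaseIndex n), GSNormLE γ ρ a' b'
          (C * M * eSeminorms ρ (PhaseIndex n) ⟨L, hL⟩ f) (weylFun ħ Q f ψ) := by
  obtain ⟨a', b', B, C, ha', hb', hB, hC, h⟩ := exists_coefBound_weylKernel hconj hρ2 ħ Q ha hb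
  refine ⟨a', b', 2 * C, _, pairIndex_pos (ι := PhaseIndex n) hB.le, ha', hb', by positivity,
    fun ψ M hψ hM f q y => ?_⟩
  refine (f.summable_pair hconj.lt hB.le (h ψ M hψ hM q y)).2.trans_eq ?_
  ring

theorem differentiable_weylFun (hconj : ρ.HolderConjugate γ) (hρ2 : ρ ≤ 2) (ħ : ℝ)
    (Q : Matrix (PhaseIndex n) (PhaseIndex n) ℂ) (f : ESpace ρ (PhaseIndex n))
    (ψ : GSSpace γ ρ n) : Differentiable ℂ (weylFun ħ Q f ψ) := by
  obtain ⟨hd, a, b, M, ha, hb, hM, h⟩ := ψ.2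
  obtain ⟨a', b', B, C, ha', hb', hB, hC, hbd⟩ := exists_coefBound_weylKernel hconj hρ2 ħ Q ha hb
  refine differentiable_pair hconj.lt (c := fun z => taylorCoef (weylKernel ħ Q ψ z))
    (fun m α => differentiable_taylorCoef (differentiable_weylKernel ħ Q hd) m α) hB.le
    (fun R => ⟨C * M * Real.exp (b' * R ^ γ), fun z hz m => ?_⟩) f
  have := hbd ψ M hd h (fun j => (z j).re) (fun j => (z j).im) m
  rw [eq_re_add_I_mul_im] at this
  refine this.trans (mul_le_mul_of_nonneg_right ?_ (by positivity))
  refine mul_le_mul_of_nonneg_left (Real.exp_le_exp.2 ?_) (by positivity)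
  have h1 : ‖fun j => (z j).im‖ ^ γ ≤ R ^ γ :=
    Real.rpow_le_rpow (norm_nonneg _) ((norm_im_le z).trans hz.le) hconj.symm.pos.le
  have h2 : b' * ‖fun j => (z j).im‖ ^ γ ≤ b' * R ^ γ := by gcongr
  have h3 : 0 ≤ a' * ‖fun j => (z j).re‖ ^ ρ := by positivity
  linarith

/-- `J(f) ψ` as an element of `W^γ_ρ`. -/
noncomputable def weylGS (hconj : ρ.HolderConjugate γ) (hρ2 : ρ ≤ 2) (ħ : ℝ)
    (Q : Matrix (PhaseIndex n) (PhaseIndex n) ℂ) (f : ESpace ρ (PhaseIndex n))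
    (ψ : GSSpace γ ρ n) : GSSpace γ ρ n :=
  ⟨weylFun ħ Q f ψ, differentiable_weylFun hconj hρ2 ħ Q f ψ, by
    obtain ⟨hd, a, b, M, ha, hb, hM, h⟩ := ψ.2
    obtain ⟨a', b', C, L, hL, ha', hb', hC, hbd⟩ := exists_weylFun_bound hconj hρ2 ħ Q ha hb
    refine ⟨a', b', C * M * eSeminorms ρ (PhaseIndex n) ⟨L, hL⟩ f + 1, ha', hb',
      by positivity, fun q y => (hbd ψ M hd h f q y).trans ?_⟩
    exact mul_le_mul_of_nonneg_right (by linarith) (Real.exp_pos _).le⟩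

theorem GSSpace.ext {ψ χ : GSSpace γ ρ n} (h : ∀ z, ψ z = χ z) : ψ = χ :=
  Subtype.ext (funext h)

theorem GSSpace.differentiable (ψ : GSSpace γ ρ n) : Differentiable ℂ ψ := ψ.2.1

theorem weylKernel_add (ħ : ℝ) (Q : Matrix (PhaseIndex n) (PhaseIndex n) ℂ)
    (ψ χ : (Fin n → ℂ) → ℂ) (z : Fin n → ℂ) :
    weylKernel ħ Q (ψ + χ) z = fun ξ => weylKernel ħ Q ψ z ξ + weylKernel ħ Q χ z ξ := by
  funext ξ
  simp only [weylKernel, Pi.add_apply, mul_add]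

theorem weylKernel_smul (ħ : ℝ) (Q : Matrix (PhaseIndex n) (PhaseIndex n) ℂ) (c : ℂ)
    (ψ : (Fin n → ℂ) → ℂ) (z : Fin n → ℂ) :
    weylKernel ħ Q (c • ψ) z = fun ξ => c * weylKernel ħ Q ψ z ξ := by
  funext ξ
  simp only [weylKernel, Pi.smul_apply, smul_eq_mul]
  ring

/-- `J(f)` as a linear map. -/
noncomputable def weylLin (hconj : ρ.HolderConjugate γ) (hρ2 : ρ ≤ 2) (ħ : ℝ)
    (Q : Matrix (PhaseIndex n) (PhaseIndex n) ℂ) (f : ESpace ρ (PhaseIndex n)) :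
    GSSpace γ ρ n →ₗ[ℂ] GSSpace γ ρ n where
  toFun := weylGS hconj hρ2 ħ Q f
  map_add' ψ χ := by
    refine GSSpace.ext fun z => ?_
    change pair (taylorCoef (weylKernel ħ Q (ψ.1 + χ.1) z)) f =
      pair (taylorCoef (weylKernel ħ Q ψ.1 z)) f + pair (taylorCoef (weylKernel ħ Q χ.1 z)) f
    obtain ⟨A, B, hB, hc⟩ := exists_coefBound_weylKernel_of_gsSpace hconj hρ2 ħ Q ψ z
    obtain ⟨A', B', hB', hc'⟩ := exists_coefBound_weylKernel_of_gsSpace hconj hρ2 ħ Q χ z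
    rw [← ESpace.pair_add hconj.lt hB.le hB'.le hc hc', weylKernel_add]
    congr 1
    funext m α
    exact taylorCoef_add (differentiable_weylKernel_right ħ Q ψ.differentiable z)
      (differentiable_weylKernel_right ħ Q χ.differentiable z) m α
  map_smul' c ψ := by
    refine GSSpace.ext fun z => ?_
    change pair (taylorCoef (weylKernel ħ Q (c • ψ.1) z)) f =
      c * pair (taylorCoef (weylKernel ħ Q ψ.1 z)) f
    rw [← pair_smul, weylKernel_smul]
    congr 1
    funext m α
    exact taylorCoef_smul (differentiable_weylKernel_right ħ Q ψ.differentiable z) c m α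

/-- On each step of the inductive limit, the continuous seminorms of `J(f) ψ` are bounded by the norm
of `ψ` in this step and by one of the norms of `f`. -/
theorem exists_seminorm_weylLin_le (hconj : ρ.HolderConjugate γ) (hρ2 : ρ ≤ 2) (ħ : ℝ)
    (Q : Matrix (PhaseIndex n) (PhaseIndex n) ℂ) (P : IndLimSeminorm γ ρ n) {a b : ℝ}
    (ha : 0 < a) (hb : 0 < b) :
    ∃ (C L : ℝ) (hL : 0 < L), 0 ≤ C ∧ ∀ (ψ : GSSpace γ ρ n) (M : ℝ), GSNormLE γ ρ a b M ψ →
      ∀ f : ESpace ρ (PhaseIndex n), P.1 (weylLin hconj hρ2 ħ Q f ψ) ≤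
        C * M * eSeminorms ρ (PhaseIndex n) ⟨L, hL⟩ f := by
  obtain ⟨a', b', C, L, hL, ha', hb', hC, hbd⟩ := exists_weylFun_bound hconj hρ2 ħ Q ha hb
  obtain ⟨D, hD⟩ := P.2 a' b' ha' hb'
  refine ⟨|D| * C, L, hL, by positivity, fun ψ M hM f => ?_⟩
  have hM0 := hM.nonneg
  have h1 := hD (weylLin hconj hρ2 ħ Q f ψ) _ (hbd ψ M ψ.differentiable hM f)
  refine h1.trans ?_
  calc D * (C * M * eSeminorms ρ (PhaseIndex n) ⟨L, hL⟩ f)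
      ≤ |D| * (C * M * eSeminorms ρ (PhaseIndex n) ⟨L, hL⟩ f) := by
        gcongr; exact le_abs_self D
    _ = _ := by ring

theorem continuous_weylLin (hconj : ρ.HolderConjugate γ) (hρ2 : ρ ≤ 2) (ħ : ℝ)
    (Q : Matrix (PhaseIndex n) (PhaseIndex n) ℂ) (f : ESpace ρ (PhaseIndex n)) :
    Continuous (weylLin hconj hρ2 ħ Q f) := by
  refine WithSeminorms.continuous_of_isBounded (gs_withSeminorms γ ρ n) (gs_withSeminorms γ ρ n) _
    fun P => ?_
  have hP : ∀ a b : ℝ, 0 < a → 0 < b → ∃ C : ℝ, ∀ (ψ : GSSpace γ ρ n) (M : ℝ),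
      GSNormLE γ ρ a b M ψ → P.1.comp (weylLin hconj hρ2 ħ Q f) ψ ≤ C * M := by
    intro a b ha hb
    obtain ⟨C, L, hL, -, h⟩ := exists_seminorm_weylLin_le hconj hρ2 ħ Q P ha hb
    refine ⟨C * eSeminorms ρ (PhaseIndex n) ⟨L, hL⟩ f, fun ψ M hM => ?_⟩
    exact (h ψ M hM f).trans_eq (by ring)
  set P' : IndLimSeminorm γ ρ n := ⟨P.1.comp (weylLin hconj hρ2 ħ Q f), hP⟩
  refine ⟨{P'}, 1, ?_⟩
  rw [Finset.sup_singleton, one_smul]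
  exact le_refl (gsSeminorms γ ρ n P')

/-- Point evaluation on `W^γ_ρ`. -/
def gsEval (z : Fin n → ℂ) : GSSpace γ ρ n →ₗ[ℂ] ℂ where
  toFun ψ := ψ z
  map_add' _ _ := rfl
  map_smul' _ _ := rfl

/-- The inductive limit is regular: a bounded subset is contained and bounded in one of the
steps. Otherwise there are `ψ_k` in the subset and points `z_k` at which `ψ_k` violates the bound
with the constants `1/(k+1)`, `k+1`, `k+1`; then `ψ ↦ sup_k |ψ(z_k)| w_k`, with the weights `w_k`
of these bounds, is a continuous seminorm that is unbounded on the subset. -/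
theorem exists_gsNormLE_of_isVonNBounded {S : Set (GSSpace γ ρ n)}
    (hS : Bornology.IsVonNBounded ℂ S) :
    ∃ a b M : ℝ, 0 < a ∧ 0 < b ∧ ∀ ψ ∈ S, GSNormLE γ ρ a b M ψ := by
  by_contra! hcon
  have hk : ∀ k : ℕ, ∃ ψ ∈ S, ∃ q y : Fin n → ℝ,
      ((k : ℝ) + 1) * Real.exp (-(((k : ℝ) + 1)⁻¹ * ‖q‖ ^ ρ) + ((k : ℝ) + 1) * ‖y‖ ^ γ) <
        ‖ψ.1 (fun j => (q j : ℂ) + Complex.I * (y j : ℂ))‖ := by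
    intro k
    obtain ⟨ψ, hψ, h⟩ := hcon ((k : ℝ) + 1)⁻¹ ((k : ℝ) + 1) ((k : ℝ) + 1) (by positivity)
      (by positivity)
    unfold GSNormLE at h
    push Not at h
    obtain ⟨q, y, h⟩ := h
    exact ⟨ψ, hψ, q, y, h⟩
  choose ψ hψS q y hlt using hk
  set w : ℕ → ℝ := fun k =>
    Real.exp (((k : ℝ) + 1)⁻¹ * ‖q k‖ ^ ρ - ((k : ℝ) + 1) * ‖y k‖ ^ γ) with hw
  set A : GSSpace γ ρ n →ₗ[ℂ] (ℕ → ℂ) := LinearMap.pi fun k =>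
    (w k : ℂ) • gsEval fun j => (q k j : ℂ) + Complex.I * (y k j : ℂ) with hA
  have hAn : ∀ (χ : GSSpace γ ρ n) k, ‖A χ k‖ =
      w k * ‖χ.1 fun j => (q k j : ℂ) + Complex.I * (y k j : ℂ)‖ := by
    intro χ k
    change ‖(w k : ℂ) * _‖ = _
    rw [norm_mul, Complex.norm_real, Real.norm_of_nonneg (Real.exp_pos _).le]
    rfl
  have hbound : ∀ a b : ℝ, 0 < a → 0 < b → ∃ C : ℝ, ∀ (χ : GSSpace γ ρ n) (M : ℝ),
      GSNormLE γ ρ a b M χ → ∀ k, ‖A χ k‖ ≤ C * M := by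
    intro a b ha hb
    -- for `k ≥ k₀`, the weight `w k` is dominated by that of the norm `‖·‖_{a,b}`
    obtain ⟨k₀, hk₀⟩ := exists_nat_ge (max a⁻¹ b)
    refine ⟨1 + ∑ k ∈ Finset.range k₀, w k * Real.exp (-(a * ‖q k‖ ^ ρ) + b * ‖y k‖ ^ γ),
      fun χ M hM k => ?_⟩
    have hM0 := hM.nonneg
    rw [hAn]
    have h1 : w k * ‖χ.1 fun j => (q k j : ℂ) + Complex.I * (y k j : ℂ)‖ ≤
        (w k * Real.exp (-(a * ‖q k‖ ^ ρ) + b * ‖y k‖ ^ γ)) * M := by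
      refine (mul_le_mul_of_nonneg_left (hM (q k) (y k)) (Real.exp_pos _).le).trans_eq ?_
      ring
    refine h1.trans (mul_le_mul_of_nonneg_right ?_ hM0)
    by_cases hkk : k < k₀
    · have := Finset.single_le_sum (f := fun k => w k * Real.exp (-(a * ‖q k‖ ^ ρ) + b * ‖y k‖ ^ γ))
        (fun _ _ => by positivity) (Finset.mem_range.2 hkk)
      linarith
    · have hk1 : (k₀ : ℝ) ≤ k := by exact_mod_cast not_lt.1 hkk
      have ha' : ((k : ℝ) + 1)⁻¹ ≤ a := by
        rw [inv_le_comm₀ (by positivity) ha]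
        linarith [le_max_left a⁻¹ b]
      have hb' : b ≤ (k : ℝ) + 1 := by linarith [le_max_right a⁻¹ b]
      have h2 : w k * Real.exp (-(a * ‖q k‖ ^ ρ) + b * ‖y k‖ ^ γ) ≤ 1 := by
        rw [hw, ← Real.exp_add, Real.exp_le_one_iff]
        have h3 : ((k : ℝ) + 1)⁻¹ * ‖q k‖ ^ ρ ≤ a * ‖q k‖ ^ ρ := by gcongr
        have h4 : b * ‖y k‖ ^ γ ≤ ((k : ℝ) + 1) * ‖y k‖ ^ γ := by gcongr
        linarith
      have : 0 ≤ ∑ k ∈ Finset.range k₀, w k * Real.exp (-(a * ‖q k‖ ^ ρ) + b * ‖y k‖ ^ γ) := by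
        positivity
      linarith
  have hbdd : ∀ χ : GSSpace γ ρ n, BddAbove (Set.range fun k => ‖A χ k‖) := by
    intro χ
    obtain ⟨-, a, b, M, ha, hb, -, h⟩ := χ.2
    obtain ⟨C, hC⟩ := hbound a b ha hb
    exact ⟨C * M, by rintro _ ⟨k, rfl⟩; exact hC χ M h k⟩
  set P : IndLimSeminorm γ ρ n := ⟨supSeminorm A hbdd, fun a b ha hb => by
    obtain ⟨C, hC⟩ := hbound a b ha hb
    exact ⟨C, fun χ M hM => ciSup_le fun k => hC χ M hM k⟩⟩ with hP
  obtain ⟨r, hr, hlt'⟩ := (gs_withSeminorms γ ρ n).isVonNBounded_iff_seminorm_bounded.1 hS P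
  obtain ⟨k, hk⟩ := exists_nat_gt r
  have h1 : ‖A (ψ k) k‖ < r := (le_ciSup (hbdd (ψ k)) k).trans_lt (hlt' (ψ k) (hψS k))
  have h2 : (k : ℝ) + 1 ≤ ‖A (ψ k) k‖ := by
    rw [hAn]
    calc (k : ℝ) + 1 = w k * (((k : ℝ) + 1) *
          Real.exp (-(((k : ℝ) + 1)⁻¹ * ‖q k‖ ^ ρ) + ((k : ℝ) + 1) * ‖y k‖ ^ γ)) := by
          rw [hw, mul_left_comm, ← Real.exp_add]
          simp
      _ ≤ _ := mul_le_mul_of_nonneg_left (hlt k).le (Real.exp_pos _).le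
  linarith

/-- The map `f ↦ J(f)` as a linear map. -/
noncomputable def weylMapLin (hconj : ρ.HolderConjugate γ) (hρ2 : ρ ≤ 2) (ħ : ℝ)
    (Q : Matrix (PhaseIndex n) (PhaseIndex n) ℂ) :
    ESpace ρ (PhaseIndex n) →ₗ[ℂ] OperatorAlgebra γ ρ n where
  toFun f := ⟨weylLin hconj hρ2 ħ Q f, continuous_weylLin hconj hρ2 ħ Q f⟩
  map_add' f g := by
    refine ContinuousLinearMap.ext fun ψ => GSSpace.ext fun z => ?_
    obtain ⟨A, B, hB, hc⟩ := exists_coefBound_weylKernel_of_gsSpace hconj hρ2 ħ Q ψ z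
    exact map_add (pairLin hconj.lt hB.le hc) f g
  map_smul' c f := by
    refine ContinuousLinearMap.ext fun ψ => GSSpace.ext fun z => ?_
    obtain ⟨A, B, hB, hc⟩ := exists_coefBound_weylKernel_of_gsSpace hconj hρ2 ħ Q ψ z
    exact map_smul (pairLin hconj.lt hB.le hc) c f

/-- The continuous linear map `J : 𝓔^ρ → 𝓐`. Since the bounded subsets of `W^γ_ρ` are bounded in one
of the steps of the inductive limit, the continuity follows from the uniform bounds on the steps. -/
noncomputable def weylMap (hconj : ρ.HolderConjugate γ) (hρ2 : ρ ≤ 2) (ħ : ℝ)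
    (Q : Matrix (PhaseIndex n) (PhaseIndex n) ℂ) :
    ESpace ρ (PhaseIndex n) →L[ℂ] OperatorAlgebra γ ρ n where
  toLinearMap := weylMapLin hconj hρ2 ħ Q
  cont := by
    set T := weylMapLin (n := n) hconj hρ2 ħ Q
    change Continuous T
    refine continuous_of_continuousAt_zero T ?_
    rw [ContinuousAt, map_zero, ((ContinuousLinearMap.hasBasis_nhds_zero_of_basis
      (gs_withSeminorms γ ρ n).hasBasis_zero_ball)).tendsto_right_iff]
    rintro ⟨S, s, r⟩ ⟨hS, hr⟩
    obtain ⟨a, b, M, ha, hb, hM⟩ := exists_gsNormLE_of_isVonNBounded hS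
    have h1 : ∀ P ∈ s, ∀ᶠ f in 𝓝 (0 : ESpace ρ (PhaseIndex n)), ∀ ψ ∈ S, P.1 (T f ψ) < r := by
      intro P _
      obtain ⟨C, L, hL, hC, h⟩ := exists_seminorm_weylLin_le hconj hρ2 ħ Q P ha hb
      have hcont : Continuous fun f : ESpace ρ (PhaseIndex n) =>
          C * M * eSeminorms ρ (PhaseIndex n) ⟨L, hL⟩ f :=
        continuous_const.mul (e_withSeminorms.continuous_seminorm ⟨L, hL⟩)
      have := hcont.tendsto 0
      rw [map_zero, mul_zero] at this
      filter_upwards [this.eventually (gt_mem_nhds hr)] with f hf ψ hψ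
      exact (h ψ M (hM ψ hψ) f).trans_lt hf
    filter_upwards [(Finset.eventually_all s).2 h1] with f hf ψ hψ
    rw [Seminorm.mem_ball_zero]
    exact Seminorm.finset_sup_apply_lt hr fun P hP => hf P hP ψ hψ

end Operator

/-! ### The star product on `𝓔^ρ` and on `𝒲^ρ` -/

section StarSpaces

variable {ι : Type} [Fintype ι] [DecidableEq ι] {ρ : ℝ}

omit [DecidableEq ι] in
theorem JetBound.mono {σ L L' C : ℝ} {w w' : (ι → ℝ) → ℝ} {f : (ι → ℝ) → ℂ}
    (h : JetBound σ L C w f) (hC : 0 ≤ C) (hL' : 0 < L') (hL : L' ≤ L) (hw : ∀ x, 0 ≤ w x)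
    (hww' : ∀ x, w x ≤ w' x) : JetBound σ L' C w' f := by
  intro m x
  refine (h m x).trans ?_
  have := hw x
  have := hww' x
  gcongr

omit [DecidableEq ι] in
theorem growth_mul_growth_le (hρ : 1 < ρ) {L L' : ℝ} (hL : 0 < L) (h : 4 * L ≤ L') (x : ι → ℝ) :
    growth ρ L' x * growth ρ L' x ≤ growth ρ L x := by
  unfold growth
  rw [← Real.exp_add, Real.exp_le_exp]
  have h1 : ‖x‖ / L' ≤ ‖x‖ / L * (1 / 4) := by
    rw [div_mul_div_comm, mul_one, mul_comm L]
    gcongr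
  have h2 : (‖x‖ / L') ^ ρ ≤ (‖x‖ / L) ^ ρ * (1 / 4) := by
    have hL' : 0 < L' := by linarith
    calc (‖x‖ / L') ^ ρ ≤ (‖x‖ / L * (1 / 4)) ^ ρ :=
          Real.rpow_le_rpow (by positivity) h1 (by linarith)
      _ = (‖x‖ / L) ^ ρ * (1 / 4) ^ ρ := Real.mul_rpow (by positivity) (by norm_num)
      _ ≤ (‖x‖ / L) ^ ρ * (1 / 4) := by
          refine mul_le_mul_of_nonneg_left ?_ (by positivity)
          refine (Real.rpow_le_rpow_of_exponent_ge (by norm_num) (by norm_num) hρ.le).trans_eq ?_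
          exact Real.rpow_one _
  have h3 : 0 ≤ (‖x‖ / L) ^ ρ := by positivity
  linarith

theorem sigma_le_half (hρ : 1 < ρ) (hρ2 : ρ ≤ 2) : 1 - 1 / ρ ≤ 1 / 2 := by
  have : 1 / 2 ≤ 1 / ρ := one_div_le_one_div_of_le (by linarith) hρ2
  linarith

/-- A length `L` from which the series of the star product is dominated by a geometric series. -/
noncomputable def starLength (ħ : ℝ) (ϑ : Matrix ι ι ℂ) : ℝ := 1 + 2 * starConst ħ ϑ

omit [DecidableEq ι] in
theorem starLength_pos (ħ : ℝ) (ϑ : Matrix ι ι ℂ) : 0 < starLength ħ ϑ := by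
  have := starConst_nonneg ħ ϑ
  unfold starLength; positivity

omit [DecidableEq ι] in
theorem starConst_div_le {ħ L : ℝ} {ϑ : Matrix ι ι ℂ} (hL : starLength ħ ϑ ≤ L) :
    starConst ħ ϑ / L ^ 2 ≤ 1 / 2 := by
  have h := starConst_nonneg ħ ϑ
  unfold starLength at hL
  rw [div_le_iff₀ (by nlinarith)]
  nlinarith

/-- The index `L'` of a norm such that `‖f ⋆ g‖_L` is controlled by `‖f‖_{L'} ‖g‖_{L'}`. -/
noncomputable def starIndex (ħ : ℝ) (ϑ : Matrix ι ι ℂ) (L : ℝ) : ℝ :=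
  (Fintype.card ι + 1) * (4 * L + starLength ħ ϑ)

omit [DecidableEq ι] in
theorem starIndex_pos (ħ : ℝ) (ϑ : Matrix ι ι ℂ) {L : ℝ} (hL : 0 < L) : 0 < starIndex ħ ϑ L := by
  have := starLength_pos ħ ϑ
  unfold starIndex; positivity

theorem ESpace.star_estimate (hρ : 1 < ρ) (hρ2 : ρ ≤ 2) (ħ : ℝ) (ϑ : Matrix ι ι ℂ)
    (f g : ESpace ρ ι) {L : ℝ} (hL : 0 < L) :
    IsStarProduct ħ ϑ f g (fun x => ∑' m, starTerm ħ ϑ f g m x) ∧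
    ContDiff ℝ ∞ (fun x => ∑' m, starTerm ħ ϑ f g m x) ∧
    JetBound (1 - 1 / ρ) L (2 * (eSeminorms ρ ι ⟨_, starIndex_pos ħ ϑ hL⟩ f *
      eSeminorms ρ ι ⟨_, starIndex_pos ħ ϑ hL⟩ g)) (growth ρ L)
      (fun x => ∑' m, starTerm ħ ϑ f g m x) := by
  have hs := starLength_pos ħ ϑ
  have hd : (0 : ℝ) < Fintype.card ι + 1 := by positivity
  set L₁ : ℝ := 4 * L + starLength ħ ϑ with hL₁
  have hL₁0 : 0 < L₁ := by positivity
  have hdiv : starIndex ħ ϑ L / (Fintype.card ι + 1) = L₁ := by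
    unfold starIndex
    field_simp
    rfl
  have hle : 4 * L ≤ starIndex ħ ϑ L := by
    unfold starIndex
    have : (0 : ℝ) ≤ Fintype.card ι * (4 * L + starLength ħ ϑ) := by positivity
    linarith
  have hf := f.jetBound hρ (starIndex_pos ħ ϑ hL)
  have hg := g.jetBound hρ (starIndex_pos ħ ϑ hL)
  rw [hdiv] at hf hg
  have huv : ∀ R : ℝ, ∃ D : ℝ, ∀ x : ι → ℝ, ‖x‖ < R →
      growth ρ (starIndex ħ ϑ L) x * growth ρ (starIndex ħ ϑ L) x ≤ D := by
    refine fun R => ⟨Real.exp ((R / L) ^ ρ), fun x hx => ?_⟩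
    refine (growth_mul_growth_le hρ hL hle x).trans (Real.exp_le_exp.2 ?_)
    have : ‖x‖ / L ≤ R / L := by gcongr
    exact Real.rpow_le_rpow (by positivity) this (by linarith)
  obtain ⟨h1, h2, h3⟩ := StarAlgebra.star_estimate (sigma_pos hρ).le (sigma_le_half hρ hρ2) hL₁0
    (apply_nonneg _ _) (apply_nonneg _ _) (fun x => (growth_pos ρ _ x).le)
    (fun x => (growth_pos ρ _ x).le) huv ħ ϑ
    (starConst_div_le (by linarith)) f.contDiff g.contDiff hf hg
  refine ⟨h1, h2, h3.mono ?_ hL (by linarith) (fun x => ?_)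
    fun x => growth_mul_growth_le hρ hL hle x⟩
  · exact mul_nonneg zero_le_two (mul_nonneg (apply_nonneg _ _) (apply_nonneg _ _))
  · exact mul_nonneg (growth_pos ρ _ x).le (growth_pos ρ _ x).le

/-- The star product on `𝓔^ρ`. -/
noncomputable def starE (hρ : 1 < ρ) (hρ2 : ρ ≤ 2) (ħ : ℝ) (ϑ : Matrix ι ι ℂ)
    (f g : ESpace ρ ι) : ESpace ρ ι :=
  ESpace.ofJet hρ (fun x => ∑' m, starTerm ħ ϑ f g m x)
    (f.star_estimate hρ hρ2 ħ ϑ g one_pos).2.1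
    fun _ hL => ⟨_, mul_nonneg zero_le_two (mul_nonneg (apply_nonneg _ _) (apply_nonneg _ _)),
      (f.star_estimate hρ hρ2 ħ ϑ g hL).2.2⟩

theorem isStarProduct_starE (hρ : 1 < ρ) (hρ2 : ρ ≤ 2) (ħ : ℝ) (ϑ : Matrix ι ι ℂ)
    (f g : ESpace ρ ι) : IsStarProduct ħ ϑ f g (starE hρ hρ2 ħ ϑ f g) :=
  (f.star_estimate hρ hρ2 ħ ϑ g one_pos).1

theorem exists_eSeminorm_starE_le (hρ : 1 < ρ) (hρ2 : ρ ≤ 2) (ħ : ℝ) (ϑ : Matrix ι ι ℂ)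
    {L : ℝ} (hL : 0 < L) : ∃ (L' : ℝ) (hL' : 0 < L'), ∀ f g : ESpace ρ ι,
      eSeminorms ρ ι ⟨L, hL⟩ (starE hρ hρ2 ħ ϑ f g) ≤
        2 * (eSeminorms ρ ι ⟨L', hL'⟩ f * eSeminorms ρ ι ⟨L', hL'⟩ g) := by
  have hL₁ : 0 < L * 2 ^ Fintype.card ι := by positivity
  refine ⟨_, starIndex_pos ħ ϑ hL₁, fun f g => ?_⟩
  have h := eSeminorm_le_of_jetBound hρ (starE hρ hρ2 ħ ϑ f g) hL₁
    (mul_nonneg zero_le_two (mul_nonneg (apply_nonneg _ _) (apply_nonneg _ _)))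
    (f.star_estimate hρ hρ2 ħ ϑ g hL₁).2.2
  have h2 : L * 2 ^ Fintype.card ι / 2 ^ Fintype.card ι = L :=
    mul_div_cancel_right₀ _ (by positivity)
  simpa only [h2] using h

/-! #### Bilinearity -/

theorem starTerm_add_left (ħ : ℝ) (ϑ : Matrix ι ι ℂ) {f₁ f₂ : (ι → ℝ) → ℂ} (g : (ι → ℝ) → ℂ)
    (h₁ : ContDiff ℝ ∞ f₁) (h₂ : ContDiff ℝ ∞ f₂) (m : ℕ) (x : ι → ℝ) :
    starTerm ħ ϑ (f₁ + f₂) g m x = starTerm ħ ϑ f₁ g m x + starTerm ħ ϑ f₂ g m x := by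
  unfold starTerm
  simp only [wordDeriv_add _ h₁ h₂, add_mul, mul_add, Finset.sum_add_distrib]

theorem starTerm_add_right (ħ : ℝ) (ϑ : Matrix ι ι ℂ) (f : (ι → ℝ) → ℂ) {g₁ g₂ : (ι → ℝ) → ℂ}
    (h₁ : ContDiff ℝ ∞ g₁) (h₂ : ContDiff ℝ ∞ g₂) (m : ℕ) (x : ι → ℝ) :
    starTerm ħ ϑ f (g₁ + g₂) m x = starTerm ħ ϑ f g₁ m x + starTerm ħ ϑ f g₂ m x := by
  unfold starTerm
  simp only [wordDeriv_add _ h₁ h₂, mul_add, Finset.sum_add_distrib]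

theorem starTerm_smul_left (ħ : ℝ) (ϑ : Matrix ι ι ℂ) {f : (ι → ℝ) → ℂ} (g : (ι → ℝ) → ℂ)
    (h : ContDiff ℝ ∞ f) (c : ℂ) (m : ℕ) (x : ι → ℝ) :
    starTerm ħ ϑ (c • f) g m x = c * starTerm ħ ϑ f g m x := by
  unfold starTerm
  simp only [wordDeriv_smul _ c h, Finset.mul_sum]
  exact Finset.sum_congr rfl fun _ _ => Finset.sum_congr rfl fun _ _ => by ring

theorem starTerm_smul_right (ħ : ℝ) (ϑ : Matrix ι ι ℂ) (f : (ι → ℝ) → ℂ) {g : (ι → ℝ) → ℂ}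
    (h : ContDiff ℝ ∞ g) (c : ℂ) (m : ℕ) (x : ι → ℝ) :
    starTerm ħ ϑ f (c • g) m x = c * starTerm ħ ϑ f g m x := by
  unfold starTerm
  simp only [wordDeriv_smul _ c h, Finset.mul_sum]
  exact Finset.sum_congr rfl fun _ _ => Finset.sum_congr rfl fun _ _ => by ring

/-- A linear operator on `𝓔^ρ` is continuous if each norm `‖·‖_L` is controlled by another one. -/
theorem ESpace.continuous_of_bound (T : ESpace ρ ι →ₗ[ℂ] ESpace ρ ι)
    (hT : ∀ (L : ℝ) (hL : 0 < L), ∃ (L' : ℝ) (hL' : 0 < L') (C : ℝ), 0 ≤ C ∧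
      ∀ f, eSeminorms ρ ι ⟨L, hL⟩ (T f) ≤ C * eSeminorms ρ ι ⟨L', hL'⟩ f) : Continuous T := by
  refine WithSeminorms.continuous_of_isBounded e_withSeminorms e_withSeminorms T fun L => ?_
  obtain ⟨L', hL', C, hC, h⟩ := hT L.1 L.2
  refine ⟨{⟨L', hL'⟩}, ⟨C, hC⟩, ?_⟩
  rw [Finset.sup_singleton]
  exact h

/-- The map `f ↦ f ⋆ g`. -/
noncomputable def starRight (hρ : 1 < ρ) (hρ2 : ρ ≤ 2) (ħ : ℝ) (ϑ : Matrix ι ι ℂ)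
    (g : ESpace ρ ι) : ESpace ρ ι →ₗ[ℂ] ESpace ρ ι where
  toFun f := starE hρ hρ2 ħ ϑ f g
  map_add' f₁ f₂ := ESpace.ext fun x =>
    (isStarProduct_starE hρ hρ2 ħ ϑ (f₁ + f₂) g x).unique <| by
      simp only [ESpace.add_coe, starTerm_add_left ħ ϑ g.1 f₁.contDiff f₂.contDiff]
      exact (isStarProduct_starE hρ hρ2 ħ ϑ f₁ g x).add (isStarProduct_starE hρ hρ2 ħ ϑ f₂ g x)
  map_smul' c f := ESpace.ext fun x =>
    (isStarProduct_starE hρ hρ2 ħ ϑ (c • f) g x).unique <| by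
      simp only [ESpace.smul_coe, starTerm_smul_left ħ ϑ g.1 f.contDiff]
      exact (isStarProduct_starE hρ hρ2 ħ ϑ f g x).mul_left c

theorem continuous_starRight (hρ : 1 < ρ) (hρ2 : ρ ≤ 2) (ħ : ℝ) (ϑ : Matrix ι ι ℂ)
    (g : ESpace ρ ι) : Continuous (starRight hρ hρ2 ħ ϑ g) :=
  ESpace.continuous_of_bound _ fun L hL => by
    obtain ⟨L', hL', h⟩ := exists_eSeminorm_starE_le hρ hρ2 ħ ϑ hL
    refine ⟨L', hL', 2 * eSeminorms ρ ι ⟨L', hL'⟩ g,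
      mul_nonneg zero_le_two (apply_nonneg _ _), fun f => (h f g).trans_eq ?_⟩
    ring

/-- The map `g ↦ f ⋆ g`. -/
noncomputable def starLeft (hρ : 1 < ρ) (hρ2 : ρ ≤ 2) (ħ : ℝ) (ϑ : Matrix ι ι ℂ)
    (f : ESpace ρ ι) : ESpace ρ ι →ₗ[ℂ] ESpace ρ ι where
  toFun g := starE hρ hρ2 ħ ϑ f g
  map_add' g₁ g₂ := ESpace.ext fun x =>
    (isStarProduct_starE hρ hρ2 ħ ϑ f (g₁ + g₂) x).unique <| by
      simp only [ESpace.add_coe, starTerm_add_right ħ ϑ f.1 g₁.contDiff g₂.contDiff]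
      exact (isStarProduct_starE hρ hρ2 ħ ϑ f g₁ x).add (isStarProduct_starE hρ hρ2 ħ ϑ f g₂ x)
  map_smul' c g := ESpace.ext fun x =>
    (isStarProduct_starE hρ hρ2 ħ ϑ f (c • g) x).unique <| by
      simp only [ESpace.smul_coe, starTerm_smul_right ħ ϑ f.1 g.contDiff]
      exact (isStarProduct_starE hρ hρ2 ħ ϑ f g x).mul_left c

theorem continuous_starLeft (hρ : 1 < ρ) (hρ2 : ρ ≤ 2) (ħ : ℝ) (ϑ : Matrix ι ι ℂ)
    (f : ESpace ρ ι) : Continuous (starLeft hρ hρ2 ħ ϑ f) :=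
  ESpace.continuous_of_bound _ fun L hL => by
    obtain ⟨L', hL', h⟩ := exists_eSeminorm_starE_le hρ hρ2 ħ ϑ hL
    refine ⟨L', hL', 2 * eSeminorms ρ ι ⟨L', hL'⟩ f,
      mul_nonneg zero_le_two (apply_nonneg _ _), fun g => (h f g).trans_eq ?_⟩
    ring

/-! #### Exponentials -/

/-- The exponentials multiply by the rule `e^{iξ·x} ⋆ e^{iη·x} = e^{-iħ ξ·ϑη} e^{i(ξ+η)·x}`. -/
theorem starE_expE (hρ : 1 < ρ) (hρ2 : ρ ≤ 2) (ħ : ℝ) (ϑ : Matrix ι ι ℂ) (ξ η : ι → ℝ) :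
    starE hρ hρ2 ħ ϑ (expE hρ ξ) (expE hρ η) =
      Complex.exp (-(Complex.I * ħ * ((fun j => (ξ j : ℂ)) ⬝ᵥ (ϑ *ᵥ fun j => (η j : ℂ))))) •
        expE hρ (ξ + η) := by
  refine ESpace.ext fun x => (isStarProduct_starE hρ hρ2 ħ ϑ _ _ x).unique ?_
  rw [ESpace.smul_coe, Pi.smul_apply, smul_eq_mul]
  set a : ℂ := -(Complex.I * ħ * ((fun j => (ξ j : ℂ)) ⬝ᵥ (ϑ *ᵥ fun j => (η j : ℂ)))) with ha
  have hterm : ∀ m, starTerm ħ ϑ (expE hρ ξ) (expE hρ η) m x =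
      a ^ m / (m ! : ℂ) * expFun (ξ + η) x := by
    intro m
    change starTerm ħ ϑ (expFun ξ) (expFun η) m x = _
    have hprod : expFun ξ x * expFun η x = expFun (ξ + η) x := by
      unfold expFun
      rw [← Complex.exp_add, add_dotProduct]
      push_cast
      ring_nf
    unfold starTerm
    simp only [wordDeriv_expFun]
    have h1 : ∀ α β : Fin m → ι, (∏ i, ϑ (α i) (β i)) *
        (((∏ i, Complex.I * (ξ (α i) : ℂ)) * expFun ξ x) *
          ((∏ i, Complex.I * (η (β i) : ℂ)) * expFun η x)) =
        (∏ i, -(ξ (α i) * (ϑ (α i) (β i) * η (β i)) : ℂ)) * expFun (ξ + η) x := by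
      intro α β
      have h2 : ∀ i, -(ξ (α i) * (ϑ (α i) (β i) * η (β i)) : ℂ) =
          ϑ (α i) (β i) * ((Complex.I * ξ (α i)) * (Complex.I * η (β i))) := by
        intro i
        linear_combination (-(ϑ (α i) (β i) * ξ (α i) * η (β i))) * Complex.I_mul_I
      rw [Finset.prod_congr rfl fun i _ => h2 i, ← hprod]
      simp only [Finset.prod_mul_distrib]
      ring
    simp only [h1, ← Finset.sum_mul]
    rw [sum_words_prod (fun j k => -(ξ j * (ϑ j k * η k) : ℂ)) m, ← mul_assoc]
    congr 1
    rw [div_mul_eq_mul_div, ← mul_pow]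
    congr 2
    rw [ha]
    simp only [dotProduct, Matrix.mulVec, Finset.mul_sum, Finset.sum_neg_distrib, mul_neg]
  simp only [hterm]
  have := (NormedSpace.expSeries_div_hasSum_exp a).mul_right (expFun (ξ + η) x)
  rwa [← Complex.exp_eq_exp_ℂ] at this

/-! #### The space `𝒲^ρ` -/

/-- The jets of the elements of `𝒲^ρ`. -/
theorem exists_jetBound_of_mem_wSubmodule (hρ : 1 < ρ) {f : ESpace ρ ι} (hf : f ∈ wSubmodule ρ ι)
    {L : ℝ} (hL : 0 < L) (N : ℕ) :
    ∃ C, 0 ≤ C ∧ JetBound (1 - 1 / ρ) L C (fun x => ((1 + ‖x‖) ^ N)⁻¹) f := by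
  have hd : (0 : ℝ) < Fintype.card ι + 1 := by positivity
  obtain ⟨C, hC⟩ := hf (L * (Fintype.card ι + 1)) (by positivity) N
  refine ⟨max C 0, le_max_right _ _, ?_⟩
  have := jetBound_of_multiDeriv (σ := 1 - 1 / ρ) (C := max C 0) (f := f.1)
    (w := fun x : ι → ℝ => ((1 + ‖x‖) ^ N)⁻¹) (sigma_pos hρ).le
    (by positivity : 0 < L * (Fintype.card ι + 1)) (le_max_right _ _)
    (fun x => by positivity) f.contDiff fun κ x => (hC κ x).trans <| by
      have : (0 : ℝ) < mfact κ := by exact_mod_cast mfact_pos κ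
      gcongr
      exact le_max_left _ _
  rwa [mul_div_cancel_right₀ _ hd.ne'] at this

theorem mem_wSubmodule_of_jetBound (hρ : 1 < ρ) {f : ESpace ρ ι}
    (hf : ∀ L : ℝ, 0 < L → ∀ N : ℕ,
      ∃ C, 0 ≤ C ∧ JetBound (1 - 1 / ρ) L C (fun x => ((1 + ‖x‖) ^ N)⁻¹) f) :
    f ∈ wSubmodule ρ ι := by
  intro L hL N
  obtain ⟨C, hC, h⟩ := hf (L * 2 ^ Fintype.card ι) (by positivity) N
  have hσ1 : 1 - 1 / ρ ≤ 1 := by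
    have : 0 < 1 / ρ := by positivity
    linarith
  refine ⟨C, fun κ x => ?_⟩
  have := h.multiDeriv_le (sigma_pos hρ).le hσ1 (by positivity) hC (fun x => by positivity) κ x
  rwa [mul_div_cancel_right₀ _ (by positivity)] at this

theorem starE_mem_wSubmodule (hρ : 1 < ρ) (hρ2 : ρ ≤ 2) (ħ : ℝ) (ϑ : Matrix ι ι ℂ)
    {f g : ESpace ρ ι} (hf : f ∈ wSubmodule ρ ι) (hg : g ∈ wSubmodule ρ ι) :
    starE hρ hρ2 ħ ϑ f g ∈ wSubmodule ρ ι := by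
  refine mem_wSubmodule_of_jetBound hρ fun L hL N => ?_
  have hs := starLength_pos ħ ϑ
  have hL₁ : 0 < 4 * L + starLength ħ ϑ := by positivity
  obtain ⟨C, hC, hbf⟩ := exists_jetBound_of_mem_wSubmodule hρ hf hL₁ N
  -- the decay of one of the factors suffices
  obtain ⟨D, hD, hbg⟩ := exists_jetBound_of_mem_wSubmodule hρ hg hL₁ 0
  have h := (star_estimate (sigma_pos hρ).le (sigma_le_half hρ hρ2) hL₁ hC hD
    (fun x => by positivity) (fun x => by positivity) (fun R => ⟨1, fun x _ => ?_⟩) ħ ϑ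
    (starConst_div_le (by linarith)) f.contDiff g.contDiff hbf hbg).2.2
  · refine ⟨2 * (C * D), by positivity, h.mono (by positivity) hL (by linarith)
      (fun x => by positivity) fun x => ?_⟩
    simp
  · simp only [pow_zero, inv_one, mul_one]
    exact inv_le_one_of_one_le₀ (one_le_pow₀ (le_add_of_nonneg_right (norm_nonneg x)))

/-- A continuous linear functional on `𝓔^ρ` that vanishes on the exponentials is zero. -/
theorem eq_zero_of_expE (hρ : 1 < ρ) {T : ESpace ρ ι →ₗ[ℂ] ℂ} (hT : Continuous T)
    (h0 : ∀ ξ, T (expE hρ ξ) = 0) : T = 0 := by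
  obtain ⟨L, hL, C, hC, h⟩ := exists_le_eSeminorm hρ (q := (normSeminorm ℂ ℂ).comp T) hT.norm
  exact functional_eq_zero hρ T hL hC h h0

end StarSpaces

/-! ### The homomorphism property -/

section Homomorphism

variable {n : ℕ} {ρ γ : ℝ}

theorem inv_Omega (R : Type) [CommRing R] : (Omega n R)⁻¹ = -Omega n R := by
  refine Matrix.inv_eq_right_inv ?_
  unfold Omega
  rw [Matrix.fromBlocks_neg, Matrix.fromBlocks_multiply]
  simp [Matrix.fromBlocks_one]

theorem Omega_mulVec {R : Type} [CommRing R] (v : PhaseIndex n → R) :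
    Omega n R *ᵥ v = Sum.elim (fun j => v (Sum.inr j)) fun j => -v (Sum.inl j) := by
  unfold Omega
  rw [Matrix.fromBlocks_mulVec]
  congr 1 <;> funext j <;> simp [Matrix.neg_mulVec]

theorem dotProduct_Omega_mulVec {R : Type} [CommRing R] (u v : PhaseIndex n → R) :
    u ⬝ᵥ (Omega n R *ᵥ v) = (fun j => u (Sum.inl j)) ⬝ᵥ (fun j => v (Sum.inr j)) -
      (fun j => u (Sum.inr j)) ⬝ᵥ fun j => v (Sum.inl j) := by
  rw [Omega_mulVec]
  simp [dotProduct, Fintype.sum_sum_type, sub_eq_add_neg]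

theorem dotProduct_theta_mulVec (Q : Matrix (PhaseIndex n) (PhaseIndex n) ℂ)
    (ξ η : PhaseIndex n → ℂ) :
    ξ ⬝ᵥ (theta Q *ᵥ η) = ξ ⬝ᵥ (Q *ᵥ η) - 1 / 2 *
      ((fun j => ξ (Sum.inl j)) ⬝ᵥ (fun j => η (Sum.inr j)) -
        (fun j => ξ (Sum.inr j)) ⬝ᵥ fun j => η (Sum.inl j)) := by
  unfold theta
  rw [inv_Omega, Matrix.add_mulVec, dotProduct_add, smul_neg, Matrix.neg_mulVec, dotProduct_neg,
    Matrix.smul_mulVec, dotProduct_smul, dotProduct_Omega_mulVec, smul_eq_mul, ← sub_eq_add_neg]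

/-- The cocycle identity behind the homomorphism property. -/
theorem weylPhase_add {Q : Matrix (PhaseIndex n) (PhaseIndex n) ℂ} (hQ : Q.IsSymm) (ħ : ℝ)
    (z : Fin n → ℂ) (ξ η : PhaseIndex n → ℂ) :
    weylPhase ħ Q z ξ + weylPhase ħ Q (fun j => z j + ħ * ξ (Sum.inl j)) η =
      weylPhase ħ Q z (ξ + η) - ħ * (ξ ⬝ᵥ (theta Q *ᵥ η)) := by
  have hsymm : η ⬝ᵥ (Q *ᵥ ξ) = ξ ⬝ᵥ (Q *ᵥ η) := by
    rw [Matrix.dotProduct_mulVec, ← Matrix.mulVec_transpose, hQ.eq, dotProduct_comm]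
  have h1 : (fun j => η (Sum.inr j)) ⬝ᵥ (fun j => z j + ħ * ξ (Sum.inl j)) =
      (fun j => η (Sum.inr j)) ⬝ᵥ z +
        ħ * ((fun j => ξ (Sum.inl j)) ⬝ᵥ fun j => η (Sum.inr j)) := by
    simp only [dotProduct, mul_add, Finset.sum_add_distrib, Finset.mul_sum]
    congr 1
    exact Finset.sum_congr rfl fun _ _ => by ring
  have h2 : (fun j => (ξ + η) (Sum.inr j)) =
      (fun j : Fin n => ξ (Sum.inr j)) + fun j => η (Sum.inr j) := rfl
  have h3 : (fun j => (ξ + η) (Sum.inl j)) =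
      (fun j : Fin n => ξ (Sum.inl j)) + fun j => η (Sum.inl j) := rfl
  unfold weylPhase
  rw [dotProduct_theta_mulVec, h1, h2, h3, Matrix.mulVec_add]
  simp only [add_dotProduct, dotProduct_add]
  rw [hsymm, dotProduct_comm (fun j => η (Sum.inr j)) fun j => ξ (Sum.inl j)]
  ring

/-- The homomorphism property on exponentials: the operators compose by the rule by which the
exponentials multiply. -/
theorem weylKernel_weylKernel {Q : Matrix (PhaseIndex n) (PhaseIndex n) ℂ} (hQ : Q.IsSymm) (ħ : ℝ)
    (ψ : (Fin n → ℂ) → ℂ) (z : Fin n → ℂ) (ξ η : PhaseIndex n → ℂ) :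
    weylKernel ħ Q (fun w => weylKernel ħ Q ψ w η) z ξ =
      Complex.exp (-(Complex.I * ħ * (ξ ⬝ᵥ (theta Q *ᵥ η)))) * weylKernel ħ Q ψ z (ξ + η) := by
  unfold weylKernel
  rw [← mul_assoc, ← mul_assoc, ← Complex.exp_add, ← Complex.exp_add, ← mul_add,
    weylPhase_add hQ]
  congr 2
  · ring
  · funext j
    simp only [Pi.add_apply]
    ring

theorem weylMap_expE (hconj : ρ.HolderConjugate γ) (hρ2 : ρ ≤ 2) (ħ : ℝ)
    (Q : Matrix (PhaseIndex n) (PhaseIndex n) ℂ) (ξ : PhaseIndex n → ℝ)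
    (ψ : GSSpace γ ρ n) (z : Fin n → ℂ) :
    weylMap hconj hρ2 ħ Q (expE hconj.lt ξ) ψ z = weylKernel ħ Q ψ z fun j => (ξ j : ℂ) :=
  pair_taylorCoef_expFun (differentiable_weylKernel_right ħ Q ψ.differentiable z) ξ

theorem continuous_gsEval (z : Fin n → ℂ) : Continuous (gsEval z : GSSpace γ ρ n →ₗ[ℂ] ℂ) := by
  have hP : ∀ a b : ℝ, 0 < a → 0 < b → ∃ C : ℝ, ∀ (ψ : GSSpace γ ρ n) (M : ℝ),
      GSNormLE γ ρ a b M ψ → (normSeminorm ℂ ℂ).comp (gsEval z) ψ ≤ C * M := by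
    intro a b _ _
    refine ⟨Real.exp (-(a * ‖fun j => (z j).re‖ ^ ρ) + b * ‖fun j => (z j).im‖ ^ γ),
      fun ψ M hM => ?_⟩
    have := hM (fun j => (z j).re) fun j => (z j).im
    rw [eq_re_add_I_mul_im] at this
    exact this.trans_eq (mul_comm _ _)
  set P : IndLimSeminorm γ ρ n := ⟨(normSeminorm ℂ ℂ).comp (gsEval z), hP⟩
  refine WithSeminorms.continuous_of_isBounded (gs_withSeminorms γ ρ n) (norm_withSeminorms ℂ ℂ) _
    fun _ => ⟨{P}, 1, ?_⟩
  rw [Finset.sup_singleton, one_smul]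
  exact le_refl (gsSeminorms γ ρ n P)

theorem continuous_operator_apply (J : ESpace ρ (PhaseIndex n) →L[ℂ] OperatorAlgebra γ ρ n)
    (ψ : GSSpace γ ρ n) : Continuous fun f => J f ψ :=
  (continuous_eval_const ψ).comp J.continuous

/-- The map `J` is a homomorphism: by the continuity in each factor it suffices to consider
exponentials. -/
theorem weylMap_starE (hconj : ρ.HolderConjugate γ) (hρ2 : ρ ≤ 2) (ħ : ℝ)
    {Q : Matrix (PhaseIndex n) (PhaseIndex n) ℂ} (hQ : Q.IsSymm)
    (f g : ESpace ρ (PhaseIndex n)) :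
    weylMap hconj hρ2 ħ Q (starE hconj.lt hρ2 ħ (theta Q) f g) =
      (weylMap hconj hρ2 ħ Q f).comp (weylMap hconj hρ2 ħ Q g) := by
  refine ContinuousLinearMap.ext fun ψ => GSSpace.ext fun z => ?_
  set J := weylMap (n := n) hconj hρ2 ħ Q with hJ
  -- `(J(·) χ)(z)` as a functional
  let ev : GSSpace γ ρ n → ESpace ρ (PhaseIndex n) →ₗ[ℂ] ℂ := fun χ =>
    { toFun := fun f => J f χ z
      map_add' := fun f₁ f₂ => by rw [map_add]; rfl
      map_smul' := fun c f => by rw [map_smul]; rfl }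
  have hev : ∀ χ, Continuous (ev χ) := fun χ =>
    (continuous_gsEval z).comp (continuous_operator_apply J χ)
  -- `(J(f) J(·) ψ)(z)` as a functional
  let ev₂ : ESpace ρ (PhaseIndex n) → ESpace ρ (PhaseIndex n) →ₗ[ℂ] ℂ := fun f =>
    { toFun := fun g => J f (J g ψ) z
      map_add' := fun g₁ g₂ => by
        rw [map_add]
        change J f (J g₁ ψ + J g₂ ψ) z = _
        rw [map_add]; rfl
      map_smul' := fun c g => by
        rw [map_smul]
        change J f (c • J g ψ) z = _
        rw [map_smul]; rfl }
  have hev₂ : ∀ f, Continuous (ev₂ f) := fun f =>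
    (continuous_gsEval z).comp ((J f).continuous.comp (continuous_operator_apply J ψ))
  -- the case where the first factor is an exponential
  have hexp : ∀ ξ g, J (starE hconj.lt hρ2 ħ (theta Q) (expE hconj.lt ξ) g) ψ z =
      J (expE hconj.lt ξ) (J g ψ) z := by
    intro ξ g
    have h0 : (ev ψ).comp (starLeft hconj.lt hρ2 ħ (theta Q) (expE hconj.lt ξ)) -
        ev₂ (expE hconj.lt ξ) = 0 := by
      refine eq_zero_of_expE hconj.lt (((hev ψ).comp
        (continuous_starLeft hconj.lt hρ2 ħ (theta Q) (expE hconj.lt ξ))).sub (hev₂ _)) fun η => ?_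
      refine sub_eq_zero.2 ?_
      change ev ψ (starE hconj.lt hρ2 ħ (theta Q) (expE hconj.lt ξ) (expE hconj.lt η)) =
        J (expE hconj.lt ξ) (J (expE hconj.lt η) ψ) z
      rw [starE_expE, map_smul]
      change _ * J (expE hconj.lt (ξ + η)) ψ z = _
      rw [hJ, weylMap_expE, weylMap_expE]
      have : (weylMap hconj hρ2 ħ Q (expE hconj.lt η) ψ).1 =
          fun w => weylKernel ħ Q ψ w fun j => (η j : ℂ) :=
        funext fun w => weylMap_expE hconj hρ2 ħ Q η ψ w
      rw [this, weylKernel_weylKernel hQ]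
      congr 2
      funext j
      simp
    exact sub_eq_zero.1 (LinearMap.congr_fun h0 g)
  have h0 : (ev ψ).comp (starRight hconj.lt hρ2 ħ (theta Q) g) - ev (J g ψ) = 0 :=
    eq_zero_of_expE hconj.lt (((hev ψ).comp
      (continuous_starRight hconj.lt hρ2 ħ (theta Q) g)).sub (hev _)) fun ξ =>
        sub_eq_zero.2 (hexp ξ g)
  exact sub_eq_zero.1 (LinearMap.congr_fun h0 f)

theorem expE_zero_apply (hρ : 1 < ρ) (x : PhaseIndex n → ℝ) :
    (expE hρ (0 : PhaseIndex n → ℝ)) x = 1 := by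
  change expFun 0 x = 1
  simp [expFun]

theorem weylMap_one (hconj : ρ.HolderConjugate γ) (hρ2 : ρ ≤ 2) (ħ : ℝ)
    (Q : Matrix (PhaseIndex n) (PhaseIndex n) ℂ) :
    weylMap hconj hρ2 ħ Q (expE hconj.lt 0) = ContinuousLinearMap.id ℂ (GSSpace γ ρ n) := by
  refine ContinuousLinearMap.ext fun ψ => GSSpace.ext fun z => ?_
  rw [weylMap_expE]
  simp [weylKernel, weylPhase, dotProduct]

end Homomorphism

/-! ### The Fourier transformation -/

section Fourier

variable {ι : Type} [Fintype ι]

/-- The transform `ξ ↦ ∫ f(x) e^{i ξ·x} dx`. -/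
noncomputable def expTransform (f : (ι → ℝ) → ℂ) (ξ : ι → ℝ) : ℂ := ∫ x, f x * expFun ξ x

/-- The bilinear form `-(2π)⁻¹ v·w`, which turns Mathlib's Fourier integral into
`expTransform`. -/
noncomputable def fourierForm (ι : Type) [Fintype ι] : (ι → ℝ) →L[ℝ] (ι → ℝ) →L[ℝ] ℝ :=
  (-(2 * Real.pi)⁻¹) • ∑ j, (ContinuousLinearMap.proj j : (ι → ℝ) →L[ℝ] ℝ).smulRight
    (ContinuousLinearMap.proj j : (ι → ℝ) →L[ℝ] ℝ)

theorem fourierForm_apply (v w : ι → ℝ) : fourierForm ι v w = -((2 * Real.pi)⁻¹ * (v ⬝ᵥ w)) := by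
  simp [fourierForm, dotProduct]

theorem fourierIntegral_fourierForm (f : (ι → ℝ) → ℂ) :
    VectorFourier.fourierIntegral Real.fourierChar volume (fourierForm ι).toLinearMap₁₂ f =
      expTransform f := by
  funext ξ
  unfold VectorFourier.fourierIntegral expTransform
  refine integral_congr_ae (ae_of_all _ fun x => ?_)
  change Real.fourierChar (-(fourierForm ι x ξ)) • f x = _
  rw [Circle.smul_def, Real.fourierChar_apply, fourierForm_apply, smul_eq_mul, mul_comm]
  unfold expFun
  congr 2
  have : (Real.pi : ℂ) ≠ 0 := by exact_mod_cast Real.pi_ne_zero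
  rw [dotProduct_comm]
  push_cast
  field_simp

theorem expFun_comm (ξ x : ι → ℝ) : expFun ξ x = expFun x ξ := by
  unfold expFun; rw [dotProduct_comm]

theorem continuous_expTransform {f : (ι → ℝ) → ℂ} (hf : Integrable f) :
    Continuous (expTransform f) := by
  rw [← fourierIntegral_fourierForm]
  exact VectorFourier.fourierIntegral_continuous Real.continuous_fourierChar
    (by fun_prop : Continuous fun p : (ι → ℝ) × (ι → ℝ) => fourierForm ι p.1 p.2) hf

variable [DecidableEq ι]

theorem expTransform_wordDeriv {f : (ι → ℝ) → ℂ} (hf : ContDiff ℝ ∞ f)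
    (hint : ∀ m, Integrable (iteratedFDeriv ℝ m f)) {m : ℕ} (α : Fin m → ι) (ξ : ι → ℝ) :
    expTransform (wordDeriv α f) ξ = (∏ i, -(Complex.I * (ξ (α i) : ℂ))) * expTransform f ξ := by
  have h := VectorFourier.fourierIntegral_iteratedFDeriv (fourierForm ι) (N := ⊤) (μ := volume)
    hf (fun m _ => hint m) (n := m) le_top
  have h1 := congr_fun h ξ
  have h2 := congr_arg (fun p : ContinuousMultilinearMap ℝ (fun _ : Fin m => ι → ℝ) ℂ =>
    p fun i => Pi.single (α i) 1) h1
  rw [Real.fourierIntegral_continuousMultilinearMap_apply' (hint m),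
    VectorFourier.fourierPowSMulRight_apply, fourierIntegral_fourierForm,
    fourierIntegral_fourierForm] at h2
  refine h2.trans ?_
  have hπ : (Real.pi : ℂ) ≠ 0 := by exact_mod_cast Real.pi_ne_zero
  have h3 : ∀ i, (-(fourierForm ι).flip) ξ (Pi.single (α i) 1) = (2 * Real.pi)⁻¹ * ξ (α i) := by
    intro i
    rw [neg_apply, neg_apply,
      ContinuousLinearMap.flip_apply, fourierForm_apply, neg_neg, single_one_dotProduct]
  simp only [h3]
  rw [Complex.real_smul, smul_eq_mul, ← mul_assoc]
  congr 1
  rw [Complex.ofReal_prod, ← Fin.prod_const, ← Finset.prod_mul_distrib]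
  refine Finset.prod_congr rfl fun i _ => ?_
  push_cast
  field_simp

omit [DecidableEq ι] in
theorem norm_expTransform_le (f : (ι → ℝ) → ℂ) (ξ : ι → ℝ) :
    ‖expTransform f ξ‖ ≤ ∫ x, ‖f x‖ := by
  refine (norm_integral_le_integral_norm _).trans_eq ?_
  simp only [norm_mul, norm_expFun, mul_one]

omit [DecidableEq ι] in
/-- The Fourier inversion formula. -/
theorem integral_expTransform {f : (ι → ℝ) → ℂ} (hf : Continuous f) (hfi : Integrable f)
    (hF : Integrable (expTransform f)) (x : ι → ℝ) :
    f x = (((2 * Real.pi) ^ Fintype.card ι : ℝ) : ℂ)⁻¹ * ∫ ξ, expTransform f ξ * expFun (-ξ) x := by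
  -- the formula in Mathlib is stated for inner product spaces and for the character `e^{2πi}`
  set g : EuclideanSpace ℝ ι → ℂ := fun v => f v.ofLp with hg
  have hmp' := PiLp.volume_preserving_toLp ι
  have hemb : MeasurableEmbedding (WithLp.toLp 2 : (ι → ℝ) → EuclideanSpace ℝ ι) :=
    (MeasurableEquiv.toLp 2 (ι → ℝ)).measurableEmbedding
  have hgc : Continuous g := hf.comp (PiLp.continuous_ofLp 2 _)
  have hgi : Integrable g := by
    rw [← hmp'.integrable_comp_emb hemb]
    exact hfi
  have hin : ∀ v w : ι → ℝ, inner ℝ (WithLp.toLp 2 v : EuclideanSpace ℝ ι) (WithLp.toLp 2 w) = w ⬝ᵥ v := by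
    intro v w
    rw [EuclideanSpace.inner_toLp_toLp]
    simp [dotProduct, mul_comm]
  have hFg : ∀ w : ι → ℝ, FourierTransform.fourier g (WithLp.toLp 2 w) =
      expTransform f (-((2 * Real.pi) • w)) := by
    intro w
    rw [Real.fourier_eq', ← hmp'.integral_comp hemb]
    refine integral_congr_ae (ae_of_all _ fun v => ?_)
    simp only [hin, hg, smul_eq_mul]
    rw [mul_comm]
    unfold expFun
    rw [neg_dotProduct, smul_dotProduct, smul_eq_mul]
    congr 2
    push_cast
    ring
  have hπ : (0 : ℝ) < 2 * Real.pi := by positivity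
  have hFgi : Integrable (FourierTransform.fourier g) := by
    rw [← hmp'.integrable_comp_emb hemb]
    have : (FourierTransform.fourier g ∘ (WithLp.toLp 2 : (ι → ℝ) → EuclideanSpace ℝ ι)) =
        fun w => expTransform f ((-(2 * Real.pi)) • w) := by
      funext w
      rw [Function.comp_apply, hFg, neg_smul]
    rw [this, integrable_comp_smul_iff volume (expTransform f) (by linarith)]
    exact hF
  have h1 := congr_fun (hgc.fourierInv_fourier_eq hgi hFgi) (WithLp.toLp 2 x)
  rw [Real.fourierInv_eq', ← hmp'.integral_comp hemb] at h1
  have h2 : f x = ∫ w : ι → ℝ, (fun ξ => expTransform f ξ * expFun (-ξ) x) ((-(2 * Real.pi)) • w) := by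
    refine h1.symm.trans (integral_congr_ae (ae_of_all _ fun w => ?_))
    simp only [hFg, hin, smul_eq_mul]
    rw [mul_comm, neg_smul]
    congr 1
    unfold expFun
    rw [neg_neg, smul_dotProduct, smul_eq_mul, dotProduct_comm]
    congr 1
    push_cast
    ring
  rw [h2, Measure.integral_comp_smul volume (fun ξ => expTransform f ξ * expFun (-ξ) x)
      (-(2 * Real.pi)), Module.finrank_fintype_fun_eq_card, Complex.real_smul,
    abs_inv, abs_pow, abs_neg, abs_of_pos hπ]
  push_cast
  rfl

end Fourier

/-! ### The Fourier transformation on `𝒲^ρ` -/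

section FourierW

/-- Optimization over `m`: the bounds `t^m A ≤ C L^{-m} (m!)^σ` imply the decay
`e^{-(σ/2) (Lt)^{1/σ}}`. The `1/σ`-th powers of the bounds are summed with the weights `2^{-m}/m!`. -/
theorem le_exp_of_pow_mul_le {σ : ℝ} (hσ : 0 < σ) {A C L t : ℝ} (hA : 0 ≤ A) (hC : 0 ≤ C)
    (hL : 0 < L) (ht : 0 ≤ t)
    (h : ∀ m : ℕ, t ^ m * A ≤ C * ((L ^ m)⁻¹ * (m ! : ℝ) ^ σ)) :
    A ≤ 2 ^ σ * C * Real.exp (-(σ * ((L * t) ^ σ⁻¹ / 2))) := by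
  set s : ℝ := (L * t) ^ σ⁻¹ with hs
  have hs0 : 0 ≤ s := by positivity
  have hterm : ∀ m : ℕ, (s / 2) ^ m / (m ! : ℝ) * A ^ σ⁻¹ ≤ C ^ σ⁻¹ * (1 / 2) ^ m := by
    intro m
    have hm : (0 : ℝ) < m ! := by exact_mod_cast Nat.factorial_pos m
    have h1 : (L * t) ^ m * A ≤ C * (m ! : ℝ) ^ σ := by
      have := mul_le_mul_of_nonneg_left (h m) (by positivity : 0 ≤ L ^ m)
      calc (L * t) ^ m * A = L ^ m * (t ^ m * A) := by ring
        _ ≤ L ^ m * (C * ((L ^ m)⁻¹ * (m ! : ℝ) ^ σ)) := this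
        _ = C * (m ! : ℝ) ^ σ := by field_simp
    have h2 := Real.rpow_le_rpow (by positivity) h1 (inv_pos.2 hσ).le
    rw [Real.mul_rpow (by positivity) hA, Real.mul_rpow hC (by positivity), ← Real.rpow_mul hm.le,
      mul_inv_cancel₀ hσ.ne', Real.rpow_one, ← Real.rpow_natCast, ← Real.rpow_mul (by positivity),
      mul_comm (m : ℝ), Real.rpow_mul (by positivity), Real.rpow_natCast, ← hs] at h2
    rw [div_mul_eq_mul_div, div_le_iff₀ hm, div_pow, one_div, inv_pow]
    have h3 : (0 : ℝ) < 2 ^ m := by positivity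
    calc s ^ m / 2 ^ m * A ^ σ⁻¹ = (s ^ m * A ^ σ⁻¹) * (2 ^ m)⁻¹ := by ring
      _ ≤ (C ^ σ⁻¹ * m !) * (2 ^ m)⁻¹ := by gcongr
      _ = _ := by ring
  have hsum : Real.exp (s / 2) * A ^ σ⁻¹ ≤ C ^ σ⁻¹ * 2 := by
    have h1 := (NormedSpace.expSeries_div_hasSum_exp (s / 2)).mul_right (A ^ σ⁻¹)
    rw [← Real.exp_eq_exp_ℝ] at h1
    exact hasSum_le hterm h1 (hasSum_geometric_two.mul_left _)
  have h4 := Real.rpow_le_rpow (by positivity) hsum hσ.le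
  rw [Real.mul_rpow (by positivity) (by positivity), Real.mul_rpow (by positivity) zero_le_two,
    ← Real.rpow_mul hA, ← Real.rpow_mul hC, inv_mul_cancel₀ hσ.ne', Real.rpow_one, Real.rpow_one,
    ← Real.exp_mul] at h4
  rw [Real.exp_neg, ← div_eq_mul_inv, le_div_iff₀ (Real.exp_pos _)]
  calc A * Real.exp (σ * (s / 2)) = Real.exp (s / 2 * σ) * A := by rw [mul_comm σ, mul_comm]
    _ ≤ C * 2 ^ σ := h4
    _ = _ := mul_comm _ _

variable {ι : Type} [Fintype ι]

theorem exists_abs_eq_norm [Nonempty ι] (ξ : ι → ℝ) : ∃ j, |ξ j| = ‖ξ‖ := by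
  obtain ⟨j, hj⟩ := Finite.exists_max fun j => |ξ j|
  exact ⟨j, le_antisymm (norm_le_pi_norm ξ j)
    ((pi_norm_le_iff_of_nonneg (abs_nonneg _)).2 hj)⟩

theorem integrable_inv_one_add_norm_pow :
    Integrable fun x : ι → ℝ => ((1 + ‖x‖) ^ (Fintype.card ι + 1))⁻¹ := by
  have h := integrable_one_add_norm (E := ι → ℝ) (μ := volume) (r := (Fintype.card ι + 1 : ℕ))
    (by rw [Module.finrank_fintype_fun_eq_card]; push_cast; linarith)
  refine h.congr (ae_of_all _ fun x => ?_)
  simp only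
  rw [Real.rpow_neg (by positivity), Real.rpow_natCast]

theorem one_add_pow_le_exp {γ : ℝ} (hγ : 1 ≤ γ) {t : ℝ} (ht : 0 ≤ t) (k : ℕ) :
    (1 + t) ^ k ≤ k ! * Real.exp 2 * Real.exp (t ^ γ) := by
  have hk : (0 : ℝ) < k ! := by exact_mod_cast Nat.factorial_pos k
  have h1 := Real.pow_div_factorial_le_exp (1 + t) (by positivity) k
  rw [div_le_iff₀ hk] at h1
  have h2 : t ≤ 1 + t ^ γ := by
    have := rpow_le_one_add_rpow ht zero_le_one hγ
    rwa [Real.rpow_one] at this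
  have h3 : Real.exp (1 + t) ≤ Real.exp 2 * Real.exp (t ^ γ) := by
    rw [← Real.exp_add, Real.exp_le_exp]; linarith
  calc (1 + t) ^ k ≤ Real.exp (1 + t) * k ! := h1
    _ ≤ (Real.exp 2 * Real.exp (t ^ γ)) * k ! := by gcongr
    _ = _ := by ring

variable [DecidableEq ι] {ρ : ℝ}

theorem integrable_iteratedFDeriv_of_mem_wSubmodule (hρ : 1 < ρ) {f : ESpace ρ ι}
    (hf : f ∈ wSubmodule ρ ι) (m : ℕ) : Integrable (iteratedFDeriv ℝ m f.1) := by
  obtain ⟨C, hC, h⟩ := exists_jetBound_of_mem_wSubmodule hρ hf one_pos (Fintype.card ι + 1)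
  refine (integrable_inv_one_add_norm_pow.const_mul (C * ((1 ^ m)⁻¹ * (m ! : ℝ) ^ (1 - 1 / ρ)))).mono'
    (f.contDiff.continuous_iteratedFDeriv (by exact_mod_cast le_top)).aestronglyMeasurable
    (ae_of_all _ fun x => (h m x).trans_eq (by ring))

theorem integrable_wordDeriv_of_mem_wSubmodule (hρ : 1 < ρ) {f : ESpace ρ ι}
    (hf : f ∈ wSubmodule ρ ι) {m : ℕ} (α : Fin m → ι) : Integrable (wordDeriv α f) :=
  (integrable_iteratedFDeriv_of_mem_wSubmodule hρ hf m).mono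
    (contDiff_wordDeriv f.contDiff α).continuous.aestronglyMeasurable
    (ae_of_all _ fun x => norm_wordDeriv_le α f x)

theorem integrable_of_mem_wSubmodule (hρ : 1 < ρ) {f : ESpace ρ ι}
    (hf : f ∈ wSubmodule ρ ι) : Integrable f.1 := by
  obtain ⟨C, hC, h⟩ := exists_jetBound_of_mem_wSubmodule hρ hf one_pos (Fintype.card ι + 1)
  refine (integrable_inv_one_add_norm_pow.const_mul C).mono'
    f.contDiff.continuous.aestronglyMeasurable (ae_of_all _ fun x => ?_)
  simpa using h 0 x

/-- The bound `(m!)^{1-1/ρ}` on the derivatives of order `m` becomes the decay `e^{-N|ξ|^{ρ'}}`. -/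
theorem exists_norm_expTransform_le (hρ : 1 < ρ) {f : ESpace ρ ι} (hf : f ∈ wSubmodule ρ ι)
    (N : ℝ) : ∃ C, 0 ≤ C ∧ ∀ ξ : ι → ℝ,
      ‖expTransform f ξ‖ ≤ C * Real.exp (-(N * ‖ξ‖ ^ (1 - 1 / ρ)⁻¹)) := by
  have hσ := sigma_pos hρ
  set σ := 1 - 1 / ρ with hσdef
  -- `L` is chosen such that `(σ / 2) L^{1/σ} = |N| + 1`
  set L : ℝ := (2 * (|N| + 1) / σ) ^ σ with hL
  have hL0 : 0 < L := by positivity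
  have hLγ : L ^ σ⁻¹ = 2 * (|N| + 1) / σ := by
    rw [hL, ← Real.rpow_mul (by positivity), mul_inv_cancel₀ hσ.ne', Real.rpow_one]
  obtain ⟨C, hC, h⟩ := exists_jetBound_of_mem_wSubmodule hρ hf hL0 (Fintype.card ι + 1)
  set D : ℝ := ∫ x : ι → ℝ, ((1 + ‖x‖) ^ (Fintype.card ι + 1))⁻¹ with hD
  have hD0 : 0 ≤ D := integral_nonneg fun x => by positivity
  refine ⟨2 ^ σ * (C * D), by positivity, fun ξ => ?_⟩
  have hword : ∀ {m : ℕ} (α : Fin m → ι),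
      ‖expTransform (wordDeriv α f) ξ‖ ≤ C * D * ((L ^ m)⁻¹ * (m ! : ℝ) ^ σ) := by
    intro m α
    refine (norm_expTransform_le _ _).trans ?_
    calc ∫ x, ‖wordDeriv α f x‖
        ≤ ∫ x : ι → ℝ, (C * ((L ^ m)⁻¹ * (m ! : ℝ) ^ σ)) * ((1 + ‖x‖) ^ (Fintype.card ι + 1))⁻¹ := by
          refine integral_mono (integrable_wordDeriv_of_mem_wSubmodule hρ hf α).norm
            (integrable_inv_one_add_norm_pow.const_mul _) fun x => ?_
          exact (norm_wordDeriv_le α f x).trans ((h m x).trans_eq (by ring))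
      _ = _ := by rw [integral_const_mul]; ring
  have hpow : ∀ m : ℕ, ‖ξ‖ ^ m * ‖expTransform f ξ‖ ≤ C * D * ((L ^ m)⁻¹ * (m ! : ℝ) ^ σ) := by
    intro m
    rcases isEmpty_or_nonempty ι with hι | hι
    · rcases m with - | m
      · have := hword (m := 0) finZeroElim
        rw [expTransform_wordDeriv f.contDiff
          (integrable_iteratedFDeriv_of_mem_wSubmodule hρ hf)] at this
        simpa using this
      · have : ξ = 0 := Subsingleton.elim _ _
        rw [this, norm_zero, zero_pow (Nat.succ_ne_zero m), zero_mul]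
        positivity
    · obtain ⟨j, hj⟩ := exists_abs_eq_norm ξ
      have := hword (m := m) fun _ => j
      rw [expTransform_wordDeriv f.contDiff
        (integrable_iteratedFDeriv_of_mem_wSubmodule hρ hf), norm_mul] at this
      simpa [hj] using this
  refine (le_exp_of_pow_mul_le hσ (norm_nonneg _) (by positivity) hL0 (norm_nonneg ξ) hpow).trans ?_
  refine mul_le_mul_of_nonneg_left (Real.exp_le_exp.2 (neg_le_neg ?_)) (by positivity)
  rw [Real.mul_rpow hL0.le (norm_nonneg _), hLγ]
  have h1 : σ * (2 * (|N| + 1) / σ * ‖ξ‖ ^ σ⁻¹ / 2) = (|N| + 1) * ‖ξ‖ ^ σ⁻¹ := by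
    field_simp
  rw [h1]
  refine mul_le_mul_of_nonneg_right ?_ (by positivity)
  linarith [le_abs_self N]

theorem one_le_sigma_inv (hρ : 1 < ρ) : 1 ≤ (1 - 1 / ρ)⁻¹ := by
  have : 0 < 1 / ρ := by positivity
  exact (one_le_inv₀ (sigma_pos hρ)).2 (by linarith)

theorem integrable_expTransform_mul_exp (hρ : 1 < ρ) {f : ESpace ρ ι} (hf : f ∈ wSubmodule ρ ι)
    (N : ℝ) :
    Integrable fun ξ : ι → ℝ => ‖expTransform f ξ‖ * Real.exp (N * ‖ξ‖ ^ (1 - 1 / ρ)⁻¹) := by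
  obtain ⟨C, hC, h⟩ := exists_norm_expTransform_le hρ hf (N + 1)
  have hcont := continuous_expTransform (integrable_of_mem_wSubmodule hρ hf)
  have hγ := one_le_sigma_inv hρ
  set k := Fintype.card ι + 1
  refine (integrable_inv_one_add_norm_pow.const_mul (C * (k ! * Real.exp 2))).mono' ?_
    (ae_of_all _ fun ξ => ?_)
  · refine Continuous.aestronglyMeasurable ?_
    refine hcont.norm.mul (Real.continuous_exp.comp (continuous_const.mul ?_))
    exact continuous_norm.rpow_const fun _ => Or.inr (by linarith)
  · rw [Real.norm_of_nonneg (by positivity)]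
    have h1 := one_add_pow_le_exp hγ (norm_nonneg ξ) k
    have h2 : (0 : ℝ) < (1 + ‖ξ‖) ^ k := by positivity
    calc ‖expTransform f ξ‖ * Real.exp (N * ‖ξ‖ ^ (1 - 1 / ρ)⁻¹)
        ≤ C * Real.exp (-((N + 1) * ‖ξ‖ ^ (1 - 1 / ρ)⁻¹)) *
            Real.exp (N * ‖ξ‖ ^ (1 - 1 / ρ)⁻¹) := by gcongr; exact h ξ
      _ = C * (Real.exp (‖ξ‖ ^ (1 - 1 / ρ)⁻¹))⁻¹ := by
          rw [mul_assoc, ← Real.exp_add, ← Real.exp_neg]; congr 2; ring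
      _ ≤ C * (k ! * Real.exp 2 * ((1 + ‖ξ‖) ^ k)⁻¹) := by
          refine mul_le_mul_of_nonneg_left ?_ hC
          rw [← div_eq_mul_inv, le_div_iff₀ h2, inv_mul_le_iff₀ (Real.exp_pos _)]
          exact h1.trans_eq (by ring)
      _ = _ := by ring

omit [DecidableEq ι] in
theorem norm_prod_coord_le {m : ℕ} (α : Fin m → ι) (ξ : ι → ℝ) :
    ‖∏ i, -(Complex.I * (ξ (α i) : ℂ))‖ ≤ ‖ξ‖ ^ m := by
  rw [norm_prod]
  refine (Finset.prod_le_prod (g := fun _ => ‖ξ‖) (fun _ _ => norm_nonneg _)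
    fun i _ => ?_).trans_eq (by simp)
  rw [norm_neg, norm_mul, Complex.norm_I, one_mul, Complex.norm_real]
  exact norm_le_pi_norm ξ _

/-- The inversion formula for the derivatives at the origin. -/
theorem wordDeriv_zero_eq_integral (hρ : 1 < ρ) {f : ESpace ρ ι} (hf : f ∈ wSubmodule ρ ι)
    {m : ℕ} (α : Fin m → ι) :
    wordDeriv α f 0 = ∫ ξ : ι → ℝ, ((((2 * Real.pi) ^ Fintype.card ι : ℝ) : ℂ)⁻¹ *
      expTransform f ξ) * ∏ i, (Complex.I * ((-ξ) (α i) : ℂ)) := by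
  have hF : expTransform (wordDeriv α f) =
      fun ξ => (∏ i, -(Complex.I * (ξ (α i) : ℂ))) * expTransform f ξ := by
    funext ξ
    exact expTransform_wordDeriv f.contDiff (integrable_iteratedFDeriv_of_mem_wSubmodule hρ hf) α ξ
  have hcont := continuous_expTransform (integrable_of_mem_wSubmodule hρ hf)
  have hFi : Integrable (expTransform (wordDeriv α f)) := by
    rw [hF]
    refine ((integrable_expTransform_mul_exp hρ hf 1).const_mul (m ! * Real.exp 2)).mono' ?_
      (ae_of_all _ fun ξ => ?_)
    · refine Continuous.aestronglyMeasurable (Continuous.mul ?_ hcont)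
      fun_prop
    · rw [norm_mul, one_mul]
      have h1 : ‖ξ‖ ^ m ≤ m ! * Real.exp 2 * Real.exp (‖ξ‖ ^ (1 - 1 / ρ)⁻¹) :=
        (pow_le_pow_left₀ (norm_nonneg _) (by linarith) m).trans
          (one_add_pow_le_exp (one_le_sigma_inv hρ) (norm_nonneg ξ) m)
      calc _ ≤ (m ! * Real.exp 2 * Real.exp (‖ξ‖ ^ (1 - 1 / ρ)⁻¹)) * ‖expTransform f ξ‖ := by
            gcongr
            exact (norm_prod_coord_le α ξ).trans h1
        _ = _ := by ring
  rw [integral_expTransform (contDiff_wordDeriv f.contDiff α).continuous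
    (integrable_wordDeriv_of_mem_wSubmodule hρ hf α) hFi, ← integral_const_mul]
  refine integral_congr_ae (ae_of_all _ fun ξ => ?_)
  have h0 : expFun (-ξ) 0 = 1 := by simp [expFun]
  simp only [hF, h0, mul_one, Pi.neg_apply, Complex.ofReal_neg, mul_neg]
  ring

/-- A functional that is given by coefficients acts under the integral sign of the inversion
formula. -/
theorem pair_eq_integral (hρ : 1 < ρ) {f : ESpace ρ ι} (hf : f ∈ wSubmodule ρ ι) {A B : ℝ}
    (hB : 0 < B) {c : ∀ m : ℕ, (Fin m → ι) → ℂ} (hc : CoefBound (1 - 1 / ρ) A B c) :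
    pair c f = ∫ ξ : ι → ℝ, ((((2 * Real.pi) ^ Fintype.card ι : ℝ) : ℂ)⁻¹ *
      expTransform f ξ) * pair c (expFun (-ξ)) := by
  have hcont := continuous_expTransform (integrable_of_mem_wSubmodule hρ hf)
  refine pair_integral (sigma_pos hρ) hB hc (ξ := fun ξ => -ξ)
    (a := fun ξ => (((2 * Real.pi) ^ Fintype.card ι : ℝ) : ℂ)⁻¹ * expTransform f ξ)
    (continuous_const.mul hcont).aestronglyMeasurable
    continuous_neg.aestronglyMeasurable ?_ fun m α => wordDeriv_zero_eq_integral hρ hf α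
  refine ((integrable_expTransform_mul_exp hρ hf ((1 - 1 / ρ) * (2 * B) ^ (1 - 1 / ρ)⁻¹)).const_mul
    ‖((((2 * Real.pi) ^ Fintype.card ι : ℝ) : ℂ)⁻¹)‖).congr (ae_of_all _ fun ξ => ?_)
  beta_reduce
  rw [norm_mul, norm_neg, ← mul_assoc 2 B, Real.mul_rpow (by positivity) (norm_nonneg _),
    mul_assoc, mul_assoc]

/-! #### Fourier transforms of test functions -/

/-- A smooth function whose derivatives satisfy the bounds of `𝒲^ρ`, as an element of this
space. -/
def ESpace.ofDecay (hρ : 1 < ρ) (f : (ι → ℝ) → ℂ) (hf : ContDiff ℝ ∞ f)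
    (h : ∀ L : ℝ, 0 < L → ∀ N : ℕ,
      ∃ C, 0 ≤ C ∧ JetBound (1 - 1 / ρ) L C (fun x => ((1 + ‖x‖) ^ N)⁻¹) f) : wSubmodule ρ ι :=
  ⟨ESpace.ofJet hρ f hf fun L hL => by
    obtain ⟨C, hC, h⟩ := h L hL 0
    refine ⟨C, hC, h.mono hC hL le_rfl (fun x => by positivity) fun x => ?_⟩
    simpa using one_le_growth ρ hL x, mem_wSubmodule_of_jetBound hρ h⟩

omit [DecidableEq ι] in
theorem one_add_norm_pow_le (x : ι → ℝ) (N : ℕ) :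
    (1 + ‖x‖) ^ N ≤ 2 ^ N * (1 + ∑ j, |x j| ^ N) := by
  have hs : 0 ≤ ∑ j, |x j| ^ N := by positivity
  rcases le_total ‖x‖ 1 with h | h
  · calc (1 + ‖x‖) ^ N ≤ 2 ^ N := pow_le_pow_left₀ (by positivity) (by linarith) N
      _ ≤ _ := le_mul_of_one_le_right (by positivity) (by linarith)
  · rcases isEmpty_or_nonempty ι with hι | hι
    · rw [Subsingleton.elim x 0, norm_zero] at h
      exact absurd h (by norm_num)
    · obtain ⟨j, hj⟩ := exists_abs_eq_norm x
      calc (1 + ‖x‖) ^ N ≤ (2 * |x j|) ^ N := by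
            rw [hj]; exact pow_le_pow_left₀ (by positivity) (by linarith) N
        _ = 2 ^ N * |x j| ^ N := mul_pow _ _ _
        _ ≤ _ := by
            refine mul_le_mul_of_nonneg_left ?_ (by positivity)
            have := Finset.single_le_sum (f := fun j => |x j| ^ N) (fun _ _ => by positivity)
              (Finset.mem_univ j)
            linarith

omit [DecidableEq ι] in
theorem integrable_pow_mul_iteratedFDeriv {h : (ι → ℝ) → ℂ} (hh : ContDiff ℝ ∞ h)
    (hs : HasCompactSupport h) (k m : ℕ) :
    Integrable fun v => ‖v‖ ^ k * ‖iteratedFDeriv ℝ m h v‖ := by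
  refine Continuous.integrable_of_hasCompactSupport ?_ ?_
  · exact (continuous_norm.pow k).mul
      (hh.continuous_iteratedFDeriv (by exact_mod_cast le_top)).norm
  · exact ((hs.iteratedFDeriv (𝕜 := ℝ) m).norm).mul_left

/-- The derivatives of the transform of a test function grow geometrically with the order,
and they decrease rapidly. -/
theorem exists_iteratedFDeriv_expTransform_le {h : (ι → ℝ) → ℂ} (hh : ContDiff ℝ ∞ h)
    (hs : HasCompactSupport h) (N : ℕ) : ∃ A B : ℝ, 0 ≤ A ∧ 0 ≤ B ∧ ∀ (k : ℕ) (w : ι → ℝ),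
      (1 + ‖w‖) ^ N * ‖iteratedFDeriv ℝ k (expTransform h) w‖ ≤ A * B ^ k := by
  obtain ⟨R, hR, hR'⟩ : ∃ R : ℝ, 1 ≤ R ∧ ∀ v, h v ≠ 0 → ‖v‖ ≤ R := by
    obtain ⟨R, hR⟩ := hs.isCompact.isBounded.exists_norm_le
    exact ⟨max R 1, le_max_right _ _, fun v hv =>
      (hR v (subset_tsupport h hv)).trans (le_max_left _ _)⟩
  have hsupp : ∀ m v, iteratedFDeriv ℝ m h v ≠ 0 → ‖v‖ ≤ R := by
    intro m v hv
    have h1 : tsupport h ⊆ Metric.closedBall 0 R := closure_minimal (fun v hv => by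
      rw [mem_closedBall_zero_iff]; exact hR' v hv) Metric.isClosed_closedBall
    have h2 := h1 (support_iteratedFDeriv_subset m hv)
    rwa [mem_closedBall_zero_iff] at h2
  have hmom : ∀ k m, ∫ v, ‖v‖ ^ k * ‖iteratedFDeriv ℝ m h v‖ ≤
      R ^ k * ∫ v, ‖iteratedFDeriv ℝ m h v‖ := by
    intro k m
    rw [← integral_const_mul]
    have h0 := integrable_pow_mul_iteratedFDeriv hh hs 0 m
    simp only [pow_zero, one_mul] at h0
    refine integral_mono (integrable_pow_mul_iteratedFDeriv hh hs k m) (h0.const_mul _) fun v => ?_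
    by_cases hv : iteratedFDeriv ℝ m h v = 0
    · simp [hv]
    · have := hsupp m v hv
      simp only
      gcongr
  set I : ℕ → ℝ := fun q => ∑ m ∈ Finset.range (q + 1), ∫ v, ‖iteratedFDeriv ℝ m h v‖ with hI
  have hI0 : ∀ q, 0 ≤ I q := fun q =>
    Finset.sum_nonneg fun m _ => integral_nonneg fun v => norm_nonneg _
  have hsum : ∀ k q : ℕ, ∑ p ∈ Finset.range (k + 1) ×ˢ Finset.range (q + 1),
      ∫ v, ‖v‖ ^ p.1 * ‖iteratedFDeriv ℝ p.2 h v‖ ≤ (k + 1) * R ^ k * I q := by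
    intro k q
    rw [Finset.sum_product]
    calc _ ≤ ∑ x ∈ Finset.range (k + 1), R ^ k * I q := by
          refine Finset.sum_le_sum fun i hi => ?_
          rw [hI, Finset.mul_sum]
          refine Finset.sum_le_sum fun m _ => (hmom i m).trans ?_
          refine mul_le_mul_of_nonneg_right ?_ (integral_nonneg fun v => norm_nonneg _)
          exact pow_le_pow_right₀ hR (Nat.lt_succ_iff.1 (Finset.mem_range.1 hi))
      _ = _ := by rw [Finset.sum_const, Finset.card_range, nsmul_eq_mul]; push_cast; ring
  set K : ℝ := 2 * Real.pi * ‖fourierForm ι‖ with hK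
  have hK0 : 0 ≤ K := by positivity
  have hder : ∀ (k q : ℕ) (v w : ι → ℝ),
      |fourierForm ι v w| ^ q * ‖iteratedFDeriv ℝ k (expTransform h) w‖ ≤
        ‖v‖ ^ q * K ^ k * (2 * k + 2) ^ q * ((k + 1) * R ^ k * I q) := by
    intro k q v w
    have := VectorFourier.pow_mul_norm_iteratedFDeriv_fourierIntegral_le (fourierForm ι) (K := ⊤)
      (N := ⊤) (μ := volume) hh (fun k m _ _ => integrable_pow_mul_iteratedFDeriv hh hs k m)
      (k := k) (n := q) le_top le_top v w
    rw [fourierIntegral_fourierForm] at this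
    exact this.trans (mul_le_mul_of_nonneg_left (hsum k q) (by positivity))
  -- polynomials in `k` are absorbed into the geometric factor
  have hpoly : ∀ k q : ℕ, (2 * (k : ℝ) + 2) ^ q * (k + 1) ≤ (q + 1)! * Real.exp 2 * (Real.exp 2) ^ k := by
    intro k q
    have h1 := Real.pow_div_factorial_le_exp (2 * (k : ℝ) + 2) (by positivity) (q + 1)
    rw [div_le_iff₀ (by exact_mod_cast Nat.factorial_pos _)] at h1
    calc (2 * (k : ℝ) + 2) ^ q * (k + 1) ≤ (2 * (k : ℝ) + 2) ^ q * (2 * k + 2) := by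
          gcongr
          · linarith
          · norm_num
      _ = (2 * (k : ℝ) + 2) ^ (q + 1) := by ring
      _ ≤ _ := h1
      _ = _ := by
        rw [← Real.exp_nat_mul, mul_assoc, ← Real.exp_add, mul_comm]
        congr 2
        ring
  have hπ : (0 : ℝ) < 2 * Real.pi := by positivity
  have hcoord : ∀ (k q : ℕ) (j : ι) (w : ι → ℝ), |w j| ^ q * ‖iteratedFDeriv ℝ k (expTransform h) w‖ ≤
      (2 * Real.pi) ^ q * I q * ((q + 1)! * Real.exp 2) * (K * R * Real.exp 2) ^ k := by
    intro k q j w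
    have h1 := hder k q (Pi.single j 1) w
    rw [fourierForm_apply, single_one_dotProduct, abs_neg, abs_mul, abs_of_pos (inv_pos.2 hπ),
      Pi.norm_single, norm_one, one_pow, one_mul, mul_pow, inv_pow, mul_assoc,
      inv_mul_le_iff₀ (by positivity)] at h1
    refine h1.trans ?_
    have h2 := mul_le_mul_of_nonneg_left (hpoly k q)
      (by have := hI0 q; positivity : 0 ≤ (2 * Real.pi) ^ q * I q * (K * R) ^ k)
    calc _ = (2 * Real.pi) ^ q * I q * (K * R) ^ k * ((2 * (k : ℝ) + 2) ^ q * (k + 1)) := by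
          rw [mul_pow]; ring
      _ ≤ _ := h2
      _ = _ := by rw [mul_pow (K * R)]; ring
  have hzero : ∀ (k : ℕ) (w : ι → ℝ), ‖iteratedFDeriv ℝ k (expTransform h) w‖ ≤
      I 0 * (1 ! * Real.exp 2) * (K * R * Real.exp 2) ^ k := by
    intro k w
    have h1 := hder k 0 0 w
    simp only [pow_zero, one_mul, mul_one] at h1
    refine h1.trans ?_
    have h2 := mul_le_mul_of_nonneg_left (hpoly k 0)
      (by have := hI0 0; positivity : 0 ≤ I 0 * (K * R) ^ k)
    calc _ = I 0 * (K * R) ^ k * ((2 * (k : ℝ) + 2) ^ 0 * (k + 1)) := by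
          rw [mul_pow]; ring
      _ ≤ _ := h2
      _ = _ := by rw [mul_pow (K * R)]; ring
  have hIN := hI0 N
  have hI00 := hI0 0
  refine ⟨2 ^ N * (I 0 * (1 ! * Real.exp 2) +
    Fintype.card ι * ((2 * Real.pi) ^ N * I N * ((N + 1)! * Real.exp 2))), K * R * Real.exp 2,
    by positivity, by positivity, fun k w => ?_⟩
  calc (1 + ‖w‖) ^ N * ‖iteratedFDeriv ℝ k (expTransform h) w‖
      ≤ 2 ^ N * (1 + ∑ j, |w j| ^ N) * ‖iteratedFDeriv ℝ k (expTransform h) w‖ := by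
        gcongr
        exact one_add_norm_pow_le w N
    _ = 2 ^ N * (‖iteratedFDeriv ℝ k (expTransform h) w‖ +
          ∑ j, |w j| ^ N * ‖iteratedFDeriv ℝ k (expTransform h) w‖) := by
        rw [← Finset.sum_mul]; ring
    _ ≤ 2 ^ N * (I 0 * (1 ! * Real.exp 2) * (K * R * Real.exp 2) ^ k + ∑ _j : ι,
          (2 * Real.pi) ^ N * I N * ((N + 1)! * Real.exp 2) * (K * R * Real.exp 2) ^ k) := by
        refine mul_le_mul_of_nonneg_left (add_le_add (hzero k w) ?_) (by positivity)
        exact Finset.sum_le_sum fun j _ => hcoord k N j w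
    _ = _ := by
        rw [Finset.sum_const, Finset.card_univ, nsmul_eq_mul]
        ring

omit [DecidableEq ι] in
theorem contDiff_expTransform {h : (ι → ℝ) → ℂ} (hh : ContDiff ℝ ∞ h)
    (hs : HasCompactSupport h) : ContDiff ℝ ∞ (expTransform h) := by
  rw [← fourierIntegral_fourierForm]
  refine VectorFourier.contDiff_fourierIntegral (fourierForm ι) (N := ⊤) fun k _ => ?_
  have := integrable_pow_mul_iteratedFDeriv hh hs k 0
  simpa using this

/-- The transform of a test function belongs to `𝒲^ρ`. -/
noncomputable def testTransform (hρ : 1 < ρ) {h : (ι → ℝ) → ℂ} (hh : ContDiff ℝ ∞ h)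
    (hs : HasCompactSupport h) : wSubmodule ρ ι :=
  ESpace.ofDecay hρ (expTransform h) (contDiff_expTransform hh hs) fun L hL N => by
    obtain ⟨A, B, hA, hB, hb⟩ := exists_iteratedFDeriv_expTransform_le hh hs N
    refine ⟨A * Real.exp ((1 - 1 / ρ) * (B * L) ^ (1 - 1 / ρ)⁻¹), by positivity, fun k w => ?_⟩
    have h1 := pow_div_factorial_rpow_le (sigma_pos hρ) (by positivity : 0 ≤ B * L) k
    have hk : (0 : ℝ) < (k ! : ℝ) ^ (1 - 1 / ρ) := by positivity
    rw [← div_eq_mul_inv, div_le_iff₀ hk, mul_pow] at h1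
    have h2 : (0 : ℝ) < (1 + ‖w‖) ^ N := by positivity
    have h3 := hb k w
    rw [← le_div_iff₀' h2] at h3
    have h4 : B ^ k ≤ (Real.exp ((1 - 1 / ρ) * (B * L) ^ (1 - 1 / ρ)⁻¹) *
        (k ! : ℝ) ^ (1 - 1 / ρ)) / L ^ k := (le_div_iff₀ (by positivity)).2 h1
    calc _ ≤ A * B ^ k / (1 + ‖w‖) ^ N := h3
      _ ≤ A * ((Real.exp ((1 - 1 / ρ) * (B * L) ^ (1 - 1 / ρ)⁻¹) *
        (k ! : ℝ) ^ (1 - 1 / ρ)) / L ^ k) / (1 + ‖w‖) ^ N := by gcongr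
      _ = _ := by rw [div_eq_mul_inv, div_eq_mul_inv]; ring

theorem wordDeriv_expTransform {h : (ι → ℝ) → ℂ} (hh : ContDiff ℝ ∞ h)
    (hs : HasCompactSupport h) {m : ℕ} (α : Fin m → ι) :
    wordDeriv α (expTransform h) 0 = ∫ ξ, h ξ * ∏ i, (Complex.I * (ξ (α i) : ℂ)) := by
  have hint : ∀ k : ℕ, Integrable fun v : ι → ℝ => ‖v‖ ^ k * ‖h v‖ := fun k => by
    simpa using integrable_pow_mul_iteratedFDeriv hh hs k 0
  have h1 := VectorFourier.iteratedFDeriv_fourierIntegral (fourierForm ι) (N := ⊤) (μ := volume)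
    (fun k _ => hint k) hh.continuous.aestronglyMeasurable (n := m) le_top
  rw [fourierIntegral_fourierForm] at h1
  unfold wordDeriv
  rw [h1, Real.fourierIntegral_continuousMultilinearMap_apply'
    (VectorFourier.integrable_fourierPowSMulRight _ (hint m) hh.continuous.aestronglyMeasurable),
    fourierIntegral_fourierForm]
  unfold expTransform
  refine integral_congr_ae (ae_of_all _ fun ξ => ?_)
  have h0 : expFun 0 ξ = 1 := by simp [expFun]
  have hπ : (Real.pi : ℂ) ≠ 0 := by exact_mod_cast Real.pi_ne_zero
  simp only [VectorFourier.fourierPowSMulRight_apply, h0, mul_one, fourierForm_apply,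
    dotProduct_single_one]
  rw [Complex.real_smul, smul_eq_mul, ← mul_assoc, mul_comm (h ξ)]
  congr 1
  rw [Complex.ofReal_prod, ← Fin.prod_const, ← Finset.prod_mul_distrib]
  refine Finset.prod_congr rfl fun i _ => ?_
  push_cast
  field_simp

/-- The functional with the coefficients `c` acts under the integral sign of the transform. -/
theorem pair_testTransform (hρ : 1 < ρ) {h : (ι → ℝ) → ℂ} (hh : ContDiff ℝ ∞ h)
    (hs : HasCompactSupport h) {A B : ℝ} (hB : 0 < B) {c : ∀ m : ℕ, (Fin m → ι) → ℂ}
    (hc : CoefBound (1 - 1 / ρ) A B c) :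
    pair c (testTransform hρ hh hs).1 = ∫ ξ, h ξ * pair c (expFun ξ) := by
  refine pair_integral (sigma_pos hρ) hB hc hh.continuous.aestronglyMeasurable
    continuous_id.aestronglyMeasurable ?_ fun m α => wordDeriv_expTransform hh hs α
  have hγ := one_le_sigma_inv hρ
  refine Continuous.integrable_of_hasCompactSupport ?_ hs.norm.mul_right
  refine hh.continuous.norm.mul (Real.continuous_exp.comp (continuous_const.mul ?_))
  exact Continuous.rpow_const (by fun_prop) fun _ => Or.inr (by linarith)

theorem continuous_pair_expFun {σ A B : ℝ} (hσ : 0 < σ) (hB : 0 < B)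
    {c : ∀ m : ℕ, (Fin m → ι) → ℂ} (hc : CoefBound σ A B c) :
    Continuous fun ξ => pair c (expFun ξ) := by
  rw [continuous_iff_continuousAt]
  intro ξ₀
  set R : ℝ := ‖ξ₀‖ + 1
  have hR : 0 < R := by positivity
  have hA := coefBound_nonneg hc
  have hon : ContinuousOn (fun ξ => pair c (expFun ξ)) (Metric.ball 0 R) := by
    have h0 : ∀ ξ : ι → ℝ, expFun ξ 0 = 1 := fun ξ => by simp [expFun]
    unfold pair
    refine continuousOn_tsum (u := fun m => A * Real.exp (σ * (Fintype.card ι * R * (2 * B)) ^ σ⁻¹) *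
      (B / (2 * B)) ^ m) (fun m => ?_) ?_ fun m ξ hξ => ?_
    · refine Continuous.continuousOn ?_
      simp only [wordDeriv_expFun, h0]
      fun_prop
    · refine (summable_geometric_of_lt_one (by positivity) ?_).mul_left _
      rw [div_lt_one (by positivity)]
      linarith
    · rw [mem_ball_zero_iff] at hξ
      refine norm_pair_term_le (by positivity) (Real.exp_pos _).le hc (fun k => ?_) m
      refine (norm_iteratedFDeriv_expFun_le ξ 0 k).trans ?_
      have h1 := pow_div_factorial_rpow_le hσ (by positivity : 0 ≤ Fintype.card ι * R * (2 * B)) k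
      have hk : (0 : ℝ) < (k ! : ℝ) ^ σ := by positivity
      rw [← div_eq_mul_inv, div_le_iff₀ hk, mul_pow, ← le_div_iff₀ (by positivity)] at h1
      refine (pow_le_pow_left₀ (by positivity) ?_ k).trans (h1.trans_eq ?_)
      · gcongr
      · rw [div_eq_mul_inv]; ring
  exact hon.continuousAt (Metric.isOpen_ball.mem_nhds (by simp [R]))

end FourierW

/-! ### Uniqueness of the extension -/

section Uniqueness

variable {ι : Type} [Fintype ι] [DecidableEq ι] {ρ : ℝ}

/-- A continuous linear functional on `𝓔^ρ` that vanishes on `𝒲^ρ` is zero: it vanishes on the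
transforms of the test functions, hence on the exponentials. -/
theorem eq_zero_of_wSubmodule (hρ : 1 < ρ) {T : ESpace ρ ι →ₗ[ℂ] ℂ} (hT : Continuous T)
    (h0 : ∀ f ∈ wSubmodule ρ ι, T f = 0) : T = 0 := by
  refine eq_zero_of_expE hρ hT ?_
  obtain ⟨L, hL, C, hC, hb⟩ := exists_le_eSeminorm hρ (q := (normSeminorm ℂ ℂ).comp T) hT.norm
  obtain ⟨⟨B, hB, hc⟩, hpair⟩ := functional_eq_pair hρ T hL hC hb
  set c := fun m (α : Fin m → ι) => (m ! : ℂ)⁻¹ * T (monoE hρ α)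
  have hcont := continuous_pair_expFun (sigma_pos hρ) hB hc
  have hae : ∀ᵐ ξ : ι → ℝ, pair c (expFun ξ) = 0 := by
    refine ae_eq_zero_of_integral_contDiff_smul_eq_zero hcont.locallyIntegrable fun g hg hgs => ?_
    have hg' : ContDiff ℝ ∞ fun ξ => (g ξ : ℂ) := Complex.ofRealCLM.contDiff.comp hg
    have hgs' : HasCompactSupport fun ξ => (g ξ : ℂ) :=
      hgs.comp_left (g := fun t : ℝ => (t : ℂ)) Complex.ofReal_zero
    have h1 := pair_testTransform hρ hg' hgs' hB hc
    rw [← hpair, h0 _ (testTransform hρ hg' hgs').2] at h1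
    rw [h1]
    exact integral_congr_ae (ae_of_all _ fun ξ => Complex.real_smul)
  have heq : (fun ξ => pair c (expFun ξ)) = fun _ => 0 :=
    Measure.eq_of_ae_eq hae hcont continuous_const
  intro ξ
  rw [hpair]
  exact congr_fun heq ξ

variable {n : ℕ} {γ : ℝ}

/-- An entire function is determined by its restriction to `ℝⁿ`. -/
theorem eq_of_eq_on_real {F G : (Fin n → ℂ) → ℂ} (hF : Differentiable ℂ F)
    (hG : Differentiable ℂ G) (h : ∀ q : Fin n → ℝ, F (fun j => (q j : ℂ)) = G fun j => (q j : ℂ)) :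
    F = G := by
  funext z
  -- the identity theorem on the complex line through `z` which is the complexification of a real one
  set l : ℂ → Fin n → ℂ := fun t j => ((z j).re : ℂ) + t * ((z j).im : ℂ) with hl
  have hld : Differentiable ℂ l := by
    rw [hl]
    fun_prop
  have hz : l Complex.I = z := by
    funext j
    simp only [hl]
    rw [mul_comm]
    exact Complex.re_add_im (z j)
  have hFa : AnalyticOnNhd ℂ (F ∘ l) Set.univ :=
    fun t _ => (hF.comp hld).analyticAt t
  have hGa : AnalyticOnNhd ℂ (G ∘ l) Set.univ :=
    fun t _ => (hG.comp hld).analyticAt t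
  have hreal : ∀ t : ℝ, (F ∘ l) t = (G ∘ l) t := by
    intro t
    have : l t = fun j => (((z j).re + t * (z j).im : ℝ) : ℂ) := by
      funext j
      simp [hl]
    simp only [Function.comp_apply, this]
    exact h _
  have hfreq : ∃ᶠ t in 𝓝[≠] (0 : ℂ), (F ∘ l) t = (G ∘ l) t := by
    have htend : Tendsto (fun k : ℕ => (((k : ℝ) + 1)⁻¹ : ℝ)) atTop (𝓝 0) := by
      simpa [one_div] using tendsto_one_div_add_atTop_nhds_zero_nat (𝕜 := ℝ)
    have htend' : Tendsto (fun k : ℕ => ((((k : ℝ) + 1)⁻¹ : ℝ) : ℂ)) atTop (𝓝[≠] 0) := by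
      refine tendsto_nhdsWithin_iff.2 ⟨?_, Eventually.of_forall fun k => ?_⟩
      · have := (Complex.continuous_ofReal.tendsto 0).comp htend
        rwa [Complex.ofReal_zero] at this
      · simp only [Set.mem_compl_iff, Set.mem_singleton_iff, Complex.ofReal_eq_zero]
        positivity
    exact htend'.frequently (Frequently.of_forall fun k => hreal _)
  have := hFa.eq_of_frequently_eq hGa hfreq
  have h1 := congr_fun this Complex.I
  simpa only [Function.comp_apply, hz] using h1

theorem toL2_injective (hρ : 1 < ρ) {ψ χ : GSSpace γ ρ n} (h : toL2 hρ ψ = toL2 hρ χ) : ψ = χ := by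
  have hcont : ∀ ψ : GSSpace γ ρ n, Continuous (realRestrict ψ) := fun ψ =>
    ψ.differentiable.continuous.comp (by fun_prop)
  have h1 : realRestrict ψ =ᵐ[volume] realRestrict χ := (MemLp.toLp_eq_toLp_iff _ _).1 h
  have h2 := Measure.eq_of_ae_eq h1 (hcont ψ) (hcont χ)
  exact Subtype.ext (eq_of_eq_on_real ψ.differentiable χ.differentiable fun q => congr_fun h2 q)

/-- A continuous linear map from `𝓔^ρ` to `𝓐` is determined by its restriction to `𝒲^ρ`. -/
theorem operator_eq_of_wSubmodule (hρ : 1 < ρ)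
    {J J' : ESpace ρ (PhaseIndex n) →L[ℂ] OperatorAlgebra γ ρ n}
    (h : ∀ f ∈ wSubmodule ρ (PhaseIndex n), J f = J' f) : J = J' := by
  refine ContinuousLinearMap.ext fun f => ContinuousLinearMap.ext fun ψ => GSSpace.ext fun z => ?_
  let T : ESpace ρ (PhaseIndex n) →ₗ[ℂ] ℂ :=
    { toFun := fun f => J f ψ z - J' f ψ z
      map_add' := fun f g => by
        rw [map_add, map_add]
        change (J f ψ z + J g ψ z) - (J' f ψ z + J' g ψ z) = _
        ring
      map_smul' := fun c f => by
        rw [map_smul, map_smul]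
        change c * J f ψ z - c * J' f ψ z = c * (J f ψ z - J' f ψ z)
        ring }
  have hT : Continuous T := ((continuous_gsEval z).comp (continuous_operator_apply J ψ)).sub
    ((continuous_gsEval z).comp (continuous_operator_apply J' ψ))
  have h0 : T = 0 := eq_zero_of_wSubmodule hρ hT fun f hf => by
    change J f ψ z - J' f ψ z = 0
    rw [h f hf, sub_self]
  exact sub_eq_zero.1 (LinearMap.congr_fun h0 f)

end Uniqueness

/-! ### The symplectic Fourier transformation and the kernel for real arguments -/

section Symplectic

variable {n : ℕ} {ρ γ : ℝ}

theorem measurePreserving_Omega :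
    MeasurePreserving (fun s : PhaseIndex n → ℝ => Omega n ℝ *ᵥ s) volume volume := by
  have hO : Omega n ℝ = (Matrix.J (Fin n) ℝ)ᵀ := by
    unfold Omega Matrix.J
    rw [Matrix.fromBlocks_transpose]
    simp
  have hdet : (Omega n ℝ).det * (Omega n ℝ).det = 1 := by
    rw [hO, Matrix.det_transpose]
    exact Matrix.J_det_mul_J_det _ _
  have hne : (Omega n ℝ).det ≠ 0 := fun h => by simp [h] at hdet
  have habs : |(Omega n ℝ).det⁻¹| = 1 := by
    rw [abs_inv, inv_eq_one]
    have : |(Omega n ℝ).det| * |(Omega n ℝ).det| = 1 := by rw [← abs_mul, hdet, abs_one]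
    nlinarith [abs_nonneg (Omega n ℝ).det]
  have := Real.map_matrix_volume_pi_eq_smul_volume_pi hne
  rw [habs, ENNReal.ofReal_one, one_smul] at this
  exact ⟨(Matrix.toLin' (Omega n ℝ)).continuous_of_finiteDimensional.measurable, this⟩

theorem continuous_Omega_mulVec : Continuous fun s : PhaseIndex n → ℝ => Omega n ℝ *ᵥ s :=
  (Matrix.toLin' (Omega n ℝ)).continuous_of_finiteDimensional

theorem integral_comp_Omega {F : (PhaseIndex n → ℝ) → ℂ} (hF : Continuous F) :
    ∫ s, F (Omega n ℝ *ᵥ s) = ∫ ξ, F ξ := by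
  conv_rhs => rw [← measurePreserving_Omega.map_eq]
  rw [integral_map measurePreserving_Omega.measurable.aemeasurable hF.aestronglyMeasurable]

theorem norm_le_norm_Omega_mulVec (s : PhaseIndex n → ℝ) : ‖s‖ ≤ ‖Omega n ℝ *ᵥ s‖ := by
  rw [pi_norm_le_iff_of_nonneg (norm_nonneg _)]
  have h := norm_le_pi_norm (Omega n ℝ *ᵥ s)
  rw [Omega_mulVec] at h ⊢
  rintro (j | j)
  · simpa using h (Sum.inr j)
  · simpa using h (Sum.inl j)

theorem sympFourier_eq (f : (PhaseIndex n → ℝ) → ℂ) (s : PhaseIndex n → ℝ) :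
    sympFourier f s = (((2 * Real.pi) ^ n : ℝ) : ℂ)⁻¹ * expTransform f (Omega n ℝ *ᵥ s) := by
  unfold sympFourier expTransform expFun omegaForm
  congr 1
  refine integral_congr_ae (ae_of_all _ fun x => ?_)
  simp only
  rw [dotProduct_comm]

/-- The scalar factor `f̃(s) e^{(iħ/2) s·Q̃s}` of the integrand. -/
noncomputable def weylFactor (ħ : ℝ) (Q : Matrix (PhaseIndex n) (PhaseIndex n) ℂ)
    (f : (PhaseIndex n → ℝ) → ℂ) (s : PhaseIndex n → ℝ) : ℂ :=
  sympFourier f s * Complex.exp (Complex.I * ħ / 2 *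
      ((fun i => (s i : ℂ)) ⬝ᵥ (Qtilde Q *ᵥ fun i => (s i : ℂ))))

theorem Omega_map_ofReal (s : PhaseIndex n → ℝ) :
    (fun j => ((Omega n ℝ *ᵥ s) j : ℂ)) = Omega n ℂ *ᵥ fun i => (s i : ℂ) := by
  rw [Omega_mulVec, Omega_mulVec]
  funext j
  rcases j with j | j <;> simp

theorem dotProduct_Qtilde_mulVec (Q : Matrix (PhaseIndex n) (PhaseIndex n) ℂ)
    (s : PhaseIndex n → ℂ) :
    s ⬝ᵥ (Qtilde Q *ᵥ s) = (Omega n ℂ *ᵥ s) ⬝ᵥ (Q *ᵥ (Omega n ℂ *ᵥ s)) := by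
  have h : (Omega n ℂ)ᵀ = -Omega n ℂ := by
    unfold Omega
    rw [Matrix.fromBlocks_transpose, Matrix.fromBlocks_neg]
    simp
  unfold Qtilde
  rw [Matrix.neg_mulVec, dotProduct_neg, ← Matrix.mulVec_mulVec, ← Matrix.mulVec_mulVec,
    Matrix.dotProduct_mulVec, ← Matrix.mulVec_transpose, h, Matrix.neg_mulVec, neg_dotProduct,
    neg_neg]

/-- The correspondence between the exponential `e^{-iω(x,s)}` and the operator
`e^{(iħ/2) s·Q̃s} T_{ħs}`. -/
theorem weylKernel_neg_Omega {ħ : ℝ} (hħ : ħ ≠ 0) (Q : Matrix (PhaseIndex n) (PhaseIndex n) ℂ)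
    (ψ : GSSpace γ ρ n) (s : PhaseIndex n → ℝ) (y : Fin n → ℝ) :
    weylKernel ħ Q ψ (fun j => (y j : ℂ)) (fun j => ((-(Omega n ℝ *ᵥ s)) j : ℂ)) =
      Complex.exp (Complex.I * ħ / 2 *
        ((fun i => (s i : ℂ)) ⬝ᵥ (Qtilde Q *ᵥ fun i => (s i : ℂ)))) *
      translateFun ħ (ħ • s) (realRestrict ψ) y := by
  set ξ : PhaseIndex n → ℂ := fun j => ((-(Omega n ℝ *ᵥ s)) j : ℂ) with hξ
  have hξ' : ξ = -(Omega n ℂ *ᵥ fun i => (s i : ℂ)) := by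
    rw [← Omega_map_ofReal]
    funext j
    simp [hξ]
  have hQ : ξ ⬝ᵥ (Q *ᵥ ξ) = (fun i => (s i : ℂ)) ⬝ᵥ (Qtilde Q *ᵥ fun i => (s i : ℂ)) := by
    rw [dotProduct_Qtilde_mulVec, hξ', Matrix.mulVec_neg, neg_dotProduct, dotProduct_neg, neg_neg]
  have hinl : ∀ j, ξ (Sum.inl j) = -(s (Sum.inr j) : ℂ) := fun j => by
    rw [hξ', Omega_mulVec]; simp
  have hinr : ∀ j, ξ (Sum.inr j) = (s (Sum.inl j) : ℂ) := fun j => by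
    rw [hξ', Omega_mulVec]; simp
  have hħ' : (ħ : ℂ) ≠ 0 := by exact_mod_cast hħ
  unfold weylKernel weylPhase translateFun realRestrict
  rw [hQ, ← mul_assoc, ← Complex.exp_add]
  simp only [hinl, hinr]
  congr 2
  · have h1 : (((((ħ • s) ∘ Sum.inl) ⬝ᵥ y) - (((ħ • s) ∘ Sum.inl) ⬝ᵥ ((ħ • s) ∘ Sum.inr)) / 2) / ħ : ℝ) =
        ((fun j => s (Sum.inl j)) ⬝ᵥ y) -
          ħ / 2 * ((fun j => s (Sum.inl j)) ⬝ᵥ fun j : Fin n => s (Sum.inr j)) := by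
      have e1 : ((ħ • s) ∘ Sum.inl) = ħ • fun j : Fin n => s (Sum.inl j) := rfl
      have e2 : ((ħ • s) ∘ Sum.inr) = ħ • fun j : Fin n => s (Sum.inr j) := rfl
      rw [e1, e2, smul_dotProduct, smul_dotProduct, dotProduct_smul]
      simp only [smul_eq_mul]
      field_simp
    rw [h1]
    simp only [dotProduct, mul_neg, Finset.sum_neg_distrib]
    push_cast
    ring
  · refine congr_arg ψ.1 (funext fun j => ?_)
    simp
    ring

/-- The factor `e^{(iħ/2) s·Q̃s}` grows at most like `e^{c|s|²}`, and this is compensated by the decay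
of `f̃`, because `ρ' ≥ 2`. -/
theorem integrable_weylFactor (hconj : ρ.HolderConjugate γ) (hρ2 : ρ ≤ 2) (ħ : ℝ)
    (Q : Matrix (PhaseIndex n) (PhaseIndex n) ℂ) {f : ESpace ρ (PhaseIndex n)}
    (hf : f ∈ wSubmodule ρ (PhaseIndex n)) : Integrable (weylFactor ħ Q f) := by
  have hγ2 := two_le_of_holderConjugate hconj hρ2
  have hc := continuous_expTransform (integrable_of_mem_wSubmodule hconj.lt hf)
  have hsF : sympFourier f.1 = fun s =>
      (((2 * Real.pi) ^ n : ℝ) : ℂ)⁻¹ * expTransform f (Omega n ℝ *ᵥ s) :=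
    funext (sympFourier_eq f.1)
  set q : ℝ := (n + n) * ∑ j, ∑ k, ‖Qtilde Q j k‖ with hq
  have hq0 : 0 ≤ q := by positivity
  set N : ℝ := |ħ| * q with hN
  have hN0 : 0 ≤ N := by positivity
  have hint := integrable_expTransform_mul_exp hconj.lt hf N
  rw [holderConjugate_inv hconj] at hint
  have hint' := measurePreserving_Omega.integrable_comp_of_integrable hint
  refine (hint'.const_mul (‖(((2 * Real.pi) ^ n : ℝ) : ℂ)⁻¹‖ * Real.exp N)).mono' ?_
    (ae_of_all _ fun s => ?_)
  · unfold weylFactor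
    rw [hsF]
    refine Continuous.aestronglyMeasurable ?_
    refine (continuous_const.mul (hc.comp continuous_Omega_mulVec)).mul ?_
    unfold dotProduct Matrix.mulVec dotProduct
    fun_prop
  · unfold weylFactor
    rw [hsF, norm_mul, norm_mul, Complex.norm_exp]
    have hs : ‖fun i => (s i : ℂ)‖ = ‖s‖ := by
      simp only [Pi.norm_def, Complex.nnnorm_real]
    have h1 : (Complex.I * ħ / 2 * ((fun i => (s i : ℂ)) ⬝ᵥ (Qtilde Q *ᵥ fun i => (s i : ℂ)))).re ≤
        N + N * ‖Omega n ℝ *ᵥ s‖ ^ γ := by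
      refine (Complex.re_le_norm _).trans ?_
      have h2 : ‖(fun i => (s i : ℂ)) ⬝ᵥ (Qtilde Q *ᵥ fun i => (s i : ℂ))‖ ≤ q * ‖s‖ ^ 2 := by
        refine (norm_dotProduct_le _ _).trans ?_
        have h3 := norm_mulVec_le (Qtilde Q) fun i => (s i : ℂ)
        rw [hs] at h3
        simp only [Fintype.card_sum, Fintype.card_fin, hs]
        push_cast
        calc ((n : ℝ) + n) * (‖s‖ * ‖Qtilde Q *ᵥ fun i => (s i : ℂ)‖)
            ≤ ((n : ℝ) + n) * (‖s‖ * ((∑ j, ∑ k, ‖Qtilde Q j k‖) * ‖s‖)) := by gcongr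
          _ = _ := by rw [hq]; ring
      have h4 : ‖s‖ ^ 2 ≤ 1 + ‖Omega n ℝ *ᵥ s‖ ^ γ := by
        have := rpow_le_one_add_rpow (norm_nonneg (Omega n ℝ *ᵥ s)) zero_le_two hγ2
        rw [Real.rpow_two] at this
        exact (pow_le_pow_left₀ (norm_nonneg _) (norm_le_norm_Omega_mulVec s) 2).trans this
      have h5 : ‖Complex.I * ħ / 2‖ ≤ |ħ| := by
        rw [norm_div, norm_mul, Complex.norm_I, one_mul, Complex.norm_real, Real.norm_eq_abs]
        simp only [Complex.norm_ofNat]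
        linarith [abs_nonneg ħ]
      rw [norm_mul]
      calc _ ≤ |ħ| * (q * ‖s‖ ^ 2) := by gcongr
        _ ≤ |ħ| * (q * (1 + ‖Omega n ℝ *ᵥ s‖ ^ γ)) := by gcongr
        _ = _ := by rw [hN]; ring
    have h6 := Real.exp_le_exp.2 h1
    rw [Real.exp_add] at h6
    calc _ ≤ ‖(((2 * Real.pi) ^ n : ℝ) : ℂ)⁻¹‖ * ‖expTransform f.1 (Omega n ℝ *ᵥ s)‖ *
          (Real.exp N * Real.exp (N * ‖Omega n ℝ *ᵥ s‖ ^ γ)) := by gcongr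
      _ = _ := by simp only [Function.comp_apply]; ring

/-- For `f ∈ 𝒲^ρ`, the function `J(f) ψ` is on `ℝⁿ` the pointwise integral of the integrand that
defines the Weyl operator. -/
theorem weylMap_eq_integral (hconj : ρ.HolderConjugate γ) (hρ2 : ρ ≤ 2) {ħ : ℝ} (hħ : ħ ≠ 0)
    (Q : Matrix (PhaseIndex n) (PhaseIndex n) ℂ) {f : ESpace ρ (PhaseIndex n)}
    (hf : f ∈ wSubmodule ρ (PhaseIndex n)) (ψ : GSSpace γ ρ n) (y : Fin n → ℝ) :
    realRestrict (weylMap hconj hρ2 ħ Q f ψ) y =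
      (((2 * Real.pi) ^ n : ℝ) : ℂ)⁻¹ *
        ∫ s, weylFactor ħ Q f s * translateFun ħ (ħ • s) (realRestrict ψ) y := by
  set z : Fin n → ℂ := fun j => (y j : ℂ)
  obtain ⟨A, B, hB, hc⟩ := exists_coefBound_weylKernel_of_gsSpace hconj hρ2 ħ Q ψ z
  have hG := differentiable_weylKernel_right ħ Q ψ.differentiable z
  have hcont := continuous_expTransform (integrable_of_mem_wSubmodule hconj.lt hf)
  have hcontK : Continuous fun ξ : PhaseIndex n → ℝ => weylKernel ħ Q ψ z fun j => ((-ξ) j : ℂ) :=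
    hG.continuous.comp (by fun_prop)
  change pair (taylorCoef (weylKernel ħ Q ψ z)) f = _
  rw [pair_eq_integral hconj.lt hf hB hc]
  simp only [pair_taylorCoef_expFun hG]
  rw [← integral_comp_Omega (F := fun ξ => ((((2 * Real.pi) ^ Fintype.card (PhaseIndex n) : ℝ) : ℂ)⁻¹ *
    expTransform f.1 ξ) * weylKernel ħ Q ψ.1 z fun j => ((-ξ) j : ℂ))
    ((continuous_const.mul hcont).mul hcontK), ← integral_const_mul]
  refine integral_congr_ae (ae_of_all _ fun s => ?_)
  simp only
  rw [weylKernel_neg_Omega hħ]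
  unfold weylFactor
  rw [sympFourier_eq, Fintype.card_sum, Fintype.card_fin, pow_add]
  push_cast
  rw [mul_inv]
  ring

end Symplectic

/-! ### The phase space translations on `L²(ℝⁿ)` -/

section Translation

variable {n : ℕ}

/-- The exponential factor `e^{(i/ħ)(p·y - p·q/2)}` of the operator `T_x`. -/
noncomputable def translatePhase (ħ : ℝ) (x : PhaseIndex n → ℝ) (y : Fin n → ℝ) : ℂ :=
  Complex.exp (Complex.I *
      (((((x ∘ Sum.inl) ⬝ᵥ y) - ((x ∘ Sum.inl) ⬝ᵥ (x ∘ Sum.inr)) / 2) / ħ : ℝ) : ℂ))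

theorem norm_translatePhase (ħ : ℝ) (x : PhaseIndex n → ℝ) (y : Fin n → ℝ) :
    ‖translatePhase ħ x y‖ = 1 := by
  unfold translatePhase
  rw [mul_comm, Complex.norm_exp_ofReal_mul_I]

theorem continuous_translatePhase {X : Type*} [TopologicalSpace X] (ħ : ℝ)
    {x : X → PhaseIndex n → ℝ} {y : X → Fin n → ℝ} (hx : Continuous x) (hy : Continuous y) :
    Continuous fun t => translatePhase ħ (x t) (y t) := by
  unfold translatePhase dotProduct
  simp only [Function.comp_apply]
  fun_prop

theorem coeFn_translateOp (ħ : ℝ) (x : PhaseIndex n → ℝ) (u : L2 n) :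
    translateOp ħ x u =ᵐ[volume] translateFun ħ x u :=
  MemLp.coeFn_toLp _

theorem norm_translateFun (ħ : ℝ) (x : PhaseIndex n → ℝ) (u : (Fin n → ℝ) → ℂ) (y : Fin n → ℝ) :
    ‖translateFun ħ x u y‖ = ‖u (y - x ∘ Sum.inr)‖ := by
  change ‖translatePhase ħ x y * u (y - x ∘ Sum.inr)‖ = _
  rw [norm_mul, norm_translatePhase, one_mul]

theorem translateFun_ae_congr (ħ : ℝ) (x : PhaseIndex n → ℝ) {u v : (Fin n → ℝ) → ℂ}
    (h : u =ᵐ[volume] v) : translateFun ħ x u =ᵐ[volume] translateFun ħ x v := by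
  have h1 := (measurePreserving_sub_right volume (x ∘ Sum.inr)).quasiMeasurePreserving.ae_eq_comp h
  filter_upwards [h1] with y hy
  have hy' : u (y - x ∘ Sum.inr) = v (y - x ∘ Sum.inr) := hy
  unfold translateFun
  rw [hy']

theorem translateOp_add (ħ : ℝ) (x : PhaseIndex n → ℝ) (u v : L2 n) :
    translateOp ħ x (u + v) = translateOp ħ x u + translateOp ħ x v := by
  refine Lp.ext ?_
  filter_upwards [coeFn_translateOp ħ x (u + v), coeFn_translateOp ħ x u, coeFn_translateOp ħ x v,
    Lp.coeFn_add (translateOp ħ x u) (translateOp ħ x v),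
    translateFun_ae_congr ħ x (Lp.coeFn_add u v)] with y h1 h2 h3 h4 h5
  rw [h1, h5, h4, Pi.add_apply, h2, h3]
  exact mul_add _ _ _

theorem translateOp_smul (ħ : ℝ) (x : PhaseIndex n → ℝ) (c : ℂ) (u : L2 n) :
    translateOp ħ x (c • u) = c • translateOp ħ x u := by
  refine Lp.ext ?_
  filter_upwards [coeFn_translateOp ħ x (c • u), coeFn_translateOp ħ x u,
    Lp.coeFn_smul c (translateOp ħ x u),
    translateFun_ae_congr ħ x (Lp.coeFn_smul c u)] with y h1 h2 h4 h5
  rw [h1, h5, h4, Pi.smul_apply, h2]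
  exact mul_left_comm _ _ _

theorem norm_translateOp (ħ : ℝ) (x : PhaseIndex n → ℝ) (u : L2 n) :
    ‖translateOp ħ x u‖ = ‖u‖ := by
  rw [translateOp, Lp.norm_toLp, Lp.norm_def]
  congr 1
  rw [eLpNorm_congr_norm_ae (ae_of_all _ (norm_translateFun ħ x u))]
  exact eLpNorm_comp_measurePreserving (Lp.aestronglyMeasurable u)
    (measurePreserving_sub_right volume (x ∘ Sum.inr))

theorem memLp_translatePhase_mul (ħ : ℝ) (x : PhaseIndex n → ℝ) (v : L2 n) :
    MemLp (fun y => translatePhase ħ x y * v y) 2 volume := by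
  refine (Lp.memLp v).of_le (AEStronglyMeasurable.mul
    (continuous_translatePhase ħ continuous_const continuous_id).aestronglyMeasurable (Lp.aestronglyMeasurable v)) (ae_of_all _ fun y => ?_)
  rw [norm_mul, norm_translatePhase, one_mul]

theorem norm_sq_eq_integral (w : L2 n) : ‖w‖ ^ 2 = ∫ y, ‖w y‖ ^ 2 := by
  have h2 := inner_self_eq_norm_sq_to_K (𝕜 := ℂ) w
  rw [L2.inner_def] at h2
  have h3 : (∫ y, inner ℂ (w y) (w y)) = ((∫ y, ‖w y‖ ^ 2 : ℝ) : ℂ) := by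
    rw [← integral_complex_ofReal]
    refine integral_congr_ae (ae_of_all _ fun y => ?_)
    simp only
    rw [inner_self_eq_norm_sq_to_K]
    simp
  rw [h3] at h2
  refine Complex.ofReal_injective (h2.trans ?_).symm
  exact (RCLike.ofReal_pow _ _).symm

/-- The strong continuity of the multiplication by `e^{(i/ħ)(p·y - p·q/2)}`. -/
theorem tendsto_translatePhase_mul (ħ : ℝ) (x₀ : PhaseIndex n → ℝ) (v : L2 n) :
    Tendsto (fun x => (memLp_translatePhase_mul ħ x v).toLp _) (𝓝 x₀)
      (𝓝 ((memLp_translatePhase_mul ħ x₀ v).toLp _)) := by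
  rw [tendsto_iff_norm_sub_tendsto_zero]
  have hsq : Tendsto (fun x => ‖(memLp_translatePhase_mul ħ x v).toLp _ -
      (memLp_translatePhase_mul ħ x₀ v).toLp _‖ ^ 2) (𝓝 x₀) (𝓝 0) := by
    have heq : ∀ x, ‖(memLp_translatePhase_mul ħ x v).toLp _ -
        (memLp_translatePhase_mul ħ x₀ v).toLp _‖ ^ 2 =
        ∫ y, ‖translatePhase ħ x y * v y - translatePhase ħ x₀ y * v y‖ ^ 2 := fun x => by
      rw [← MemLp.toLp_sub, norm_sq_eq_integral]
      refine integral_congr_ae ?_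
      filter_upwards [MemLp.coeFn_toLp ((memLp_translatePhase_mul ħ x v).sub
        (memLp_translatePhase_mul ħ x₀ v))] with y hy
      rw [hy]
      rfl
    simp only [heq]
    have h0 : (0 : ℝ) = ∫ y, ‖translatePhase ħ x₀ y * v y - translatePhase ħ x₀ y * v y‖ ^ 2 := by
      simp
    rw [h0]
    refine tendsto_integral_filter_of_dominated_convergence (fun y => (2 * ‖v y‖) ^ 2)
      (Eventually.of_forall fun x => ((memLp_translatePhase_mul ħ x v).1.sub
        (memLp_translatePhase_mul ħ x₀ v).1).norm.pow 2)
      (Eventually.of_forall fun x => ae_of_all _ fun y => ?_) ?_ (ae_of_all _ fun y => ?_)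
    · rw [Real.norm_of_nonneg (by positivity)]
      refine pow_le_pow_left₀ (norm_nonneg _) ((norm_sub_le _ _).trans_eq ?_) 2
      rw [norm_mul, norm_mul, norm_translatePhase, norm_translatePhase]
      ring
    · have := (memLp_two_iff_integrable_sq_norm (Lp.aestronglyMeasurable v)).1 (Lp.memLp v)
      refine (this.const_mul 4).congr (ae_of_all _ fun y => ?_)
      simp only
      ring
    · have hc : Continuous fun x => translatePhase ħ x y :=
        continuous_translatePhase ħ continuous_id continuous_const
      exact (((hc.mul continuous_const).sub continuous_const).norm.pow 2).tendsto x₀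
  have := hsq.sqrt
  simpa only [Real.sqrt_sq (norm_nonneg _), Real.sqrt_zero] using this

/-- The strong continuity of the phase space translations. -/
theorem continuous_translateOp (ħ : ℝ) (u : L2 n) : Continuous fun x => translateOp ħ x u := by
  set S : (PhaseIndex n → ℝ) → C(Fin n → ℝ, Fin n → ℝ) :=
    fun x => ⟨fun y => y - x ∘ Sum.inr, by fun_prop⟩ with hS
  have hSm : ∀ x, MeasurePreserving (S x) volume volume := fun x =>
    measurePreserving_sub_right volume (x ∘ Sum.inr)
  have hSc : Continuous S := by
    refine ContinuousMap.continuous_of_continuous_uncurry _ ?_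
    simp only [hS]
    change Continuous fun p : (PhaseIndex n → ℝ) × (Fin n → ℝ) => p.2 - p.1 ∘ Sum.inr
    fun_prop
  set A : (PhaseIndex n → ℝ) → L2 n := fun x => Lp.compMeasurePreserving (S x) (hSm x) u with hA
  have hAc : Continuous A :=
    continuous_const.compMeasurePreservingLp hSc hSm ENNReal.ofNat_ne_top
  have hT : ∀ x, translateOp ħ x u = (memLp_translatePhase_mul ħ x (A x)).toLp _ := fun x => by
    refine (MemLp.toLp_eq_toLp_iff _ _).2 ?_
    filter_upwards [Lp.coeFn_compMeasurePreserving u (hSm x)] with y hy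
    rw [hA]
    simp only
    rw [hy]
    rfl
  have hsub : ∀ x (v w : L2 n), ‖(memLp_translatePhase_mul ħ x v).toLp _ -
      (memLp_translatePhase_mul ħ x w).toLp _‖ ≤ ‖v - w‖ := fun x v w => by
    refine Lp.norm_le_norm_of_ae_le ?_
    rw [← MemLp.toLp_sub]
    filter_upwards [MemLp.coeFn_toLp ((memLp_translatePhase_mul ħ x v).sub
      (memLp_translatePhase_mul ħ x w)), Lp.coeFn_sub v w] with y h1 h2
    rw [h1, h2, Pi.sub_apply, Pi.sub_apply, ← mul_sub, norm_mul, norm_translatePhase, one_mul]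
  rw [continuous_iff_continuousAt]
  intro x₀
  have h1 := tendsto_iff_norm_sub_tendsto_zero.1 (tendsto_translatePhase_mul ħ x₀ (A x₀))
  have h2 := tendsto_iff_norm_sub_tendsto_zero.1 (hAc.tendsto x₀)
  refine tendsto_iff_norm_sub_tendsto_zero.2 (squeeze_zero (fun _ => norm_nonneg _) (fun x => ?_)
    (by simpa using h2.add h1))
  change ‖translateOp ħ x u - translateOp ħ x₀ u‖ ≤ _
  rw [hT, hT]
  refine (norm_sub_le_norm_sub_add_norm_sub _ ((memLp_translatePhase_mul ħ x (A x₀)).toLp _) _).trans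
    (add_le_add_left (hsub x _ _) _)

end Translation

/-! ### The Weyl operators on `L²(ℝⁿ)` -/

section WeylOperator

variable {n : ℕ} {ρ γ : ℝ}

theorem integrable_weylIntegrand (hconj : ρ.HolderConjugate γ) (hρ2 : ρ ≤ 2) (ħ : ℝ)
    (Q : Matrix (PhaseIndex n) (PhaseIndex n) ℂ) {f : ESpace ρ (PhaseIndex n)}
    (hf : f ∈ wSubmodule ρ (PhaseIndex n)) (u : L2 n) : Integrable (weylIntegrand ħ Q f u) := by
  have h := integrable_weylFactor hconj hρ2 ħ Q hf
  have hT : Continuous fun s : PhaseIndex n → ℝ => translateOp ħ (ħ • s) u :=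
    (continuous_translateOp ħ u).comp (continuous_const_smul ħ)
  refine (h.norm.mul_const ‖u‖).mono' (h.1.smul hT.aestronglyMeasurable) (ae_of_all _ fun s => ?_)
  change ‖weylFactor ħ Q f s • translateOp ħ (ħ • s) u‖ ≤ _
  rw [norm_smul, norm_translateOp]

theorem sympFourier_add (hρ : 1 < ρ) {f g : ESpace ρ (PhaseIndex n)}
    (hf : f ∈ wSubmodule ρ (PhaseIndex n)) (hg : g ∈ wSubmodule ρ (PhaseIndex n))
    (s : PhaseIndex n → ℝ) :
    sympFourier (f + g : ESpace ρ (PhaseIndex n)).1 s = sympFourier f s + sympFourier g s := by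
  have h : ∀ {f : ESpace ρ (PhaseIndex n)}, f ∈ wSubmodule ρ (PhaseIndex n) →
      Integrable fun x => f x * Complex.exp (Complex.I * omegaForm x s) := fun {f} hf => by
    have hi := integrable_of_mem_wSubmodule hρ hf
    refine hi.mono (hi.1.mul (Continuous.aestronglyMeasurable ?_)) (ae_of_all _ fun x => ?_)
    · unfold omegaForm dotProduct
      fun_prop
    · rw [norm_mul, mul_comm Complex.I, Complex.norm_exp_ofReal_mul_I, mul_one]
  unfold sympFourier
  rw [← mul_add, ← integral_add (h hf) (h hg)]
  simp only [ESpace.add_coe, Pi.add_apply, add_mul]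

theorem sympFourier_smul (c : ℂ) (f : ESpace ρ (PhaseIndex n)) (s : PhaseIndex n → ℝ) :
    sympFourier (c • f : ESpace ρ (PhaseIndex n)).1 s = c * sympFourier f s := by
  unfold sympFourier
  rw [mul_left_comm c, ← integral_const_mul c]
  simp only [ESpace.smul_coe, Pi.smul_apply, smul_eq_mul, mul_assoc]

/-- The Weyl operator `(2π)^{-n} ∫ f̃(s) e^{(iħ/2) s·Q̃s} T_{ħs} ds`. -/
noncomputable def weylOperator (hconj : ρ.HolderConjugate γ) (hρ2 : ρ ≤ 2) (ħ : ℝ)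
    (Q : Matrix (PhaseIndex n) (PhaseIndex n) ℂ) (f : wSubmodule ρ (PhaseIndex n)) :
    L2 n →L[ℂ] L2 n :=
  LinearMap.mkContinuous
    { toFun := fun u => (((2 * Real.pi) ^ n : ℝ) : ℂ)⁻¹ • ∫ s, weylIntegrand ħ Q f.1 u s
      map_add' := fun u v => by
        rw [← smul_add, ← integral_add (integrable_weylIntegrand hconj hρ2 ħ Q f.2 u)
          (integrable_weylIntegrand hconj hρ2 ħ Q f.2 v)]
        simp only [weylIntegrand, translateOp_add, smul_add]
      map_smul' := fun c u => by
        rw [RingHom.id_apply, smul_comm c, ← integral_smul c]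
        simp only [weylIntegrand, translateOp_smul, smul_comm c] }
    (‖(((2 * Real.pi) ^ n : ℝ) : ℂ)⁻¹‖ * ∫ s, ‖weylFactor ħ Q f.1 s‖) fun u => by
      change ‖(((2 * Real.pi) ^ n : ℝ) : ℂ)⁻¹ • ∫ s, weylIntegrand ħ Q f.1 u s‖ ≤ _
      rw [norm_smul, mul_assoc, ← integral_mul_const]
      refine mul_le_mul_of_nonneg_left (norm_integral_le_of_norm_le
        ((integrable_weylFactor hconj hρ2 ħ Q f.2).norm.mul_const _) (ae_of_all _ fun s => ?_))
        (norm_nonneg _)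
      change ‖weylFactor ħ Q f s • translateOp ħ (ħ • s) u‖ ≤ _
      rw [norm_smul, norm_translateOp]

theorem isWeylOperator_weylOperator (hconj : ρ.HolderConjugate γ) (hρ2 : ρ ≤ 2) (ħ : ℝ)
    (Q : Matrix (PhaseIndex n) (PhaseIndex n) ℂ) (f : wSubmodule ρ (PhaseIndex n)) :
    IsWeylOperator ħ Q f.1 (weylOperator hconj hρ2 ħ Q f) :=
  fun u => ⟨integrable_weylIntegrand hconj hρ2 ħ Q f.2 u, rfl⟩

/-- The generalized Weyl map `f ↦ (2π)^{-n} ∫ f̃(s) e^{(iħ/2) s·Q̃s} T_{ħs} ds`. -/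
noncomputable def weylOperatorLin (hconj : ρ.HolderConjugate γ) (hρ2 : ρ ≤ 2) (ħ : ℝ)
    (Q : Matrix (PhaseIndex n) (PhaseIndex n) ℂ) :
    wSubmodule ρ (PhaseIndex n) →ₗ[ℂ] (L2 n →L[ℂ] L2 n) where
  toFun := weylOperator hconj hρ2 ħ Q
  map_add' f g := by
    refine ContinuousLinearMap.ext fun u => ?_
    change (((2 * Real.pi) ^ n : ℝ) : ℂ)⁻¹ • ∫ s, weylIntegrand ħ Q (f.1 + g.1 : ESpace ρ (PhaseIndex n)).1 u s =
      (((2 * Real.pi) ^ n : ℝ) : ℂ)⁻¹ • (∫ s, weylIntegrand ħ Q f.1 u s) + (((2 * Real.pi) ^ n : ℝ) : ℂ)⁻¹ • ∫ s, weylIntegrand ħ Q g.1 u s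
    rw [← smul_add, ← integral_add (integrable_weylIntegrand hconj hρ2 ħ Q f.2 u)
      (integrable_weylIntegrand hconj hρ2 ħ Q g.2 u)]
    simp only [weylIntegrand, sympFourier_add hconj.lt f.2 g.2, add_mul, add_smul]
  map_smul' c f := by
    refine ContinuousLinearMap.ext fun u => ?_
    change (((2 * Real.pi) ^ n : ℝ) : ℂ)⁻¹ • ∫ s, weylIntegrand ħ Q (c • f.1 : ESpace ρ (PhaseIndex n)).1 u s =
      c • (((2 * Real.pi) ^ n : ℝ) : ℂ)⁻¹ • ∫ s, weylIntegrand ħ Q f.1 u s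
    rw [smul_comm c, ← integral_smul c]
    simp only [weylIntegrand, sympFourier_smul, mul_assoc, mul_smul]

theorem inner_eq_integral (v w : L2 n) :
    inner ℂ v w = ∫ y, w y * (starRingEnd ℂ) (v y) := by
  rw [L2.inner_def]
  rfl

/-- The operator `J(f)` on the space of entire functions is the restriction of the Weyl operator
of `f ∈ 𝒲^ρ`: the weak integral can be evaluated pointwise, by Fubini's theorem. -/
theorem extends_weylMap (hconj : ρ.HolderConjugate γ) (hρ2 : ρ ≤ 2) {ħ : ℝ} (hħ : ħ ≠ 0)
    (Q : Matrix (PhaseIndex n) (PhaseIndex n) ℂ) :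
    Extends hconj.lt (weylOperatorLin hconj hρ2 ħ Q) (weylMap hconj hρ2 ħ Q) := by
  intro f ψ
  refine ext_inner_left ℂ fun v => ?_
  set c : ℂ := (((2 * Real.pi) ^ n : ℝ) : ℂ)⁻¹ with hc
  set w := weylFactor ħ Q f.1 with hw
  have hwi : Integrable w := integrable_weylFactor hconj hρ2 ħ Q f.2
  have hψ := realRestrict_memLp hconj.lt ψ
  have hψc : Continuous (realRestrict ψ) := ψ.differentiable.continuous.comp (by fun_prop)
  have hT : ∀ s, translateOp ħ (ħ • s) (toL2 hconj.lt ψ) =ᵐ[volume]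
      translateFun ħ (ħ • s) (realRestrict ψ) := fun s =>
    (coeFn_translateOp _ _ _).trans (translateFun_ae_congr _ _ (MemLp.coeFn_toLp _))
  -- both sides are iterated integrals of the same function of `s` and `y`
  have hleft : inner ℂ v (toL2 hconj.lt (weylMap hconj hρ2 ħ Q f.1 ψ)) =
      c * ∫ y, ∫ s, w s * translateFun ħ (ħ • s) (realRestrict ψ) y * (starRingEnd ℂ) (v y) := by
    rw [inner_eq_integral, ← integral_const_mul]
    refine integral_congr_ae ?_
    filter_upwards [MemLp.coeFn_toLp (realRestrict_memLp hconj.lt (weylMap hconj hρ2 ħ Q f.1 ψ))]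
      with y hy
    change toL2 hconj.lt (weylMap hconj hρ2 ħ Q f.1 ψ) y = _ at hy
    rw [hy, weylMap_eq_integral hconj hρ2 hħ Q f.2, integral_mul_const, mul_assoc]
  have hright : inner ℂ v (weylOperatorLin hconj hρ2 ħ Q f (toL2 hconj.lt ψ)) =
      c * ∫ s, ∫ y, w s * translateFun ħ (ħ • s) (realRestrict ψ) y * (starRingEnd ℂ) (v y) := by
    change inner ℂ v (c • ∫ s, weylIntegrand ħ Q f.1 (toL2 hconj.lt ψ) s) = _
    rw [inner_smul_right, ← integral_inner (integrable_weylIntegrand hconj hρ2 ħ Q f.2 _)]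
    congr 1
    refine integral_congr_ae (ae_of_all _ fun s => ?_)
    change inner ℂ v (w s • translateOp ħ (ħ • s) (toL2 hconj.lt ψ)) = _
    rw [inner_smul_right, inner_eq_integral, ← integral_const_mul]
    refine integral_congr_ae ?_
    filter_upwards [hT s] with y hy
    rw [hy, mul_assoc]
  rw [hleft, hright]
  congr 1
  symm
  refine integral_integral_swap ?_
  have hm : AEStronglyMeasurable (fun p : (PhaseIndex n → ℝ) × (Fin n → ℝ) =>
      w p.1 * translateFun ħ (ħ • p.1) (realRestrict ψ) p.2 * (starRingEnd ℂ) (v p.2))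
      (volume.prod volume) := by
    refine (hwi.1.comp_fst.mul (Continuous.aestronglyMeasurable ?_)).mul
      (Complex.continuous_conj.comp_aestronglyMeasurable (Lp.aestronglyMeasurable v).comp_snd)
    refine Continuous.mul (continuous_translatePhase ħ (continuous_fst.const_smul ħ)
      continuous_snd) (hψc.comp ?_)
    change Continuous fun p : (PhaseIndex n → ℝ) × (Fin n → ℝ) => p.2 - fun j => ħ * p.1 (Sum.inr j)
    fun_prop
  have hvsq := (memLp_two_iff_integrable_sq_norm (Lp.aestronglyMeasurable v)).1 (Lp.memLp v)
  have hψsq := (memLp_two_iff_integrable_sq_norm hψ.1).1 hψ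
  have hψsqs : ∀ s : PhaseIndex n → ℝ,
      Integrable fun y => ‖realRestrict ψ (y - (ħ • s) ∘ Sum.inr)‖ ^ 2 := fun s =>
    hψsq.comp_sub_right ((ħ • s) ∘ Sum.inr)
  have hbound : ∀ s y, ‖w s * translateFun ħ (ħ • s) (realRestrict ψ) y * (starRingEnd ℂ) (v y)‖ ≤
      ‖w s‖ * (‖realRestrict ψ (y - (ħ • s) ∘ Sum.inr)‖ ^ 2 + ‖v y‖ ^ 2) := fun s y => by
    rw [norm_mul, norm_mul, norm_translateFun, RCLike.norm_conj, mul_assoc]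
    refine mul_le_mul_of_nonneg_left ?_ (norm_nonneg _)
    nlinarith [sq_nonneg (‖realRestrict ψ (y - (ħ • s) ∘ Sum.inr)‖ - ‖v y‖),
      sq_nonneg (‖realRestrict ψ (y - (ħ • s) ∘ Sum.inr)‖), sq_nonneg ‖v y‖]
  have hbi : ∀ s, Integrable fun y =>
      ‖w s‖ * (‖realRestrict ψ (y - (ħ • s) ∘ Sum.inr)‖ ^ 2 + ‖v y‖ ^ 2) := fun s =>
    ((hψsqs s).add hvsq).const_mul _
  refine (integrable_prod_iff hm).2 ⟨?_, ?_⟩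
  · filter_upwards [hm.prodMk_left] with s hs
    exact (hbi s).mono' hs (ae_of_all _ (hbound s))
  · refine (hwi.norm.mul_const ((∫ y, ‖realRestrict ψ y‖ ^ 2) + ∫ y, ‖v y‖ ^ 2)).mono'
      hm.norm.integral_prod_right' (ae_of_all _ fun s => ?_)
    rw [Real.norm_of_nonneg (integral_nonneg fun _ => norm_nonneg _)]
    refine (integral_mono_of_nonneg (ae_of_all _ fun _ => norm_nonneg _) (hbi s)
      (ae_of_all _ (hbound s))).trans_eq ?_
    rw [integral_const_mul, integral_add (hψsqs s) hvsq]
    congr 2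
    exact integral_sub_right_eq_self (fun y => ‖realRestrict ψ y‖ ^ 2) ((ħ • s) ∘ Sum.inr)

end WeylOperator

/-! ### Density of the entire functions in `L²(ℝⁿ)` -/

section Density

/-- An integrable function whose Fourier transform vanishes is zero almost everywhere. -/
theorem ae_eq_zero_of_expTransform_eq_zero {ι : Type} [Fintype ι] [DecidableEq ι]
    {g : (ι → ℝ) → ℂ} (hg : Integrable g) (h0 : expTransform g = 0) : ∀ᵐ x, g x = 0 := by
  refine ae_eq_zero_of_integral_contDiff_smul_eq_zero hg.locallyIntegrable fun h hh hhs => ?_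
  have hh' : ContDiff ℝ ∞ fun x => (h x : ℂ) := Complex.ofRealCLM.contDiff.comp hh
  have hhs' : HasCompactSupport fun x => (h x : ℂ) :=
    hhs.comp_left (g := fun t : ℝ => (t : ℂ)) Complex.ofReal_zero
  have hF : Integrable (expTransform fun x => (h x : ℂ)) :=
    integrable_of_mem_wSubmodule one_lt_two (testTransform one_lt_two hh' hhs').2
  have hinv := integral_expTransform hh'.continuous
    (hh'.continuous.integrable_of_hasCompactSupport hhs') hF
  set H := expTransform fun x => (h x : ℂ) with hH
  set c : ℂ := (((2 * Real.pi) ^ Fintype.card ι : ℝ) : ℂ)⁻¹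
  have hflip : (fourierForm ι).toLinearMap₁₂.flip = (fourierForm ι).toLinearMap₁₂ := by
    refine LinearMap.ext fun v => LinearMap.ext fun w => ?_
    change fourierForm ι w v = fourierForm ι v w
    rw [fourierForm_apply, fourierForm_apply, dotProduct_comm]
  have key := VectorFourier.integral_fourierIntegral_smul_eq_flip (μ := volume) (ν := volume)
    (L := (fourierForm ι).toLinearMap₁₂) Real.continuous_fourierChar
    (by fun_prop : Continuous fun p : (ι → ℝ) × (ι → ℝ) => fourierForm ι p.1 p.2) hg
    (hF.comp_neg)
  rw [hflip, fourierIntegral_fourierForm, fourierIntegral_fourierForm, h0] at key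
  simp only [Pi.zero_apply, zero_smul, integral_zero] at key
  have hneg : ∀ x, (h x : ℂ) = c * expTransform (fun ξ => H (-ξ)) x := fun x => by
    rw [hinv x]
    congr 1
    unfold expTransform
    rw [← integral_neg_eq_self]
    refine integral_congr_ae (ae_of_all _ fun ξ => ?_)
    simp only [neg_neg]
    rw [expFun_comm]
  calc ∫ x, h x • g x = ∫ x, c * (g x • expTransform (fun ξ => H (-ξ)) x) := by
        refine integral_congr_ae (ae_of_all _ fun x => ?_)
        simp only
        rw [← Complex.coe_smul, hneg x]
        simp only [smul_eq_mul]
        ring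
    _ = 0 := by rw [integral_const_mul, ← key, mul_zero]

variable {n : ℕ} {ρ γ : ℝ}

/-- The entire function `e^{iη·z - z·z/2}`. -/
noncomputable def gaussianWave (hρ : 1 < ρ) (hρ2 : ρ ≤ 2) (hγ : 2 ≤ γ) (η : Fin n → ℝ) :
    GSSpace γ ρ n :=
  ⟨fun z => Complex.exp (∑ j, (Complex.I * η j * z j - z j ^ 2 / 2)), by fun_prop,
    1 / 2, n * ‖η‖ + n / 2 + 1, Real.exp (1 / 2 + n * ‖η‖ + n / 2), by norm_num, by positivity,
    Real.exp_pos _, fun q y => by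
      rw [Complex.norm_exp, ← Real.exp_add, Real.exp_le_exp, Complex.re_sum]
      have hterm : ∀ j, (Complex.I * η j * ((q j : ℂ) + Complex.I * (y j : ℂ)) -
          ((q j : ℂ) + Complex.I * (y j : ℂ)) ^ 2 / 2).re =
          -(η j * y j) - q j ^ 2 / 2 + y j ^ 2 / 2 := fun j => by
        have : Complex.I * η j * ((q j : ℂ) + Complex.I * (y j : ℂ)) -
          ((q j : ℂ) + Complex.I * (y j : ℂ)) ^ 2 / 2 =
          ((-(η j * y j) - q j ^ 2 / 2 + y j ^ 2 / 2 : ℝ) : ℂ) +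
            ((η j * q j - q j * y j : ℝ) : ℂ) * Complex.I := by
          push_cast
          linear_combination ((η j : ℂ) * y j - (y j : ℂ) ^ 2 / 2) * Complex.I_sq
        rw [this, Complex.add_re, Complex.ofReal_re, Complex.re_ofReal_mul, Complex.I_re, mul_zero,
          add_zero]
      rw [Finset.sum_congr rfl fun j _ => hterm j, Finset.sum_add_distrib, Finset.sum_sub_distrib]
      have h1 : ∑ j, -(η j * y j) ≤ n * (‖η‖ * ‖y‖) := by
        refine (Finset.sum_le_sum (g := fun _ => ‖η‖ * ‖y‖) fun j _ => ?_).trans_eq (by simp)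
        refine (neg_le_abs _).trans ?_
        rw [abs_mul]
        exact mul_le_mul (norm_le_pi_norm η j) (norm_le_pi_norm y j) (abs_nonneg _) (norm_nonneg _)
      have h2 : ∑ j, y j ^ 2 / 2 ≤ n * (‖y‖ ^ 2 / 2) := by
        refine (Finset.sum_le_sum (g := fun _ => ‖y‖ ^ 2 / 2) fun j _ => ?_).trans_eq (by simp)
        have := pow_le_pow_left₀ (norm_nonneg _) (norm_le_pi_norm y j) 2
        rw [Real.norm_eq_abs, sq_abs] at this
        linarith
      have h3 : ‖q‖ ^ 2 / 2 ≤ ∑ j, q j ^ 2 / 2 := by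
        rcases isEmpty_or_nonempty (Fin n) with hn | hn
        · rw [Subsingleton.elim q 0, norm_zero]
          simp
        · obtain ⟨j, hj⟩ := exists_abs_eq_norm q
          rw [← hj, sq_abs]
          exact Finset.single_le_sum (f := fun j => q j ^ 2 / 2) (fun i _ => by positivity)
            (Finset.mem_univ j)
      have h4 : ‖q‖ ^ ρ ≤ 1 + ‖q‖ ^ 2 := by
        simpa using rpow_le_one_add_rpow (norm_nonneg q) (zero_le_one.trans hρ.le) hρ2
      have h5 : ‖y‖ ≤ 1 + ‖y‖ ^ γ := by
        simpa using rpow_le_one_add_rpow (norm_nonneg y) zero_le_one (one_le_two.trans hγ)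
      have h6 : ‖y‖ ^ 2 ≤ 1 + ‖y‖ ^ γ := by
        simpa using rpow_le_one_add_rpow (norm_nonneg y) zero_le_two hγ
      have h7 : (n : ℝ) * (‖η‖ * ‖y‖) ≤ n * (‖η‖ * (1 + ‖y‖ ^ γ)) := by gcongr
      have h8 : (n : ℝ) * (‖y‖ ^ 2 / 2) ≤ n * ((1 + ‖y‖ ^ γ) / 2) := by gcongr
      have h9 : 0 ≤ ‖y‖ ^ γ := by positivity
      linarith⟩

theorem gaussianWave_apply (hρ : 1 < ρ) (hρ2 : ρ ≤ 2) (hγ : 2 ≤ γ) (η y : Fin n → ℝ) :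
    realRestrict (gaussianWave hρ hρ2 hγ η) y =
      realRestrict (gaussianWave hρ hρ2 hγ 0) y * expFun η y := by
  change Complex.exp (∑ j, (Complex.I * η j * (y j : ℂ) - (y j : ℂ) ^ 2 / 2)) =
    Complex.exp (∑ j, (Complex.I * ((0 : ℝ) : ℂ) * (y j : ℂ) - (y j : ℂ) ^ 2 / 2)) * _
  unfold expFun dotProduct
  rw [← Complex.exp_add]
  push_cast
  rw [Finset.mul_sum, ← Finset.sum_add_distrib]
  congr 1
  refine Finset.sum_congr rfl fun j _ => ?_
  ring

/-- The span of the functions `e^{iη·y - y·y/2}` is dense: if `v` is orthogonal to all of them, then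
the Fourier transform of the integrable function `v̄ e^{-y·y/2}` vanishes. -/
theorem dense_span_range_toL2 (hρ : 1 < ρ) (hρ2 : ρ ≤ 2) (hγ : 2 ≤ γ) :
    Dense (Submodule.span ℂ (Set.range (toL2 hρ : GSSpace γ ρ n → L2 n)) : Set (L2 n)) := by
  rw [Submodule.dense_iff_topologicalClosure_eq_top, Submodule.topologicalClosure_eq_top_iff,
    Submodule.eq_bot_iff]
  intro v hv
  set G := realRestrict (gaussianWave (n := n) hρ hρ2 hγ 0) with hG
  set g : (Fin n → ℝ) → ℂ := fun y => (starRingEnd ℂ) (v y) * G y with hg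
  have hinner : ∀ ψ : GSSpace γ ρ n, ∫ y, realRestrict ψ y * (starRingEnd ℂ) (v y) = 0 := fun ψ => by
    have h1 := (Submodule.mem_orthogonal' _ v).1 hv (toL2 hρ ψ)
      (Submodule.subset_span (Set.mem_range_self ψ))
    rw [inner_eq_integral] at h1
    rw [← h1]
    refine integral_congr_ae ?_
    filter_upwards [MemLp.coeFn_toLp (realRestrict_memLp hρ ψ)] with y hy
    change toL2 hρ ψ y = _ at hy
    rw [hy]
  have hgi : Integrable g :=
    (Lp.memLp v).star.integrable_mul (realRestrict_memLp hρ (gaussianWave (n := n) hρ hρ2 hγ 0))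
  have hg0 : expTransform g = 0 := by
    funext η
    rw [Pi.zero_apply, ← hinner (gaussianWave hρ hρ2 hγ η)]
    refine integral_congr_ae (ae_of_all _ fun y => ?_)
    simp only [hg]
    rw [gaussianWave_apply]
    ring
  have hGne : ∀ y, G y ≠ 0 := fun y => Complex.exp_ne_zero _
  refine Lp.eq_zero_iff_ae_eq_zero.2 ?_
  filter_upwards [ae_eq_zero_of_expTransform_eq_zero hgi hg0] with y hy
  simpa [hg, hGne y] using hy

end Density

/-! ### The homomorphism property of the Weyl map -/

section Homomorphism

variable {n : ℕ} {ρ γ : ℝ}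

/-- The Weyl map is a homomorphism, since it is the restriction of the homomorphism `J` and
`W^γ_ρ` is dense in `L²(ℝⁿ)`. -/
theorem weylOperatorLin_starE (hconj : ρ.HolderConjugate γ) (hρ2 : ρ ≤ 2) {ħ : ℝ} (hħ : ħ ≠ 0)
    {Q : Matrix (PhaseIndex n) (PhaseIndex n) ℂ} (hQ : Q.IsSymm)
    (f g : wSubmodule ρ (PhaseIndex n)) :
    weylOperatorLin hconj hρ2 ħ Q ⟨starE hconj.lt hρ2 ħ (theta Q) f.1 g.1,
        starE_mem_wSubmodule hconj.lt hρ2 ħ (theta Q) f.2 g.2⟩ =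
      (weylOperatorLin hconj hρ2 ħ Q f).comp (weylOperatorLin hconj hρ2 ħ Q g) := by
  refine ContinuousLinearMap.ext_on
    (dense_span_range_toL2 hconj.lt hρ2 (two_le_of_holderConjugate hconj hρ2)) ?_
  rintro _ ⟨ψ, rfl⟩
  have h := extends_weylMap (n := n) hconj hρ2 hħ Q
  rw [ContinuousLinearMap.comp_apply, ← h, ← h, ← h, weylMap_starE hconj hρ2 ħ hQ]
  rfl

end Homomorphism

end StarAlgebra

theorem theorem6 (n : ℕ) (ρ ρ' ħ : ℝ) (hρ : 1 < ρ) (hρ2 : ρ ≤ 2) (hρ' : ρ' = ρ / (ρ - 1))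
    (hħ : 0 < ħ) (Q : Matrix (PhaseIndex n) (PhaseIndex n) ℂ) (hQ : Q.IsSymm) :
    ∃ j : wSubmodule ρ (PhaseIndex n) →ₗ[ℂ] (L2 n →L[ℂ] L2 n),
      (∀ f : wSubmodule ρ (PhaseIndex n), IsWeylOperator ħ Q f.1 (j f)) ∧
      (∀ f g : wSubmodule ρ (PhaseIndex n), ∃ h : wSubmodule ρ (PhaseIndex n),
        IsStarProduct ħ (theta Q) f.1 g.1 h.1 ∧ j h = (j f).comp (j g)) ∧
      ∃ J : ESpace ρ (PhaseIndex n) →L[ℂ] OperatorAlgebra ρ' ρ n,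
        Extends hρ j J ∧
        (∀ f g : ESpace ρ (PhaseIndex n), ∃ h : ESpace ρ (PhaseIndex n),
          IsStarProduct ħ (theta Q) f g h ∧ J h = (J f).comp (J g)) ∧
        (∃ e : ESpace ρ (PhaseIndex n), (∀ x, e x = 1) ∧
          J e = ContinuousLinearMap.id ℂ (GSSpace ρ' ρ n)) ∧
        ∀ J' : ESpace ρ (PhaseIndex n) →L[ℂ] OperatorAlgebra ρ' ρ n,
          Extends hρ j J' → J' = J := by
  have hconj : ρ.HolderConjugate ρ' := (Real.holderConjugate_iff_eq_conjExponent hρ).2 hρ'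
  have hext := extends_weylMap (n := n) hconj hρ2 hħ.ne' Q
  refine ⟨weylOperatorLin hconj hρ2 ħ Q, isWeylOperator_weylOperator hconj hρ2 ħ Q,
    fun f g => ⟨⟨_, starE_mem_wSubmodule hρ hρ2 ħ (theta Q) f.2 g.2⟩,
      isStarProduct_starE hρ hρ2 ħ (theta Q) f.1 g.1,
      weylOperatorLin_starE hconj hρ2 hħ.ne' hQ f g⟩,
    weylMap hconj hρ2 ħ Q, hext,
    fun f g => ⟨starE hρ hρ2 ħ (theta Q) f g, isStarProduct_starE hρ hρ2 ħ (theta Q) f g,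
      weylMap_starE hconj hρ2 ħ hQ f g⟩,
    ⟨expE hρ 0, expE_zero_apply hρ, weylMap_one hconj hρ2 ħ Q⟩, fun J' hJ' => ?_⟩
  refine operator_eq_of_wSubmodule hρ fun f hf => ContinuousLinearMap.ext fun ψ => ?_
  exact toL2_injective hρ ((hJ' ⟨f, hf⟩ ψ).trans (hext ⟨f, hf⟩ ψ).symm)
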